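/- Let $n\ge 1$, $0<\lambda\le\Lambda$, $0<\sigma<1$ and $0<\alpha<1$. For a function $u$ on $\mathbb R^n\times\mathbb R$ let $$\partial_t^\alpha u(x,t)=\frac{\alpha}{\Gamma(1-\alpha)}\int_{-\infty}^t\frac{u(x,t)-u(x,s)}{(t-s)^{1+\alpha}}\,ds$$ (the Caputo derivative), and let $$Iu(x,t)=\sup_{i}\inf_{j}\ \mathrm{p.v.}\!\int_{\mathbb R^n}\frac{u(x+y,t)-u(x,t)}{|y|^{n+2\sigma}}\,a^{ij}(t,x,y)\,dy ,$$ where $i,j$ range over arbitrary nonempty index sets, the $a^{ij}$ are measurable in $y$, $a^{ij}(t,x,y)=a^{ij}(t,x,-y)$ and $\lambda\le a^{ij}\le\Lambda$. For a set $D\subset\mathbb R^n\times\mathbb R$, a function $u$ that is continuous on $D$ is a viscosity subsolution (supersolution) of $\partial_t^\alpha u-Iu=f$ in $D$ if, whenever a $C^2$ function $\varphi$ touches $u$ from above (below) on a cylinder $\mathcal C=B_r(x_1)\times[t_1,t_2]\subset D$ at a point $(x_0,t_0)\in\mathcal C$ with $t_0>t_1$, the function $v$ equal to $\varphi$ on $\mathcal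 C$ and to $u$ elsewhere satisfies $\partial_t^\alpha v-Iv\le f$ ($\ge f$) at $(x_0,t_0)$. A viscosity solution is both. **Theorem.** There are constants $\nu,\varepsilon_0,C,\kappa>0$, with $\nu<\min\{\alpha,2\sigma\}$, depending only on $n,\lambda,\Lambda,\sigma,\alpha$ and uniform as $\alpha\to1$ (for each $\alpha_0\in(0,1)$ they can be chosen the same for all $\alpha\in[\alpha_0,1)$), such that the following holds. Let $u:\mathbb R^n\times\mathbb R\to\mathbb R$ be Borel measurable and let it be a viscosity solution of $\partial_t^\alpha u-Iu=f$ in $B_2\times[-2,0]$, where $f$ is bounded there and $\|f\|_\infty=\sup_{B_2\times[-2,0]}|f|$. Assume $$|u|\le M \ \text{ in } B_2\times[-2,0],\qquad |u(x,t)|\le M|4x|^\nu \ \text{ in } (\mathbb R^n\setminus B_2)\times[-2,0],\qquad |u(x,t)|\le M|4t|^\nu\ \text{ in } B_2\times(-\infty,-2].$$ Then for all $x,y\in B_1$, $t\in(-2,0]$ and $s\in[-2,0]$, $$|u(x,t)-u(y,s)|\le C\left(M+\varepsilon_0^{-1}\|f\|_\infty\right)\frac{|x-y|^\kappa+|t-s|^{\kappa\alpha/(2\sigma)}}{(t+2)^{\kappa\alpha/(2\sigma)}}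 .$$ In particular $u$ is Hölder continuous on $B_1\times[-2+\tau,0]$ for every $\tau\in(0,2)$. -/

import Mathlib

open Set MeasureTheory

noncomputable section

/-- The Caputo derivative of order `α` of a function `g` defined on the whole time line,
`∂_t^α g(t) = α / Γ(1-α) * ∫_{-∞}^t (g(t) - g(s)) / (t-s)^(1+α) ds`. -/
def caputoDeriv (α : ℝ) (g : ℝ → ℝ) (t : ℝ) : ℝ :=
  α / Real.Gamma (1 - α) * ∫ s in Iio t, (g t - g s) / (t - s) ^ (1 + α)

/-- The second order difference `δ(g,x,y) = g(x+y) + g(x-y) - 2 g(x)`. -/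
def secondDiff {n : ℕ} (g : EuclideanSpace ℝ (Fin n) → ℝ) (x y : EuclideanSpace ℝ (Fin n)) : ℝ :=
  g (x + y) + g (x - y) - 2 * g x

/-- The linear nonlocal operator `∫ (g(x+y) - g(x)) / |y|^(n+2σ) * k(y) dy` with a kernel
`k` that is even in `y`. The integral is a principal value; for even `k` it is the absolutely
convergent integral of half the second order difference. -/
def nonlocalLin {n : ℕ} (σ : ℝ) (k : EuclideanSpace ℝ (Fin n) → ℝ)
    (g : EuclideanSpace ℝ (Fin n) → ℝ) (x : EuclideanSpace ℝ (Fin n)) : ℝ :=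
  (1 / 2) * ∫ y, secondDiff g x y / ‖y‖ ^ ((n : ℝ) + 2 * σ) * k y

/-- The coefficients `a^{ij}(t,x,y)` of an Isaacs operator: measurable and even in `y`, with
values in `[lam, Lam]`. -/
structure IsIsaacsCoeff {n : ℕ} {I J : Type*} (lam Lam : ℝ)
    (a : I → J → ℝ → EuclideanSpace ℝ (Fin n) → EuclideanSpace ℝ (Fin n) → ℝ) : Prop where
  measurable : ∀ i j t x, Measurable (a i j t x)
  even : ∀ i j t x y, a i j t x (-y) = a i j t x y
  lower : ∀ i j t x y, lam ≤ a i j t x y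
  upper : ∀ i j t x y, a i j t x y ≤ Lam

/-- The Isaacs operator `I g(x) = sup_i inf_j ∫ (g(x+y) - g(x)) / |y|^(n+2σ) a^{ij}(t,x,y) dy`
at time `t`. -/
def isaacs {n : ℕ} {I J : Type*} (σ : ℝ)
    (a : I → J → ℝ → EuclideanSpace ℝ (Fin n) → EuclideanSpace ℝ (Fin n) → ℝ)
    (t : ℝ) (g : EuclideanSpace ℝ (Fin n) → ℝ) (x : EuclideanSpace ℝ (Fin n)) : ℝ :=
  ⨆ i, ⨅ j, nonlocalLin σ (a i j t x) g x

/-- The expression `∂_t^α v - I v` at the point `(x,t)`. -/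
def fracIsaacs {n : ℕ} {I J : Type*} (α σ : ℝ)
    (a : I → J → ℝ → EuclideanSpace ℝ (Fin n) → EuclideanSpace ℝ (Fin n) → ℝ)
    (v : EuclideanSpace ℝ (Fin n) → ℝ → ℝ) (x : EuclideanSpace ℝ (Fin n)) (t : ℝ) : ℝ :=
  caputoDeriv α (fun s => v x s) t - isaacs σ a t (fun y => v y t) x

open Classical in
/-- The function that equals `φ` on the cylinder `B_r(x₁) × [t₁,t₂]` and `u` elsewhere. -/
def cylinderReplace {n : ℕ} (u : EuclideanSpace ℝ (Fin n) → ℝ → ℝ)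
    (φ : EuclideanSpace ℝ (Fin n) × ℝ → ℝ) (x₁ : EuclideanSpace ℝ (Fin n)) (r t₁ t₂ : ℝ)
    (x : EuclideanSpace ℝ (Fin n)) (t : ℝ) : ℝ :=
  if x ∈ Metric.ball x₁ r ∧ t ∈ Icc t₁ t₂ then φ (x, t) else u x t

/-- `u` is a viscosity subsolution of `∂_t^α u - I u = f` in `D`: it is continuous on `D`, and
`∂_t^α v - I v ≤ f` at `(x₀,t₀)` whenever a `C²` function `φ` touches `u` from above at
`(x₀,t₀)` on a cylinder `B_r(x₁) × [t₁,t₂] ⊆ D` containing `(x₀,t₀)`, where `v` is `φ` on the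
cylinder and `u` elsewhere. Since the time derivative looks into the past, `t₀` is
not the initial time of the cylinder. -/
def IsViscositySubsolution {n : ℕ} {I J : Type*} (α σ : ℝ)
    (a : I → J → ℝ → EuclideanSpace ℝ (Fin n) → EuclideanSpace ℝ (Fin n) → ℝ)
    (f u : EuclideanSpace ℝ (Fin n) → ℝ → ℝ) (D : Set (EuclideanSpace ℝ (Fin n) × ℝ)) : Prop :=
  ContinuousOn (Function.uncurry u) D ∧
  ∀ φ : EuclideanSpace ℝ (Fin n) × ℝ → ℝ, ContDiff ℝ 2 φ →
    ∀ (x₁ : EuclideanSpace ℝ (Fin n)) (r t₁ t₂ : ℝ), Metric.ball x₁ r ×ˢ Icc t₁ t₂ ⊆ D →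
    ∀ x₀ ∈ Metric.ball x₁ r, ∀ t₀ ∈ Ioc t₁ t₂, φ (x₀, t₀) = u x₀ t₀ →
    (∀ x ∈ Metric.ball x₁ r, ∀ t ∈ Icc t₁ t₂, u x t ≤ φ (x, t)) →
    fracIsaacs α σ a (cylinderReplace u φ x₁ r t₁ t₂) x₀ t₀ ≤ f x₀ t₀

/-- Viscosity supersolutions: the same with test functions touching from below and the
reverse inequality. -/
def IsViscositySupersolution {n : ℕ} {I J : Type*} (α σ : ℝ)
    (a : I → J → ℝ → EuclideanSpace ℝ (Fin n) → EuclideanSpace ℝ (Fin n) → ℝ)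
    (f u : EuclideanSpace ℝ (Fin n) → ℝ → ℝ) (D : Set (EuclideanSpace ℝ (Fin n) × ℝ)) : Prop :=
  ContinuousOn (Function.uncurry u) D ∧
  ∀ φ : EuclideanSpace ℝ (Fin n) × ℝ → ℝ, ContDiff ℝ 2 φ →
    ∀ (x₁ : EuclideanSpace ℝ (Fin n)) (r t₁ t₂ : ℝ), Metric.ball x₁ r ×ˢ Icc t₁ t₂ ⊆ D →
    ∀ x₀ ∈ Metric.ball x₁ r, ∀ t₀ ∈ Ioc t₁ t₂, φ (x₀, t₀) = u x₀ t₀ →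
    (∀ x ∈ Metric.ball x₁ r, ∀ t ∈ Icc t₁ t₂, φ (x, t) ≤ u x t) →
    f x₀ t₀ ≤ fracIsaacs α σ a (cylinderReplace u φ x₁ r t₁ t₂) x₀ t₀

/-- A viscosity solution is both a subsolution and a supersolution. -/
def IsViscositySolution {n : ℕ} {I J : Type*} (α σ : ℝ)
    (a : I → J → ℝ → EuclideanSpace ℝ (Fin n) → EuclideanSpace ℝ (Fin n) → ℝ)
    (f u : EuclideanSpace ℝ (Fin n) → ℝ → ℝ) (D : Set (EuclideanSpace ℝ (Fin n) × ℝ)) : Prop :=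
  IsViscositySubsolution α σ a f u D ∧ IsViscositySupersolution α σ a f u D

end

/-! The operator `I` lies between the extremal operators `g ↦ -M⁺(-g)` and `M⁺`, so `u` and `-u` are
both subsolutions of `∂_t^α v - M⁺ v ≤ ‖f‖`. This class is stable under translations and under
scalings `r` in space, `R` in time with `R^α = r^(2σ)`. Hölder continuity then follows once the
oscillation is known to drop by a fixed factor from one cylinder to a smaller one.

The drop is `exists_oscillation_decay`. Let `u ≤ 1` in the cylinder and `g(t) = ∫_{B_1} (1 -
u(·,t))`, and suppose `g` has at least half of its largest possible mass at early times. The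
function `1 - m(t) bump(x)`, plus a small increasing term with Caputo derivative `e`, is a barrier
for `u` if `∂_t^α m ≤ c g - C m`: where `u` touches it from below, the nonlocal diffusion sees all
of `1 - u`, and `M⁺` is at most `C m bump - c g` up to errors (`exists_contactBound`), which
contradicts the equation (`not_contact`, `le_barrier`). Instead of solving a fractional ODE, a
polynomial `q` slightly above `g` is taken and `m = c (J^α q - C J^{2α} q)`, two terms of a Neumann
series. Then `∂_t^α m = c (q - C J^α q) ≤ c q - C m`, everything is explicit, and the barrier is
smooth after the initial time, hence usable as a test function. For short times the second term is
at most half of the first, so early mass keeps `m` away from `0` later.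

Either `u` or `-u` has enough early mass, so the drop can be iterated on cylinders of radius `ρ^k`
and length `Y^k` with `Y^α = ρ^(2σ)` (`exists_oscControl_succ`). Distant points and the remote past
enter every step; a small growth exponent `ν` keeps the rescaled functions in the normalised class
(`isNormalized_rescale`). The final estimate zooms about the later of the two points, at a scale
dictated by `t + 2`.

All constants depend on `α` only through values of `Γ` on `[α₀, 2]`, the quotient `α / Γ(1-α)`,
which stays bounded as `α → 1`, and powers that are monotone in `α`. -/

noncomputable section

/-! ### Caputo derivatives and the beta integral -/

open Real in
theorem integral_rpow_mul_sub_rpow {a b τ : ℝ} (ha : 0 < a) (hb : 0 < b) (hτ : 0 < τ) :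
    ∫ s in (0:ℝ)..τ, s ^ (a - 1) * (τ - s) ^ (b - 1) =
      τ ^ (a + b - 1) * (Gamma a * Gamma b / Gamma (a + b)) := by
  have h := Complex.betaIntegral_scaled (a : ℂ) (b : ℂ) hτ
  have h2 := Complex.betaIntegral_eq_Gamma_mul_div (a : ℂ) (b : ℂ) (by simpa) (by simpa)
  rw [h2, ← Complex.ofReal_add, Complex.Gamma_ofReal, Complex.Gamma_ofReal,
    Complex.Gamma_ofReal] at h
  have h3 : ∫ x : ℝ in (0:ℝ)..τ, (x : ℂ) ^ ((a : ℂ) - 1) * ((τ : ℂ) - x) ^ ((b : ℂ) - 1) =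
      ∫ x : ℝ in (0:ℝ)..τ, ((x ^ (a - 1) * (τ - x) ^ (b - 1) : ℝ) : ℂ) := by
    refine intervalIntegral.integral_congr fun x hx => ?_
    rw [uIcc_of_le hτ.le] at hx
    push_cast
    rw [Complex.ofReal_cpow hx.1, Complex.ofReal_cpow (by linarith [hx.2])]
    push_cast
    rfl
  rw [h3, intervalIntegral.integral_ofReal] at h
  have h4 : ((τ : ℂ) ^ (((a + b : ℝ) : ℂ) - 1)) = ((τ ^ (a + b - 1) : ℝ) : ℂ) := by
    rw [Complex.ofReal_cpow hτ.le]; push_cast; rfl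
  rw [h4] at h
  exact_mod_cast h

open Real in
theorem intervalIntegrable_rpow_mul_sub_rpow {a b τ : ℝ} (ha : 0 < a) (hb : 0 < b) (hτ : 0 < τ) :
    IntervalIntegrable (fun s => s ^ (a - 1) * (τ - s) ^ (b - 1)) volume 0 τ := by
  -- A non-integrable function has integral `0` by convention, so a nonzero value of the integral
  -- already proves integrability.
  refine intervalIntegral.intervalIntegrable_of_integral_ne_zero ?_
  rw [integral_rpow_mul_sub_rpow ha hb hτ]
  have := Gamma_pos_of_pos ha
  have := Gamma_pos_of_pos hb
  have := Gamma_pos_of_pos (add_pos ha hb)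
  positivity

theorem setIntegral_Iio_comp_sub_left (f : ℝ → ℝ) (t : ℝ) :
    ∫ s in Iio t, f (t - s) = ∫ r in Ioi 0, f r := by
  have h := (Measure.measurePreserving_sub_left (volume : Measure ℝ) t).setIntegral_preimage_emb
    (MeasurableEquiv.subLeft t).measurableEmbedding f (Ioi 0)
  have hs : (fun s => t - s) ⁻¹' Ioi 0 = Iio t := by ext; simp
  rw [← h, hs]

/-- With the lag `r = t - s` as variable the domain is independent of `t`: translations pass to `g`,
and dilations become a change of variables on a half-line. -/
theorem caputoDeriv_eq (α : ℝ) (g : ℝ → ℝ) (t : ℝ) :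
    caputoDeriv α g t =
      α / Real.Gamma (1 - α) * ∫ r in Ioi 0, (g t - g (t - r)) / r ^ (1 + α) := by
  rw [caputoDeriv, ← setIntegral_Iio_comp_sub_left (fun r => (g t - g (t - r)) / r ^ (1 + α)) t]
  simp

/-- Absolute convergence of the integral defining the Caputo derivative of `g` at `t`. -/
def CaputoIntegrable (α : ℝ) (g : ℝ → ℝ) (t : ℝ) : Prop :=
  IntegrableOn (fun r => (g t - g (t - r)) / r ^ (1 + α)) (Ioi 0)

theorem caputoIntegrable_const (α c t : ℝ) : CaputoIntegrable α (fun _ => c) t := by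
  simp [CaputoIntegrable]

theorem caputoDeriv_const (α c t : ℝ) : caputoDeriv α (fun _ => c) t = 0 := by
  simp [caputoDeriv]

theorem CaputoIntegrable.add {α t : ℝ} {g h : ℝ → ℝ} (hg : CaputoIntegrable α g t)
    (hh : CaputoIntegrable α h t) : CaputoIntegrable α (fun s => g s + h s) t := by
  refine (Integrable.add hg hh).congr (ae_of_all _ fun r => ?_)
  simp only [Pi.add_apply]; ring

theorem CaputoIntegrable.const_mul {α t : ℝ} {g : ℝ → ℝ} (hg : CaputoIntegrable α g t) (c : ℝ) :
    CaputoIntegrable α (fun s => c * g s) t := by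
  refine (Integrable.const_mul hg c).congr (ae_of_all _ fun r => ?_)
  simp only []; ring

theorem caputoDeriv_add {α t : ℝ} {g h : ℝ → ℝ} (hg : CaputoIntegrable α g t)
    (hh : CaputoIntegrable α h t) :
    caputoDeriv α (fun s => g s + h s) t = caputoDeriv α g t + caputoDeriv α h t := by
  rw [caputoDeriv_eq, caputoDeriv_eq, caputoDeriv_eq, ← mul_add, ← integral_add hg hh]
  refine congrArg (_ * ·) (integral_congr_ae (ae_of_all _ fun r => ?_))
  ring

theorem caputoDeriv_const_mul (α t c : ℝ) (g : ℝ → ℝ) :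
    caputoDeriv α (fun s => c * g s) t = c * caputoDeriv α g t := by
  rw [caputoDeriv_eq, caputoDeriv_eq, mul_left_comm, ← integral_const_mul c]
  refine congrArg (α / Real.Gamma (1 - α) * ·) (integral_congr_ae (ae_of_all _ fun r => ?_))
  simp only []
  ring

theorem CaputoIntegrable.sum {α t : ℝ} {ι : Type*} (s : Finset ι) {g : ι → ℝ → ℝ}
    (hg : ∀ i ∈ s, CaputoIntegrable α (g i) t) :
    CaputoIntegrable α (fun x => ∑ i ∈ s, g i x) t := by
  classical
  induction s using Finset.induction_on with
  | empty => simpa using caputoIntegrable_const α 0 t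
  | insert i s hi ih =>
    simp only [Finset.sum_insert hi]
    exact (hg i (by simp)).add (ih fun j hj => hg j (by simp [hj]))

theorem caputoDeriv_sum {α t : ℝ} {ι : Type*} (s : Finset ι) {g : ι → ℝ → ℝ}
    (hg : ∀ i ∈ s, CaputoIntegrable α (g i) t) :
    caputoDeriv α (fun x => ∑ i ∈ s, g i x) t = ∑ i ∈ s, caputoDeriv α (g i) t := by
  classical
  induction s using Finset.induction_on with
  | empty => simpa using caputoDeriv_const α 0 t
  | insert i s hi ih =>
    simp only [Finset.sum_insert hi]
    rw [caputoDeriv_add (hg i (by simp))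
      (CaputoIntegrable.sum s fun j hj => hg j (by simp [hj])),
      ih fun j hj => hg j (by simp [hj])]

theorem caputoDeriv_affine {α R : ℝ} (hR : 0 < R) (A b c : ℝ) (g : ℝ → ℝ) (t : ℝ) :
    caputoDeriv α (fun s => A * (g (b + R * s) - c)) t =
      A * R ^ α * caputoDeriv α g (b + R * t) := by
  rw [caputoDeriv_eq, caputoDeriv_eq]
  have h := integral_comp_mul_left_Ioi
    (fun r => (g (b + R * t) - g (b + R * t - r)) / r ^ (1 + α)) 0 hR
  rw [mul_zero] at h
  have h2 : ∫ r in Ioi 0, (A * (g (b + R * t) - c) - A * (g (b + R * (t - r)) - c)) / r ^ (1 + α) =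
      ∫ r in Ioi 0, (A * R ^ (1 + α)) *
        ((g (b + R * t) - g (b + R * t - R * r)) / (R * r) ^ (1 + α)) := by
    refine setIntegral_congr_fun measurableSet_Ioi fun r hr => ?_
    have hr : 0 < r := hr
    rw [Real.mul_rpow hR.le hr.le]
    have : 0 < R ^ (1 + α) := Real.rpow_pos_of_pos hR _
    have : 0 < r ^ (1 + α) := Real.rpow_pos_of_pos hr _
    rw [show b + R * (t - r) = b + R * t - R * r by ring]
    field_simp
    ring
  rw [h2, integral_const_mul, h, Real.rpow_add hR, Real.rpow_one, smul_eq_mul]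
  field_simp

theorem CaputoIntegrable.comp_add {α t : ℝ} {g : ℝ → ℝ} (b : ℝ)
    (hg : CaputoIntegrable α g (t + b)) : CaputoIntegrable α (fun s => g (s + b)) t := by
  refine Integrable.congr hg (ae_of_all _ fun r => ?_)
  simp only [sub_add_eq_add_sub]

theorem caputoDeriv_comp_add (α t b : ℝ) (g : ℝ → ℝ) :
    caputoDeriv α (fun s => g (s + b)) t = caputoDeriv α g (t + b) := by
  have := caputoDeriv_affine (α := α) one_pos 1 b 0 g t
  simpa [add_comm] using this

/-- Bernoulli's inequality for `γ ≥ 1`, and `1 - x ≤ (1 - x)^γ` for `γ ≤ 1`. Linearity in `r` is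
what makes the quotient by `r^(1+α)` integrable at `0`. -/
theorem rpow_sub_sub_rpow_le {γ τ r : ℝ} (hτ : 0 < τ) (hr : 0 ≤ r) (hrτ : r ≤ τ) :
    τ ^ γ - (τ - r) ^ γ ≤ max 1 γ * τ ^ γ / τ * r := by
  have hx0 : 0 ≤ r / τ := by positivity
  have hx1 : r / τ ≤ 1 := (div_le_one hτ).2 hrτ
  have key : 1 - (1 - r / τ) ^ γ ≤ max 1 γ * (r / τ) := by
    rcases le_total 1 γ with h | h
    · rw [max_eq_right h]
      have := one_add_mul_self_le_rpow_one_add (s := -(r / τ)) (by linarith) h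
      rw [← sub_eq_add_neg] at this
      linarith
    · rw [max_eq_left h]
      have := Real.self_le_rpow_of_le_one (x := 1 - r / τ) (by linarith) (by linarith) h
      linarith
  have e : (τ - r) ^ γ = τ ^ γ * (1 - r / τ) ^ γ := by
    rw [← Real.mul_rpow hτ.le (by linarith)]
    congr 1; field_simp
  have hp : 0 < τ ^ γ := Real.rpow_pos_of_pos hτ _
  rw [e]
  calc τ ^ γ - τ ^ γ * (1 - r / τ) ^ γ = τ ^ γ * (1 - (1 - r / τ) ^ γ) := by ring
    _ ≤ τ ^ γ * (max 1 γ * (r / τ)) := by gcongr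
    _ = _ := by ring

theorem intervalIntegrable_rpow_diff_div {α γ τ : ℝ} (hα₁ : α < 1) (hγ : 0 < γ)
    (hτ : 0 < τ) :
    IntervalIntegrable (fun r => (τ ^ γ - (τ - r) ^ γ) / r ^ (1 + α)) volume 0 τ := by
  have hmaj : IntervalIntegrable (fun r => max 1 γ * τ ^ γ / τ * r ^ (-α)) volume 0 τ :=
    (intervalIntegral.intervalIntegrable_rpow' (by linarith)).const_mul _
  refine hmaj.mono_fun ?_ ?_
  · exact Measurable.aestronglyMeasurable (by fun_prop)
  · rw [uIoc_of_le hτ.le]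
    refine (ae_restrict_iff' measurableSet_Ioc).2 (ae_of_all _ fun r hr => ?_)
    have hr0 : 0 < r := hr.1
    have h1 := rpow_sub_sub_rpow_le (γ := γ) hτ hr.1.le hr.2
    have h2 : 0 ≤ τ ^ γ - (τ - r) ^ γ :=
      sub_nonneg.2 (Real.rpow_le_rpow (by linarith [hr.2]) (by linarith) hγ.le)
    have h3 : 0 < r ^ (1 + α) := Real.rpow_pos_of_pos hr0 _
    have h4 : 0 < r ^ (-α) := Real.rpow_pos_of_pos hr0 _
    beta_reduce
    rw [Real.norm_of_nonneg (by positivity), Real.norm_of_nonneg (by positivity), div_le_iff₀ h3,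
      mul_assoc, ← Real.rpow_add hr0]
    simpa using h1

-- Integration by parts: differentiating the numerator leaves a beta integral.
open Real in
theorem integral_rpow_diff_div {α γ τ : ℝ} (hα₀ : 0 < α) (hα₁ : α < 1) (hγ : 0 < γ)
    (hτ : 0 < τ) :
    ∫ r in (0:ℝ)..τ, (τ ^ γ - (τ - r) ^ γ) / r ^ (1 + α) =
      - (τ ^ (γ - α) / α) + γ / α * (τ ^ (γ - α) * (Gamma (1 - α) * Gamma γ / Gamma (1 - α + γ))) := by
  have hb := integral_rpow_mul_sub_rpow (a := 1 - α) (b := γ) (by linarith) hγ hτ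
  have hbi := intervalIntegrable_rpow_mul_sub_rpow (a := 1 - α) (b := γ) (by linarith) hγ hτ
  have hi := intervalIntegrable_rpow_diff_div hα₁ hγ hτ
  -- The boundary term. Its derivative is the integrand minus `γ / α` times the beta density; at `r
  -- = 0` it is continuous because it is `O(r^(1-α))`.
  set F : ℝ → ℝ := fun r => -((τ ^ γ - (τ - r) ^ γ) * r ^ (-α) / α) with hF
  have hcont : ContinuousOn F (Icc 0 τ) := by
    intro r hr
    rcases hr.1.eq_or_lt with h0 | h0
    · subst h0
      have hF0 : F 0 = 0 := by simp [hF]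
      rw [ContinuousWithinAt, hF0]
      refine squeeze_zero_norm' (a := fun r => max 1 γ * τ ^ γ / τ * r ^ (1 - α) / α) ?_ ?_
      · filter_upwards [self_mem_nhdsWithin] with r hr
        have h1 := rpow_sub_sub_rpow_le (γ := γ) hτ hr.1 hr.2
        have h2 : 0 ≤ τ ^ γ - (τ - r) ^ γ :=
          sub_nonneg.2 (Real.rpow_le_rpow (by linarith [hr.2]) (by linarith [hr.1]) hγ.le)
        rcases hr.1.eq_or_lt with h0 | h0
        · subst h0
          simp [hF, Real.zero_rpow (by linarith : (1:ℝ) - α ≠ 0)]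
        · have h3 : 0 < r ^ (-α) := Real.rpow_pos_of_pos h0 _
          rw [hF]
          simp only [norm_neg]
          rw [Real.norm_of_nonneg (by positivity), sub_eq_add_neg 1 α, Real.rpow_add h0,
            Real.rpow_one, ← mul_assoc]
          gcongr
      · have : ContinuousAt (fun r : ℝ => max 1 γ * τ ^ γ / τ * r ^ (1 - α) / α) 0 := by
          have := Real.continuousAt_rpow_const (0:ℝ) (1 - α) (Or.inr (by linarith))
          fun_prop
        have h := this.tendsto
        simp only [Real.zero_rpow (by linarith : (1:ℝ) - α ≠ 0), mul_zero, zero_div] at h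
        exact h.mono_left nhdsWithin_le_nhds
    · have h1 := Real.continuousAt_rpow_const r (-α) (Or.inl h0.ne')
      have h2 : ContinuousAt (fun r => (τ - r) ^ γ) r :=
        ContinuousAt.rpow_const (by fun_prop) (Or.inr hγ.le)
      exact ContinuousAt.continuousWithinAt (by fun_prop)
  have hderiv : ∀ r ∈ Ioo 0 τ, HasDerivAt F
      ((τ ^ γ - (τ - r) ^ γ) / r ^ (1 + α) - γ / α * (r ^ (1 - α - 1) * (τ - r) ^ (γ - 1))) r := by
    intro r hr
    have h1 : HasDerivAt (fun r => (τ - r) ^ γ) (-1 * γ * (τ - r) ^ (γ - 1)) r :=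
      ((hasDerivAt_id r).const_sub τ).rpow_const (Or.inl (by simpa using (sub_pos.2 hr.2).ne'))
    have h2 := Real.hasDerivAt_rpow_const (x := r) (p := -α) (Or.inl hr.1.ne')
    have h3 := (((h1.const_sub (τ ^ γ)).mul h2).div_const α).neg
    refine h3.congr_deriv ?_
    have e1 : r ^ (-α - 1) = (r ^ (1 + α))⁻¹ := by
      rw [← Real.rpow_neg hr.1.le]; congr 1; ring
    rw [e1, show (1 - α - 1 : ℝ) = -α by ring]
    have : 0 < r ^ (1 + α) := Real.rpow_pos_of_pos hr.1 _
    field_simp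
    ring
  have hint := intervalIntegral.integral_eq_sub_of_hasDerivAt_of_le hτ.le hcont hderiv
    (hi.sub (hbi.const_mul (γ / α)))
  rw [intervalIntegral.integral_sub hi (hbi.const_mul _), intervalIntegral.integral_const_mul,
    hb] at hint
  have hFτ : F τ = -(τ ^ (γ - α) / α) := by
    simp only [hF, sub_self, Real.zero_rpow hγ.ne', sub_zero]
    rw [← Real.rpow_add hτ, sub_eq_add_neg]
  have hF0 : F 0 = 0 := by simp [hF]
  rw [hFτ, hF0, show 1 - α + γ - 1 = γ - α by ring] at hint
  linarith

theorem rpow_tail_eqOn {α γ τ : ℝ} (hτ : 0 < τ) (hγ : 0 < γ) :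
    EqOn (fun r => ((max τ 0) ^ γ - (max (τ - r) 0) ^ γ) / r ^ (1 + α))
      (fun r => τ ^ γ * r ^ (-(1 + α))) (Ioi τ) := by
  intro r hr
  have hr : τ < r := hr
  simp only [max_eq_left hτ.le, max_eq_right (sub_nonpos.2 hr.le), Real.zero_rpow hγ.ne', sub_zero]
  rw [Real.rpow_neg (by linarith), div_eq_mul_inv]

theorem rpow_head_eqOn {α γ τ : ℝ} (hτ : 0 < τ) :
    EqOn (fun r => ((max τ 0) ^ γ - (max (τ - r) 0) ^ γ) / r ^ (1 + α))
      (fun r => (τ ^ γ - (τ - r) ^ γ) / r ^ (1 + α)) (Ioc 0 τ) := by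
  intro r hr
  simp only [max_eq_left hτ.le, max_eq_left (sub_nonneg.2 hr.2)]

theorem caputoIntegrable_posPart_rpow {α γ τ : ℝ} (hα₀ : 0 < α) (hα₁ : α < 1) (hγ : 0 < γ)
    (hτ : 0 < τ) : CaputoIntegrable α (fun s => (max s 0) ^ γ) τ := by
  rw [CaputoIntegrable, ← Ioc_union_Ioi_eq_Ioi hτ.le, integrableOn_union]
  constructor
  · refine IntegrableOn.congr_fun ?_ (rpow_head_eqOn hτ).symm measurableSet_Ioc
    exact (intervalIntegrable_iff_integrableOn_Ioc_of_le hτ.le).1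
      (intervalIntegrable_rpow_diff_div hα₁ hγ hτ)
  · refine IntegrableOn.congr_fun ?_ (rpow_tail_eqOn hτ hγ).symm measurableSet_Ioi
    exact (integrableOn_Ioi_rpow_of_lt (by linarith) hτ).const_mul _

open Real in
/-- The Caputo derivative of a power of the positive part. -/
theorem caputoDeriv_posPart_rpow {α γ τ : ℝ} (hα₀ : 0 < α) (hα₁ : α < 1) (hγ : 0 < γ)
    (hτ : 0 < τ) :
    caputoDeriv α (fun s => (max s 0) ^ γ) τ =
      Gamma (γ + 1) / Gamma (γ + 1 - α) * τ ^ (γ - α) := by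
  have hI := caputoIntegrable_posPart_rpow hα₀ hα₁ hγ hτ
  rw [CaputoIntegrable, ← Ioc_union_Ioi_eq_Ioi hτ.le, integrableOn_union] at hI
  rw [caputoDeriv_eq, ← Ioc_union_Ioi_eq_Ioi hτ.le,
    setIntegral_union Ioc_disjoint_Ioi_same measurableSet_Ioi
      hI.1 hI.2,
    setIntegral_congr_fun measurableSet_Ioc (rpow_head_eqOn hτ),
    setIntegral_congr_fun measurableSet_Ioi (rpow_tail_eqOn hτ hγ),
    ← intervalIntegral.integral_of_le hτ.le, integral_rpow_diff_div hα₀ hα₁ hγ hτ,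
    integral_const_mul, integral_Ioi_rpow_of_lt (by linarith) hτ]
  have e : τ ^ γ * (-τ ^ (-(1 + α) + 1) / (-(1 + α) + 1)) = τ ^ (γ - α) / α := by
    rw [show -(1 + α) + 1 = -α by ring, neg_div_neg_eq, mul_div_assoc', ← Real.rpow_add hτ,
      sub_eq_add_neg]
  rw [e, Gamma_add_one hγ.ne', show γ + 1 - α = 1 - α + γ by ring]
  have h1 := (Gamma_pos_of_pos (show 0 < 1 - α by linarith)).ne'
  have h2 := (Gamma_pos_of_pos (show 0 < 1 - α + γ by linarith)).ne'
  field_simp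
  ring

end

/-! ### Riemann-Liouville integrals of polynomials -/

noncomputable section

/-- The Riemann-Liouville integral of order `γ`, started at time `0`, of a polynomial. -/
def fracInt (γ : ℝ) (q : Polynomial ℝ) (τ : ℝ) : ℝ :=
  ∑ k ∈ q.support, q.coeff k * (Real.Gamma (k + 1) / Real.Gamma (k + 1 + γ)) *
    (max τ 0) ^ ((k : ℝ) + γ)

theorem fracInt_of_nonpos {γ τ : ℝ} (hγ : 0 < γ) (q : Polynomial ℝ) (hτ : τ ≤ 0) :
    fracInt γ q τ = 0 := by
  refine Finset.sum_eq_zero fun k _ => ?_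
  rw [max_eq_right hτ, Real.zero_rpow (by positivity), mul_zero]

theorem continuous_fracInt {γ : ℝ} (hγ : 0 < γ) (q : Polynomial ℝ) :
    Continuous (fracInt γ q) := by
  refine continuous_finsetSum _ fun k _ => continuous_const.mul ?_
  exact Continuous.rpow_const (by fun_prop) fun _ => Or.inr (by positivity)

theorem contDiffOn_fracInt (γ : ℝ) (q : Polynomial ℝ) :
    ContDiffOn ℝ 2 (fracInt γ q) (Ioi 0) := by
  refine ContDiffOn.sum fun k _ => contDiffOn_const.mul ?_
  have : ContDiffOn ℝ 2 (fun τ : ℝ => τ ^ ((k : ℝ) + γ)) (Ioi 0) := fun τ hτ =>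
    (Real.contDiffAt_rpow_const_of_ne (ne_of_gt hτ)).contDiffWithinAt
  refine this.congr fun τ hτ => ?_
  rw [max_eq_left (le_of_lt hτ)]

theorem fracInt_zero (q : Polynomial ℝ) {τ : ℝ} (hτ : 0 < τ) : fracInt 0 q τ = q.eval τ := by
  rw [Polynomial.eval_eq_sum, Polynomial.sum]
  refine Finset.sum_congr rfl fun k _ => ?_
  have := (Real.Gamma_pos_of_pos (show (0:ℝ) < k + 1 by positivity)).ne'
  rw [max_eq_left hτ.le, add_zero, add_zero, Real.rpow_natCast, div_self this, mul_one]

theorem caputoIntegrable_fracInt {α γ τ : ℝ} (hα₀ : 0 < α) (hα₁ : α < 1) (hγ : 0 < γ)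
    (q : Polynomial ℝ) (hτ : 0 < τ) : CaputoIntegrable α (fracInt γ q) τ :=
  CaputoIntegrable.sum _ fun _ _ =>
    (caputoIntegrable_posPart_rpow hα₀ hα₁ (by positivity) hτ).const_mul _

/-- The Caputo derivative inverts the Riemann-Liouville integral. -/
theorem caputoDeriv_fracInt {α γ τ : ℝ} (hα₀ : 0 < α) (hα₁ : α < 1) (hγ : 0 ≤ γ)
    (q : Polynomial ℝ) (hτ : 0 < τ) :
    caputoDeriv α (fracInt (γ + α) q) τ = fracInt γ q τ := by
  have h := caputoDeriv_sum (α := α) (t := τ) q.support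
    (g := fun k s => q.coeff k * (Real.Gamma (k + 1) / Real.Gamma (k + 1 + (γ + α))) *
      (max s 0) ^ ((k : ℝ) + (γ + α)))
    (fun k _ => (caputoIntegrable_posPart_rpow hα₀ hα₁ (by positivity) hτ).const_mul _)
  refine h.trans (Finset.sum_congr rfl fun k _ => ?_)
  rw [caputoDeriv_const_mul, caputoDeriv_posPart_rpow hα₀ hα₁ (by positivity) hτ,
    max_eq_left hτ.le, show (k : ℝ) + (γ + α) - α = k + γ by ring,
    show (k : ℝ) + (γ + α) + 1 = k + 1 + (γ + α) by ring,
    show (k : ℝ) + 1 + (γ + α) - α = k + 1 + γ by ring]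
  have := (Real.Gamma_pos_of_pos (show (0:ℝ) < k + 1 + (γ + α) by positivity)).ne'
  field_simp

theorem intervalIntegrable_sub_rpow_mul_eval {γ τ : ℝ} (hγ : 0 < γ) (q : Polynomial ℝ) :
    IntervalIntegrable (fun s => (τ - s) ^ (γ - 1) * q.eval s) volume 0 τ := by
  have h : IntervalIntegrable (fun s => (τ - s) ^ (γ - 1)) volume 0 τ := by
    have := (intervalIntegral.intervalIntegrable_rpow' (a := 0) (b := τ) (r := γ - 1)
      (by linarith)).comp_sub_left τ
    simpa using this.symm
  exact h.mul_continuousOn (by fun_prop)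

/-- The sum over monomials gives the Caputo derivatives; the integral form has a nonnegative kernel
and gives signs and comparisons. -/
theorem fracInt_eq_integral {γ τ : ℝ} (hγ : 0 < γ) (q : Polynomial ℝ) (hτ : 0 < τ) :
    fracInt γ q τ = (Real.Gamma γ)⁻¹ * ∫ s in (0:ℝ)..τ, (τ - s) ^ (γ - 1) * q.eval s := by
  have h1 : ∀ s, (τ - s) ^ (γ - 1) * q.eval s =
      ∑ k ∈ q.support, q.coeff k * (s ^ ((k : ℝ) + 1 - 1) * (τ - s) ^ (γ - 1)) := by
    intro s
    rw [Polynomial.eval_eq_sum, Polynomial.sum, Finset.mul_sum]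
    refine Finset.sum_congr rfl fun k _ => ?_
    rw [add_sub_cancel_right, Real.rpow_natCast]
    ring
  simp_rw [h1]
  rw [intervalIntegral.integral_finsetSum fun k _ =>
    (intervalIntegrable_rpow_mul_sub_rpow (by positivity) hγ hτ).const_mul _, Finset.mul_sum]
  refine Finset.sum_congr rfl fun k _ => ?_
  rw [intervalIntegral.integral_const_mul,
    integral_rpow_mul_sub_rpow (by positivity) hγ hτ, max_eq_left hτ.le,
    show (k : ℝ) + 1 + γ - 1 = k + γ by ring]
  have := (Real.Gamma_pos_of_pos hγ).ne'
  field_simp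

theorem fracInt_one {γ τ : ℝ} : fracInt γ 1 τ = (max τ 0) ^ γ / Real.Gamma (1 + γ) := by
  have : (1 : Polynomial ℝ).support = {0} := by
    rw [← Polynomial.C_1]; exact Polynomial.support_C one_ne_zero
  rw [fracInt, this, Finset.sum_singleton]
  simp
  ring

theorem fracInt_nonneg {γ τ : ℝ} (hγ : 0 < γ) {q : Polynomial ℝ}
    (hq : ∀ s ∈ Icc 0 τ, 0 ≤ q.eval s) : 0 ≤ fracInt γ q τ := by
  rcases le_or_gt τ 0 with h | hτ
  · rw [fracInt_of_nonpos hγ q h]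
  rw [fracInt_eq_integral hγ q hτ]
  have := Real.Gamma_pos_of_pos hγ
  refine mul_nonneg (by positivity) (intervalIntegral.integral_nonneg hτ.le fun s hs => ?_)
  exact mul_nonneg (Real.rpow_nonneg (by linarith [hs.2]) _) (hq s hs)

/-- For short times the integral of order `2α` is a small part of the one of order `α`. -/
theorem mul_fracInt_two_mul_le {α C T τ : ℝ} (hα : 0 < α) (hC : 0 ≤ C)
    (hT : C * T ^ α * Real.Gamma α ≤ Real.Gamma (2 * α) / 2) {q : Polynomial ℝ}
    (hq : ∀ s ∈ Icc 0 T, 0 ≤ q.eval s) (hτ : τ ≤ T) :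
    C * fracInt (2 * α) q τ ≤ fracInt α q τ / 2 := by
  rcases le_or_gt τ 0 with h | hτ0
  · rw [fracInt_of_nonpos hα q h, fracInt_of_nonpos (by linarith) q h]; simp
  rw [fracInt_eq_integral hα q hτ0, fracInt_eq_integral (by linarith) q hτ0]
  have h1 := Real.Gamma_pos_of_pos hα
  have h2 := Real.Gamma_pos_of_pos (show 0 < 2 * α by linarith)
  rw [mul_div_assoc, div_eq_mul_inv _ (2:ℝ), ← intervalIntegral.integral_mul_const, ← mul_assoc,
    ← intervalIntegral.integral_const_mul, ← intervalIntegral.integral_const_mul]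
  refine intervalIntegral.integral_mono_on_of_le_Ioo hτ0.le
    ((intervalIntegrable_sub_rpow_mul_eval (by linarith) q).const_mul _)
    (((intervalIntegrable_sub_rpow_mul_eval hα q).mul_const _).const_mul _) fun s hs => ?_
  have hs0 : 0 < τ - s := by linarith [hs.2]
  -- Up to Gamma factors, the kernel of order `2α` is that of order `α` times `(τ - s)^α ≤ T^α`.
  have e : (τ - s) ^ (2 * α - 1) = (τ - s) ^ α * (τ - s) ^ (α - 1) := by
    rw [← Real.rpow_add hs0]; congr 1; ring
  have h3 : (τ - s) ^ α ≤ T ^ α :=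
    Real.rpow_le_rpow hs0.le (by linarith [hs.1]) hα.le
  have h4 : 0 ≤ (τ - s) ^ (α - 1) * q.eval s :=
    mul_nonneg (Real.rpow_nonneg hs0.le _) (hq s ⟨hs.1.le, by linarith [hs.2]⟩)
  have h5 : C * (Real.Gamma (2 * α))⁻¹ * (τ - s) ^ α ≤ (Real.Gamma α)⁻¹ * 2⁻¹ := by
    have : C * (τ - s) ^ α * Real.Gamma α ≤ Real.Gamma (2 * α) / 2 :=
      le_trans (by gcongr) hT
    field_simp
    linarith
  calc C * (Real.Gamma (2 * α))⁻¹ * ((τ - s) ^ (2 * α - 1) * q.eval s)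
      = (C * (Real.Gamma (2 * α))⁻¹ * (τ - s) ^ α) * ((τ - s) ^ (α - 1) * q.eval s) := by
        rw [e]; ring
    _ ≤ ((Real.Gamma α)⁻¹ * 2⁻¹) * ((τ - s) ^ (α - 1) * q.eval s) := by gcongr
    _ = _ := by ring

/-- The kernel `(τ - s)^(α-1)` is at least `1`, since `τ - s ≤ 1` and `α ≤ 1`, and the history up to
`τ` contains `[0, T/2]`. Mass at early times thus bounds the integral from below at all later times.
-/
theorem le_fracInt {α T τ : ℝ} (hα : 0 < α) (hα₁ : α ≤ 1) (hT : 0 < T) (hT₁ : T ≤ 1)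
    {q : Polynomial ℝ} (hq : ∀ s ∈ Icc 0 T, 0 ≤ q.eval s) (hτ : T / 2 ≤ τ) (hτ' : τ ≤ T) :
    (Real.Gamma α)⁻¹ * ∫ s in (0:ℝ)..(T / 2), q.eval s ≤ fracInt α q τ := by
  have hτ0 : 0 < τ := by linarith
  rw [fracInt_eq_integral hα q hτ0]
  have h1 := Real.Gamma_pos_of_pos hα
  gcongr
  have hi := intervalIntegrable_sub_rpow_mul_eval (τ := τ) hα q
  calc ∫ s in (0:ℝ)..(T / 2), q.eval s ≤ ∫ s in (0:ℝ)..τ, q.eval s := by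
        refine intervalIntegral.integral_mono_interval le_rfl (by linarith) hτ ?_
          (Continuous.intervalIntegrable (by fun_prop) _ _)
        refine (ae_restrict_iff' measurableSet_Ioc).2 (ae_of_all _ fun s hs => ?_)
        exact hq s ⟨hs.1.le, by linarith [hs.2]⟩
    _ ≤ _ := by
        refine intervalIntegral.integral_mono_on_of_le_Ioo hτ0.le
          (Continuous.intervalIntegrable (by fun_prop) _ _) hi fun s hs => ?_
        have h3 : 1 ≤ (τ - s) ^ (α - 1) :=
          Real.one_le_rpow_of_pos_of_le_one_of_nonpos (by linarith [hs.2]) (by linarith [hs.1])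
            (by linarith)
        exact le_mul_of_one_le_left (hq s ⟨hs.1.le, by linarith [hs.2]⟩) h3

/-- A function that is `C²` on the half line `(0,∞)` agrees with a globally `C²` function away
from `0`. -/
theorem exists_contDiff_eqOn_Ici {f : ℝ → ℝ} (hf : ContDiffOn ℝ 2 f (Ioi 0)) {a : ℝ}
    (ha : 0 < a) : ∃ g : ℝ → ℝ, ContDiff ℝ 2 g ∧ EqOn g f (Ici a) := by
  have hχ : ContDiff ℝ 2 fun s : ℝ => Real.smoothTransition (2 * s / a - 1) :=
    Real.smoothTransition.contDiff.comp (by fun_prop)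
  -- The cutoff vanishes for `s ≤ a / 2` and equals `1` for `s ≥ a`, so it removes the singularity
  -- at `0` without touching `[a, ∞)`.
  refine ⟨fun s => Real.smoothTransition (2 * s / a - 1) * f s, ?_, fun s hs => ?_⟩
  · refine contDiff_iff_contDiffAt.2 fun s => ?_
    rcases lt_or_ge 0 s with h | h
    · exact hχ.contDiffAt.mul (hf.contDiffAt (Ioi_mem_nhds h))
    · refine (contDiffAt_const (c := (0:ℝ))).congr_of_eventuallyEq ?_
      filter_upwards [Iio_mem_nhds (show s < a / 2 by linarith)] with x hx
      have hx : x < a / 2 := hx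
      rw [Real.smoothTransition.zero_of_nonpos, zero_mul]
      rw [sub_nonpos, div_le_one ha]
      linarith
  · have hs : a ≤ s := hs
    simp only
    rw [Real.smoothTransition.one_of_one_le, one_mul]
    rw [le_sub_iff_add_le, le_div_iff₀ ha]
    linarith

end

/-! ### Extremal operators -/

noncomputable section

/-- The extremal function `z ↦ Λ z⁺ - λ z⁻`. -/
def pucci (lam Lam z : ℝ) : ℝ := Lam * max z 0 - lam * max (-z) 0

theorem mul_le_pucci {lam Lam k z : ℝ} (h₁ : lam ≤ k) (h₂ : k ≤ Lam) :
    z * k ≤ pucci lam Lam z := by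
  rcases le_total 0 z with h | h
  · rw [pucci, max_eq_left h, max_eq_right (by linarith)]; nlinarith
  · rw [pucci, max_eq_right h, max_eq_left (by linarith)]; nlinarith

theorem pucci_of_nonpos {lam Lam z : ℝ} (h : z ≤ 0) : pucci lam Lam z = lam * z := by
  rw [pucci, max_eq_right h, max_eq_left (by linarith)]; ring

theorem pucci_of_nonneg {lam Lam z : ℝ} (h : 0 ≤ z) : pucci lam Lam z = Lam * z := by
  rw [pucci, max_eq_left h, max_eq_right (by linarith)]; ring

theorem pucci_mono {lam Lam : ℝ} (hlam : 0 ≤ lam) (hLam : 0 ≤ Lam) : Monotone (pucci lam Lam) := by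
  intro a b h
  unfold pucci
  gcongr

/-- `pucci` is the maximum of `z * k` over `k ∈ [lam, Lam]`, hence sublinear. -/
theorem pucci_add_le {lam Lam : ℝ} (hL : lam ≤ Lam) (a b : ℝ) :
    pucci lam Lam (a + b) ≤ pucci lam Lam a + pucci lam Lam b := by
  rcases le_total 0 (a + b) with h | h
  · rw [pucci_of_nonneg h, mul_comm, add_mul]
    exact add_le_add (mul_le_pucci hL le_rfl) (mul_le_pucci hL le_rfl)
  · rw [pucci_of_nonpos h, mul_comm, add_mul]
    exact add_le_add (mul_le_pucci le_rfl hL) (mul_le_pucci le_rfl hL)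

theorem pucci_const_mul {lam Lam c : ℝ} (hc : 0 ≤ c) (z : ℝ) :
    pucci lam Lam (c * z) = c * pucci lam Lam z := by
  rcases le_total 0 z with h | h
  · rw [pucci_of_nonneg h, pucci_of_nonneg (mul_nonneg hc h)]; ring
  · rw [pucci_of_nonpos h, pucci_of_nonpos (mul_nonpos_of_nonneg_of_nonpos hc h)]; ring

theorem abs_pucci_le {lam Lam : ℝ} (hlam : 0 ≤ lam) (hL : lam ≤ Lam) (z : ℝ) :
    |pucci lam Lam z| ≤ Lam * |z| := by
  rcases le_total 0 z with h | h
  · rw [pucci_of_nonneg h, abs_mul, abs_of_nonneg (hlam.trans hL)]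
  · rw [pucci_of_nonpos h, abs_mul, abs_of_nonneg hlam]
    gcongr

theorem continuous_pucci (lam Lam : ℝ) : Continuous (pucci lam Lam) := by
  unfold pucci; fun_prop

variable {n : ℕ}

/-- The maximal operator `g ↦ sup_k ½ ∫ δ(g,x,y) k(y) / |y|^(n+2σ) dy` over `λ ≤ k ≤ Λ`. -/
def pucciMax (σ lam Lam : ℝ) (g : EuclideanSpace ℝ (Fin n) → ℝ)
    (x : EuclideanSpace ℝ (Fin n)) : ℝ :=
  (1 / 2) * ∫ y, pucci lam Lam (secondDiff g x y) / ‖y‖ ^ ((n : ℝ) + 2 * σ)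

/-- An integrable majorant for the second differences of functions that are `C²` near a point
and grow at most like `|y|^ν`. -/
def kernelMajorant (n : ℕ) (σ ν : ℝ) (y : EuclideanSpace ℝ (Fin n)) : ℝ :=
  min 1 (‖y‖ ^ 2) * (1 + ‖y‖) ^ ν / ‖y‖ ^ ((n : ℝ) + 2 * σ)

theorem kernelMajorant_nonneg (σ ν : ℝ) (y : EuclideanSpace ℝ (Fin n)) :
    0 ≤ kernelMajorant n σ ν y := by
  unfold kernelMajorant; positivity

/-- In polar coordinates the density is of order `r^(1-2σ)` at `0` and `r^(ν-1-2σ)` at infinity,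
which is where `σ < 1` and `ν < 2σ` enter. -/
theorem integrable_kernelMajorant (hn : 1 ≤ n) {σ ν : ℝ} (hσ : σ < 1) (hν : 0 ≤ ν)
    (hνσ : ν < 2 * σ) : Integrable (kernelMajorant n σ ν) := by
  have : Nonempty (Fin n) := ⟨⟨0, hn⟩⟩
  refine (integrable_fun_norm_addHaar (volume : Measure (EuclideanSpace ℝ (Fin n)))
    (f := fun r => min 1 (r ^ 2) * (1 + r) ^ ν / r ^ ((n : ℝ) + 2 * σ))).2 ?_
  rw [← Ioc_union_Ioi_eq_Ioi zero_le_one, integrableOn_union, finrank_euclideanSpace,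
    Fintype.card_fin]
  have hpow : ∀ r : ℝ, 0 < r → r ^ (n - 1) * (r ^ ((n : ℝ) + 2 * σ))⁻¹ = r ^ (-1 - 2 * σ) := by
    intro r hr
    rw [← Real.rpow_natCast, ← Real.rpow_neg hr.le, ← Real.rpow_add hr]
    congr 1
    push_cast [hn]
    ring
  have hmeas : Measurable fun r : ℝ => r ^ (n - 1) •
      (min 1 (r ^ 2) * (1 + r) ^ ν / r ^ ((n : ℝ) + 2 * σ)) := by
    simp only [smul_eq_mul]
    fun_prop
  constructor
  · have hmaj : IntegrableOn (fun r : ℝ => (2:ℝ) ^ ν * r ^ (1 - 2 * σ)) (Ioc 0 1) :=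
      (intervalIntegrable_iff_integrableOn_Ioc_of_le zero_le_one).1
        ((intervalIntegral.intervalIntegrable_rpow' (by linarith)).const_mul _)
    refine Integrable.mono' hmaj hmeas.aestronglyMeasurable
      ((ae_restrict_iff' measurableSet_Ioc).2 (ae_of_all _ fun r hr => ?_))
    have hr0 := hr.1
    rw [Real.norm_of_nonneg (by positivity), smul_eq_mul]
    calc r ^ (n - 1) * (min 1 (r ^ 2) * (1 + r) ^ ν / r ^ ((n : ℝ) + 2 * σ))
        = min 1 (r ^ 2) * (1 + r) ^ ν * (r ^ (n - 1) * (r ^ ((n : ℝ) + 2 * σ))⁻¹) := by ring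
      _ ≤ r ^ 2 * 2 ^ ν * r ^ (-1 - 2 * σ) := by
        rw [hpow r hr0]
        gcongr
        · exact min_le_right _ _
        · linarith [hr.2]
      _ = 2 ^ ν * r ^ (1 - 2 * σ) := by
        rw [show (1 - 2 * σ : ℝ) = (2 : ℕ) + (-1 - 2 * σ) by push_cast; ring,
          Real.rpow_add hr0, Real.rpow_natCast]
        ring
  · have hmaj : IntegrableOn (fun r : ℝ => (2:ℝ) ^ ν * r ^ (ν - 1 - 2 * σ)) (Ioi 1) :=
      (integrableOn_Ioi_rpow_of_lt (by linarith) one_pos).const_mul _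
    refine Integrable.mono' hmaj hmeas.aestronglyMeasurable
      ((ae_restrict_iff' measurableSet_Ioi).2 (ae_of_all _ fun r hr => ?_))
    have hr1 : 1 < r := hr
    have hr0 : 0 < r := by linarith
    rw [Real.norm_of_nonneg (by positivity), smul_eq_mul]
    calc r ^ (n - 1) * (min 1 (r ^ 2) * (1 + r) ^ ν / r ^ ((n : ℝ) + 2 * σ))
        = min 1 (r ^ 2) * (1 + r) ^ ν * (r ^ (n - 1) * (r ^ ((n : ℝ) + 2 * σ))⁻¹) := by ring
      _ ≤ 1 * (2 * r) ^ ν * r ^ (-1 - 2 * σ) := by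
        rw [hpow r hr0]
        gcongr
        · exact min_le_left _ _
        · linarith
      _ = 2 ^ ν * r ^ (ν - 1 - 2 * σ) := by
        rw [Real.mul_rpow (by norm_num) hr0.le,
          show (ν - 1 - 2 * σ : ℝ) = ν + (-1 - 2 * σ) by ring, Real.rpow_add hr0]
        ring

theorem one_add_norm_add_rpow_le {ν : ℝ} (hν : 0 ≤ ν) (x y : EuclideanSpace ℝ (Fin n)) :
    (1 + ‖x + y‖) ^ ν ≤ (1 + ‖x‖) ^ ν * (1 + ‖y‖) ^ ν := by
  rw [← Real.mul_rpow (by positivity) (by positivity)]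
  refine Real.rpow_le_rpow (by positivity) ?_ hν
  nlinarith [norm_add_le x y, norm_nonneg x, norm_nonneg y]

theorem abs_secondDiff_le {ν A K r : ℝ} (hν : 0 ≤ ν) (hr : 0 < r)
    {g : EuclideanSpace ℝ (Fin n) → ℝ} (hg : ∀ z, |g z| ≤ A * (1 + ‖z‖) ^ ν)
    (x : EuclideanSpace ℝ (Fin n))
    (hK : ∀ y ∈ Metric.ball 0 r, |secondDiff g x y| ≤ K * ‖y‖ ^ 2) :
    ∃ K', ∀ y, |secondDiff g x y| ≤ K' * (min 1 (‖y‖ ^ 2) * (1 + ‖y‖) ^ ν) := by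
  have hA : 0 ≤ A := by
    have := (abs_nonneg _).trans (hg 0)
    simpa using this
  have hm : 0 < min 1 (r ^ 2) := by positivity
  refine ⟨|K| * (1 + r ^ 2) + 4 * A * (1 + ‖x‖) ^ ν / min 1 (r ^ 2), fun y => ?_⟩
  have hp : 1 ≤ (1 + ‖y‖) ^ ν := Real.one_le_rpow (by linarith [norm_nonneg y]) hν
  have hpx : 1 ≤ (1 + ‖x‖) ^ ν := Real.one_le_rpow (by linarith [norm_nonneg x]) hν
  rw [add_mul]
  rcases lt_or_ge ‖y‖ r with h | h
  · have h1 := hK y (by simpa using h)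
    have h2 : ‖y‖ ^ 2 ≤ (1 + r ^ 2) * min 1 (‖y‖ ^ 2) := by
      rcases le_total 1 (‖y‖ ^ 2) with h3 | h3
      · rw [min_eq_left h3]
        nlinarith [norm_nonneg y]
      · rw [min_eq_right h3]
        nlinarith [sq_nonneg r, sq_nonneg ‖y‖]
    have h4 : min 1 (‖y‖ ^ 2) ≤ min 1 (‖y‖ ^ 2) * (1 + ‖y‖) ^ ν :=
      le_mul_of_one_le_right (by positivity) hp
    calc |secondDiff g x y| ≤ |K| * ‖y‖ ^ 2 := h1.trans (by gcongr; exact le_abs_self K)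
      _ ≤ |K| * ((1 + r ^ 2) * (min 1 (‖y‖ ^ 2) * (1 + ‖y‖) ^ ν)) := by
        gcongr
        exact h2.trans (by gcongr)
      _ = |K| * (1 + r ^ 2) * (min 1 (‖y‖ ^ 2) * (1 + ‖y‖) ^ ν) := by ring
      _ ≤ _ := le_add_of_nonneg_right (by positivity)
  · have h1 : |secondDiff g x y| ≤ 4 * A * (1 + ‖x‖) ^ ν * (1 + ‖y‖) ^ ν := by
      have e1 := (hg (x + y)).trans
        (mul_le_mul_of_nonneg_left (one_add_norm_add_rpow_le hν x y) hA)
      have e2 := (hg (x - y)).trans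
        (mul_le_mul_of_nonneg_left (by
          simpa [sub_eq_add_neg] using one_add_norm_add_rpow_le hν x (-y)) hA)
      have e3 := hg x
      have e4 : A * (1 + ‖x‖) ^ ν ≤ A * ((1 + ‖x‖) ^ ν * (1 + ‖y‖) ^ ν) := by
        gcongr
        exact le_mul_of_one_le_right (by positivity) hp
      rw [secondDiff, abs_le]
      rw [abs_le] at e1 e2 e3
      constructor <;> linarith [e1.1, e1.2, e2.1, e2.2, e3.1, e3.2]
    have h2 : min 1 (r ^ 2) ≤ min 1 (‖y‖ ^ 2) := by gcongr
    calc |secondDiff g x y| ≤ 4 * A * (1 + ‖x‖) ^ ν * (1 + ‖y‖) ^ ν := h1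
      _ = 4 * A * (1 + ‖x‖) ^ ν / min 1 (r ^ 2) * (min 1 (r ^ 2) * (1 + ‖y‖) ^ ν) := by
        field_simp
      _ ≤ 4 * A * (1 + ‖x‖) ^ ν / min 1 (r ^ 2) * (min 1 (‖y‖ ^ 2) * (1 + ‖y‖) ^ ν) := by
        gcongr
      _ ≤ _ := le_add_of_nonneg_left (by positivity)

theorem measurable_secondDiff {g : EuclideanSpace ℝ (Fin n) → ℝ} (hg : Measurable g)
    (x : EuclideanSpace ℝ (Fin n)) : Measurable (secondDiff g x) := by
  unfold secondDiff; fun_prop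

theorem integrable_secondDiff_div (hn : 1 ≤ n) {σ ν A K r : ℝ} (hσ : σ < 1) (hν : 0 ≤ ν)
    (hνσ : ν < 2 * σ) (hr : 0 < r) {g : EuclideanSpace ℝ (Fin n) → ℝ} (hgm : Measurable g)
    (hg : ∀ z, |g z| ≤ A * (1 + ‖z‖) ^ ν) (x : EuclideanSpace ℝ (Fin n))
    (hK : ∀ y ∈ Metric.ball 0 r, |secondDiff g x y| ≤ K * ‖y‖ ^ 2) :
    Integrable fun y => secondDiff g x y / ‖y‖ ^ ((n : ℝ) + 2 * σ) := by
  obtain ⟨K', hK'⟩ := abs_secondDiff_le hν hr hg x hK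
  refine ((integrable_kernelMajorant hn hσ hν hνσ).const_mul K').mono' ?_ (ae_of_all _ fun y => ?_)
  · exact ((measurable_secondDiff hgm x).div (by fun_prop)).aestronglyMeasurable
  · rw [norm_div, Real.norm_eq_abs, Real.norm_of_nonneg (by positivity), kernelMajorant,
      ← mul_div_assoc]
    gcongr
    exact hK' y

theorem integrable_pucci_secondDiff_div {σ lam Lam : ℝ} (hlam : 0 ≤ lam) (hL : lam ≤ Lam)
    {g : EuclideanSpace ℝ (Fin n) → ℝ} (hgm : Measurable g) {x : EuclideanSpace ℝ (Fin n)}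
    (h : Integrable fun y => secondDiff g x y / ‖y‖ ^ ((n : ℝ) + 2 * σ)) :
    Integrable fun y => pucci lam Lam (secondDiff g x y) / ‖y‖ ^ ((n : ℝ) + 2 * σ) := by
  refine (h.norm.const_mul Lam).mono' ?_ (ae_of_all _ fun y => ?_)
  · exact (((continuous_pucci lam Lam).measurable.comp (measurable_secondDiff hgm x)).div
      (by fun_prop)).aestronglyMeasurable
  · rw [norm_div, norm_div, ← mul_div_assoc]
    gcongr
    exact abs_pucci_le hlam hL _

theorem nonlocalLin_le_pucciMax {σ lam Lam : ℝ} (hlam : 0 ≤ lam) (hL : lam ≤ Lam)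
    {g k : EuclideanSpace ℝ (Fin n) → ℝ} (hgm : Measurable g) {x : EuclideanSpace ℝ (Fin n)}
    (h : Integrable fun y => secondDiff g x y / ‖y‖ ^ ((n : ℝ) + 2 * σ)) (hk : Measurable k)
    (hk₁ : ∀ y, lam ≤ k y) (hk₂ : ∀ y, k y ≤ Lam) :
    nonlocalLin σ k g x ≤ pucciMax σ lam Lam g x := by
  unfold nonlocalLin pucciMax
  gcongr
  · exact h.mul_bdd (c := Lam) hk.aestronglyMeasurable (ae_of_all _ fun y => by
      rw [Real.norm_of_nonneg (hlam.trans (hk₁ y))]; exact hk₂ y)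
  · exact integrable_pucci_secondDiff_div hlam hL hgm h
  · intro y
    simp only
    rw [div_mul_eq_mul_div]
    gcongr
    exact mul_le_pucci (hk₁ y) (hk₂ y)

theorem secondDiff_neg (g : EuclideanSpace ℝ (Fin n) → ℝ) (x y : EuclideanSpace ℝ (Fin n)) :
    secondDiff (fun z => -g z) x y = -secondDiff g x y := by
  simp only [secondDiff]; ring

theorem nonlocalLin_neg (σ : ℝ) (k g : EuclideanSpace ℝ (Fin n) → ℝ)
    (x : EuclideanSpace ℝ (Fin n)) :
    nonlocalLin σ k (fun z => -g z) x = -nonlocalLin σ k g x := by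
  simp only [nonlocalLin, secondDiff_neg, neg_div, neg_mul, integral_neg, mul_neg]

theorem caputoDeriv_neg (α : ℝ) (g : ℝ → ℝ) (t : ℝ) :
    caputoDeriv α (fun s => -g s) t = -caputoDeriv α g t := by
  have := caputoDeriv_const_mul α t (-1) g
  simpa using this

/-! ### Isaacs operators between the extremal operators -/

section Isaacs

variable {I J : Type*} {σ lam Lam : ℝ}
  {a : I → J → ℝ → EuclideanSpace ℝ (Fin n) → EuclideanSpace ℝ (Fin n) → ℝ}
  {g : EuclideanSpace ℝ (Fin n) → ℝ} {x : EuclideanSpace ℝ (Fin n)}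

theorem neg_pucciMax_neg_le_nonlocalLin (hlam : 0 ≤ lam) (hL : lam ≤ Lam)
    (ha : IsIsaacsCoeff lam Lam a) (hgm : Measurable g)
    (h : Integrable fun y => secondDiff g x y / ‖y‖ ^ ((n : ℝ) + 2 * σ)) (t : ℝ) (i : I) (j : J) :
    -pucciMax σ lam Lam (fun z => -g z) x ≤ nonlocalLin σ (a i j t x) g x := by
  have h' : Integrable fun y => secondDiff (fun z => -g z) x y / ‖y‖ ^ ((n : ℝ) + 2 * σ) := by
    refine h.neg.congr (ae_of_all _ fun y => ?_)
    simp only [Pi.neg_apply, secondDiff_neg, neg_div]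
  have := nonlocalLin_le_pucciMax hlam hL hgm.neg h' (ha.measurable i j t x)
    (ha.lower i j t x) (ha.upper i j t x)
  have e : nonlocalLin σ (a i j t x) (-g) x = - nonlocalLin σ (a i j t x) g x :=
    nonlocalLin_neg σ _ g x
  rw [e] at this
  exact neg_le.1 this

variable [Nonempty I] [Nonempty J]

theorem isaacs_le_pucciMax (hlam : 0 ≤ lam) (hL : lam ≤ Lam)
    (ha : IsIsaacsCoeff lam Lam a) (hgm : Measurable g)
    (h : Integrable fun y => secondDiff g x y / ‖y‖ ^ ((n : ℝ) + 2 * σ)) (t : ℝ) :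
    isaacs σ a t g x ≤ pucciMax σ lam Lam g x := by
  refine ciSup_le fun i => ?_
  obtain ⟨j⟩ := ‹Nonempty J›
  -- An infimum of reals is only meaningful for a family bounded below, so even the upper estimate
  -- needs the lower extremal bound.
  refine (ciInf_le ⟨-pucciMax σ lam Lam (fun z => -g z) x, ?_⟩ j).trans
    (nonlocalLin_le_pucciMax hlam hL hgm h (ha.measurable i j t x)
      (ha.lower i j t x) (ha.upper i j t x))
  rintro _ ⟨j, rfl⟩
  exact neg_pucciMax_neg_le_nonlocalLin hlam hL ha hgm h t i j

theorem neg_pucciMax_neg_le_isaacs (hlam : 0 ≤ lam) (hL : lam ≤ Lam)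
    (ha : IsIsaacsCoeff lam Lam a) (hgm : Measurable g)
    (h : Integrable fun y => secondDiff g x y / ‖y‖ ^ ((n : ℝ) + 2 * σ)) (t : ℝ) :
    -pucciMax σ lam Lam (fun z => -g z) x ≤ isaacs σ a t g x := by
  have hlow := neg_pucciMax_neg_le_nonlocalLin hlam hL ha hgm h t
  obtain ⟨i⟩ := ‹Nonempty I›
  refine (le_ciInf (hlow i)).trans (le_ciSup (f := fun i => ⨅ j, nonlocalLin σ (a i j t x) g x)
    ⟨pucciMax σ lam Lam g x, ?_⟩ i)
  rintro _ ⟨i, rfl⟩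
  obtain ⟨j⟩ := ‹Nonempty J›
  refine (ciInf_le ⟨-pucciMax σ lam Lam (fun z => -g z) x, ?_⟩ j).trans
    (nonlocalLin_le_pucciMax hlam hL hgm h (ha.measurable i j t x)
      (ha.lower i j t x) (ha.upper i j t x))
  rintro _ ⟨j, rfl⟩
  exact hlow i j

end Isaacs

/-- Substitute `r • y` for `y`: the kernel contributes `r^(n+2σ)` and the volume `r^(-n)`. Only
positive homogeneity of `pucci` is available, hence `0 ≤ A`. -/
theorem pucciMax_affine {σ lam Lam A r : ℝ} (hA : 0 ≤ A) (hr : 0 < r)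
    (g : EuclideanSpace ℝ (Fin n) → ℝ) (b x : EuclideanSpace ℝ (Fin n)) (c : ℝ) :
    pucciMax σ lam Lam (fun z => A * (g (b + r • z) - c)) x =
      A * r ^ (2 * σ) * pucciMax σ lam Lam g (b + r • x) := by
  have h1 : ∀ y, secondDiff (fun z => A * (g (b + r • z) - c)) x y =
      A * secondDiff g (b + r • x) (r • y) := by
    intro y
    simp only [secondDiff, smul_add, smul_sub, add_assoc, add_sub_assoc]
    ring
  have h2 := Measure.integral_comp_smul (volume : Measure (EuclideanSpace ℝ (Fin n)))
    (fun y => pucci lam Lam (secondDiff g (b + r • x) y) / ‖y‖ ^ ((n : ℝ) + 2 * σ)) r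
  rw [finrank_euclideanSpace, Fintype.card_fin, abs_of_nonneg (by positivity), smul_eq_mul] at h2
  have h3 : ∀ y : EuclideanSpace ℝ (Fin n),
      pucci lam Lam (A * secondDiff g (b + r • x) (r • y)) / ‖y‖ ^ ((n : ℝ) + 2 * σ) =
      A * r ^ ((n : ℝ) + 2 * σ) * (pucci lam Lam (secondDiff g (b + r • x) (r • y)) /
        ‖r • y‖ ^ ((n : ℝ) + 2 * σ)) := by
    intro y
    rw [pucci_const_mul hA, norm_smul, Real.norm_of_nonneg hr.le,
      Real.mul_rpow hr.le (norm_nonneg _)]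
    have : 0 < r ^ ((n : ℝ) + 2 * σ) := Real.rpow_pos_of_pos hr _
    rcases eq_or_ne (‖y‖ ^ ((n : ℝ) + 2 * σ)) 0 with h0 | h0
    · simp [h0]
    · field_simp
  simp only [pucciMax, h1, h3]
  rw [integral_const_mul, h2, Real.rpow_add hr, Real.rpow_natCast]
  field_simp

/-- `u` satisfies `∂_t^α u - M⁺ u ≤ F` in `D`, where `M⁺` is the maximal operator. The test
functions have second differences bounded by a multiple of `|y|²` at the point of contact. -/
def IsPucciSubsolution (α σ lam Lam F : ℝ) (u : EuclideanSpace ℝ (Fin n) → ℝ → ℝ)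
    (D : Set (EuclideanSpace ℝ (Fin n) × ℝ)) : Prop :=
  ∀ φ : EuclideanSpace ℝ (Fin n) × ℝ → ℝ, ContDiff ℝ 2 φ →
    ∀ (x₀ : EuclideanSpace ℝ (Fin n)) (t₀ r t₁ K : ℝ), 0 < r → t₁ < t₀ →
    Metric.ball x₀ r ×ˢ Icc t₁ t₀ ⊆ D → φ (x₀, t₀) = u x₀ t₀ →
    (∀ x ∈ Metric.ball x₀ r, ∀ t ∈ Icc t₁ t₀, u x t ≤ φ (x, t)) →
    (∀ y ∈ Metric.ball 0 r, |secondDiff (fun x => φ (x, t₀)) x₀ y| ≤ K * ‖y‖ ^ 2) →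
    caputoDeriv α (fun s => cylinderReplace u φ x₀ r t₁ t₀ x₀ s) t₀ -
      pucciMax σ lam Lam (fun y => cylinderReplace u φ x₀ r t₁ t₀ y t₀) x₀ ≤ F

theorem IsPucciSubsolution.mono {α σ lam Lam F F' : ℝ} {u : EuclideanSpace ℝ (Fin n) → ℝ → ℝ}
    {D D' : Set (EuclideanSpace ℝ (Fin n) × ℝ)} (h : IsPucciSubsolution α σ lam Lam F u D)
    (hF : F ≤ F') (hD : D' ⊆ D) : IsPucciSubsolution α σ lam Lam F' u D' :=
  fun φ hφ x₀ t₀ r t₁ K hr ht hsub h0 hle hK =>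
    (h φ hφ x₀ t₀ r t₁ K hr ht (hsub.trans hD) h0 hle hK).trans hF

theorem measurable_cylinderReplace_slice {u : EuclideanSpace ℝ (Fin n) → ℝ → ℝ}
    (hu : Measurable (Function.uncurry u)) {φ : EuclideanSpace ℝ (Fin n) × ℝ → ℝ}
    (hφ : Continuous φ) (x₁ : EuclideanSpace ℝ (Fin n)) (r t₁ t₂ t : ℝ) :
    Measurable fun y => cylinderReplace u φ x₁ r t₁ t₂ y t := by
  unfold cylinderReplace
  refine Measurable.ite ?_ (by fun_prop) (hu.comp (measurable_id.prodMk measurable_const))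
  exact measurableSet_ball.inter (MeasurableSet.const _)

theorem measurable_cylinderReplace_time {u : EuclideanSpace ℝ (Fin n) → ℝ → ℝ}
    (hu : Measurable (Function.uncurry u)) {φ : EuclideanSpace ℝ (Fin n) × ℝ → ℝ}
    (hφ : Continuous φ) (x₁ : EuclideanSpace ℝ (Fin n)) (r t₁ t₂ : ℝ)
    (x : EuclideanSpace ℝ (Fin n)) :
    Measurable fun t => cylinderReplace u φ x₁ r t₁ t₂ x t := by
  unfold cylinderReplace
  refine Measurable.ite ?_ (by fun_prop) (hu.comp (measurable_const.prodMk measurable_id))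
  exact (MeasurableSet.const _).inter measurableSet_Icc

theorem abs_cylinderReplace_le {ν A : ℝ} (hν : 0 ≤ ν) {u : EuclideanSpace ℝ (Fin n) → ℝ → ℝ}
    {t : ℝ} (hu : ∀ z, |u z t| ≤ A * (1 + ‖z‖) ^ ν) {φ : EuclideanSpace ℝ (Fin n) × ℝ → ℝ}
    (hφ : Continuous φ) (x₁ : EuclideanSpace ℝ (Fin n)) (r t₁ t₂ : ℝ) :
    ∃ A', ∀ z, |cylinderReplace u φ x₁ r t₁ t₂ z t| ≤ A' * (1 + ‖z‖) ^ ν := by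
  obtain ⟨B, hB⟩ := (isCompact_closedBall x₁ r).exists_bound_of_continuousOn
    (f := fun z => φ (z, t)) (by fun_prop)
  have hA : 0 ≤ A := by
    have := (abs_nonneg _).trans (hu 0)
    simpa using this
  refine ⟨|B| + A, fun z => ?_⟩
  have hp : 1 ≤ (1 + ‖z‖) ^ ν := Real.one_le_rpow (by linarith [norm_nonneg z]) hν
  unfold cylinderReplace
  split_ifs with h
  · refine (hB z (Metric.ball_subset_closedBall h.1)).trans ((le_abs_self B).trans ?_)
    nlinarith [abs_nonneg B]
  · refine (hu z).trans ?_
    gcongr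
    exact le_add_of_nonneg_left (abs_nonneg B)

theorem integrable_secondDiff_cylinderReplace_div (hn : 1 ≤ n) {σ ν A K r t₁ t₀ : ℝ} (hσ : σ < 1)
    (hν : 0 ≤ ν) (hνσ : ν < 2 * σ) {u : EuclideanSpace ℝ (Fin n) → ℝ → ℝ}
    (hum : Measurable (Function.uncurry u)) (hu : ∀ z, |u z t₀| ≤ A * (1 + ‖z‖) ^ ν)
    {φ : EuclideanSpace ℝ (Fin n) × ℝ → ℝ} (hφ : Continuous φ) {x₀ : EuclideanSpace ℝ (Fin n)}
    (hr : 0 < r) (ht : t₁ < t₀)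
    (hK : ∀ y ∈ Metric.ball 0 r, |secondDiff (fun x => φ (x, t₀)) x₀ y| ≤ K * ‖y‖ ^ 2) :
    Integrable fun y => secondDiff (fun y => cylinderReplace u φ x₀ r t₁ t₀ y t₀) x₀ y /
      ‖y‖ ^ ((n : ℝ) + 2 * σ) := by
  obtain ⟨A', hA'⟩ := abs_cylinderReplace_le hν hu hφ x₀ r t₁ t₀
  refine integrable_secondDiff_div (r := r) hn hσ hν hνσ hr
    (measurable_cylinderReplace_slice hum hφ x₀ r t₁ t₀ t₀) hA' x₀ (K := K) fun y hy => ?_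
  have hin : ∀ z, z ∈ Metric.ball x₀ r → cylinderReplace u φ x₀ r t₁ t₀ z t₀ = φ (z, t₀) :=
    fun z hz => if_pos ⟨hz, ht.le, le_rfl⟩
  have hy' : ‖y‖ < r := by simpa using hy
  have := hK y hy
  simp only [secondDiff] at this ⊢
  rwa [hin _ (by simpa using hy'), hin _ (by simpa [dist_eq_norm] using hy'),
    hin _ (Metric.mem_ball_self hr)]

/-! ### From viscosity solutions to extremal subsolutions -/

section Viscosity

variable {I J : Type*} [Nonempty I] [Nonempty J] {α σ lam Lam ν F : ℝ}
  {a : I → J → ℝ → EuclideanSpace ℝ (Fin n) → EuclideanSpace ℝ (Fin n) → ℝ}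
  {f u : EuclideanSpace ℝ (Fin n) → ℝ → ℝ} {D : Set (EuclideanSpace ℝ (Fin n) × ℝ)}

/-- The quadratic bound at the contact point, together with growth of order `ν < 2σ`, makes the
second difference absolutely integrable; then the Isaacs operator can be compared with the maximal
one. -/
theorem IsViscositySubsolution.isPucciSubsolution (hn : 1 ≤ n) (hlam : 0 ≤ lam) (hL : lam ≤ Lam)
    (hσ : σ < 1) (hν : 0 ≤ ν) (hνσ : ν < 2 * σ) (ha : IsIsaacsCoeff lam Lam a)
    (hum : Measurable (Function.uncurry u))
    (hu : ∀ p ∈ D, ∃ A, ∀ z, |u z p.2| ≤ A * (1 + ‖z‖) ^ ν) (hf : ∀ p ∈ D, |f p.1 p.2| ≤ F)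
    (h : IsViscositySubsolution α σ a f u D) : IsPucciSubsolution α σ lam Lam F u D := by
  intro φ hφ x₀ t₀ r t₁ K hr ht hsub h0 hle hK
  have hmem : (x₀, t₀) ∈ D := hsub ⟨Metric.mem_ball_self hr, ht.le, le_rfl⟩
  obtain ⟨A, hA⟩ := hu _ hmem
  have h1 := h.2 φ hφ x₀ r t₁ t₀ hsub x₀ (Metric.mem_ball_self hr) t₀ ⟨ht, le_rfl⟩ h0 hle
  have h2 := isaacs_le_pucciMax hlam hL ha
    (measurable_cylinderReplace_slice hum hφ.continuous x₀ r t₁ t₀ t₀)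
    (integrable_secondDiff_cylinderReplace_div hn hσ hν hνσ hum hA hφ.continuous hr ht hK) t₀
  have h3 := (abs_le.1 (hf _ hmem)).2
  simp only [fracIsaacs] at h1
  linarith

theorem cylinderReplace_neg (u : EuclideanSpace ℝ (Fin n) → ℝ → ℝ)
    (φ : EuclideanSpace ℝ (Fin n) × ℝ → ℝ) (x₁ : EuclideanSpace ℝ (Fin n)) (r t₁ t₂ : ℝ)
    (x : EuclideanSpace ℝ (Fin n)) (t : ℝ) :
    cylinderReplace (fun x t => -u x t) φ x₁ r t₁ t₂ x t =
      -cylinderReplace u (fun p => -φ p) x₁ r t₁ t₂ x t := by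
  unfold cylinderReplace
  split_ifs <;> simp

theorem IsViscositySupersolution.isPucciSubsolution_neg (hn : 1 ≤ n) (hlam : 0 ≤ lam)
    (hL : lam ≤ Lam) (hσ : σ < 1) (hν : 0 ≤ ν) (hνσ : ν < 2 * σ) (ha : IsIsaacsCoeff lam Lam a)
    (hum : Measurable (Function.uncurry u))
    (hu : ∀ p ∈ D, ∃ A, ∀ z, |u z p.2| ≤ A * (1 + ‖z‖) ^ ν) (hf : ∀ p ∈ D, |f p.1 p.2| ≤ F)
    (h : IsViscositySupersolution α σ a f u D) :
    IsPucciSubsolution α σ lam Lam F (fun x t => -u x t) D := by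
  intro φ hφ x₀ t₀ r t₁ K hr ht hsub h0 hle hK
  have hmem : (x₀, t₀) ∈ D := hsub ⟨Metric.mem_ball_self hr, ht.le, le_rfl⟩
  obtain ⟨A, hA⟩ := hu _ hmem
  have h1 := h.2 (fun p => -φ p) hφ.neg x₀ r t₁ t₀ hsub x₀ (Metric.mem_ball_self hr) t₀
    ⟨ht, le_rfl⟩ (by rw [h0, neg_neg]) fun x hx t ht => by linarith [hle x hx t ht]
  have h2 := neg_pucciMax_neg_le_isaacs hlam hL ha
    (measurable_cylinderReplace_slice hum hφ.neg.continuous x₀ r t₁ t₀ t₀)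
    (integrable_secondDiff_cylinderReplace_div (K := K) hn hσ hν hνσ hum hA hφ.neg.continuous hr ht
      fun y hy => by
        have := hK y hy
        rwa [← abs_neg, ← secondDiff_neg] at this) t₀
  have h3 := (abs_le.1 (hf _ hmem)).1
  simp only [fracIsaacs] at h1
  simp only [cylinderReplace_neg, caputoDeriv_neg]
  linarith

end Viscosity

/-! ### Translations and parabolic scalings -/

theorem mem_ball_affine_iff {r ρ : ℝ} (hr : 0 < r) (b x z : EuclideanSpace ℝ (Fin n)) :
    b + r • x ∈ Metric.ball (b + r • z) (r * ρ) ↔ x ∈ Metric.ball z ρ := by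
  rw [mem_ball_iff_norm, mem_ball_iff_norm, add_sub_add_left_eq_sub, ← smul_sub, norm_smul,
    Real.norm_of_nonneg hr.le, mul_lt_mul_iff_right₀ hr]

/-- Invariance of the class of subsolutions under translations and parabolic scalings. -/
theorem IsPucciSubsolution.affine {α σ lam Lam F A r R : ℝ} (hA : 0 < A) (hr : 0 < r)
    (hR : 0 < R) (hrR : R ^ α = r ^ (2 * σ)) {u : EuclideanSpace ℝ (Fin n) → ℝ → ℝ}
    {D D' : Set (EuclideanSpace ℝ (Fin n) × ℝ)} (h : IsPucciSubsolution α σ lam Lam F u D)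
    (b : EuclideanSpace ℝ (Fin n)) (s c : ℝ)
    (hD : ∀ x t, (x, t) ∈ D' → (b + r • x, s + R * t) ∈ D) :
    IsPucciSubsolution α σ lam Lam (A * r ^ (2 * σ) * F)
      (fun x t => A * (u (b + r • x) (s + R * t) - c)) D' := by
  intro φ hφ x₀ t₀ ρ t₁ K hρ ht hsub h0 hle hK
  set X : EuclideanSpace ℝ (Fin n) → EuclideanSpace ℝ (Fin n) := fun x => r⁻¹ • (x - b) with hX
  have hXb : ∀ x, b + r • X x = x := fun x => by simp [hX, smul_smul, hr.ne']
  have hXi : ∀ x, X (b + r • x) = x := fun x => by simp [hX, smul_smul, hr.ne']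
  set ψ : EuclideanSpace ℝ (Fin n) × ℝ → ℝ :=
    fun p => A⁻¹ * φ (X p.1, R⁻¹ * (p.2 - s)) + c with hψ
  have hψa : ∀ x t, ψ (b + r • x, s + R * t) = A⁻¹ * φ (x, t) + c := fun x t => by
    simp only [hψ, hXi]
    congr 4
    field_simp
    ring
  have hψc : ContDiff ℝ 2 ψ := by
    have : ContDiff ℝ 2 fun p : EuclideanSpace ℝ (Fin n) × ℝ => (X p.1, R⁻¹ * (p.2 - s)) := by
      simp only [hX]; fun_prop
    exact (contDiff_const.mul (hφ.comp this)).add contDiff_const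
  have htR : s + R * t₁ < s + R * t₀ := by gcongr
  have ht_iff : ∀ t, s + R * t ∈ Icc (s + R * t₁) (s + R * t₀) ↔ t ∈ Icc t₁ t₀ := fun t => by
    simp [mul_le_mul_iff_right₀ hR]
  have hsur : ∀ t, s + R * (R⁻¹ * (t - s)) = t := fun t => by field_simp; ring
  have hcyl : ∀ x t, cylinderReplace (fun x t => A * (u (b + r • x) (s + R * t) - c)) φ x₀ ρ t₁ t₀
      x t = A * (cylinderReplace u ψ (b + r • x₀) (r * ρ) (s + R * t₁) (s + R * t₀) (b + r • x)
        (s + R * t) - c) := fun x t => by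
    by_cases hc : x ∈ Metric.ball x₀ ρ ∧ t ∈ Icc t₁ t₀
    · rw [cylinderReplace, cylinderReplace, if_pos hc,
        if_pos ⟨(mem_ball_affine_iff hr b x x₀).2 hc.1, (ht_iff t).2 hc.2⟩, hψa]
      field_simp; ring
    · rw [cylinderReplace, cylinderReplace, if_neg hc,
        if_neg fun hc' => hc ⟨(mem_ball_affine_iff hr b x x₀).1 hc'.1, (ht_iff t).1 hc'.2⟩]
  have key := h ψ hψc (b + r • x₀) (s + R * t₀) (r * ρ) (s + R * t₁) (A⁻¹ * K / r ^ 2)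
    (by positivity) htR ?_ ?_ ?_ ?_
  -- The two operators acquire the factors `A * R ^ α` and `A * r ^ (2 * σ)`, which agree, so the
  -- inequality is multiplied by a constant.
  · simp only [hcyl]
    rw [caputoDeriv_affine hR A s c
      (fun t => cylinderReplace u ψ (b + r • x₀) (r * ρ) (s + R * t₁) (s + R * t₀) (b + r • x₀) t),
      pucciMax_affine hA.le hr
      (fun x => cylinderReplace u ψ (b + r • x₀) (r * ρ) (s + R * t₁) (s + R * t₀) x (s + R * t₀)),
      hrR, ← mul_sub]
    gcongr
  · rintro ⟨x, t⟩ ⟨hx, ht'⟩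
    simp only at hx ht'
    rw [← hXb x, mem_ball_affine_iff hr] at hx
    rw [← hsur t, ht_iff] at ht'
    have := hD _ _ (hsub (show (X x, R⁻¹ * (t - s)) ∈ _ from ⟨hx, ht'⟩))
    rwa [hXb, hsur] at this
  · rw [hψa, h0]; field_simp; ring
  · intro x hx t ht'
    rw [← hXb x, mem_ball_affine_iff hr] at hx
    rw [← hsur t, ht_iff] at ht'
    have := hle _ hx _ ht'
    rw [← hXb x, ← hsur t, hψa]
    beta_reduce at this
    rw [mul_comm A, ← le_div_iff₀ hA, div_eq_inv_mul] at this
    linarith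
  · intro y hy
    have hy' : r⁻¹ • y ∈ Metric.ball (0 : EuclideanSpace ℝ (Fin n)) ρ := by
      rw [mem_ball_zero_iff] at hy ⊢
      rw [norm_smul, norm_inv, Real.norm_of_nonneg hr.le, inv_mul_lt_iff₀ hr]
      exact hy
    have h1 := hK _ hy'
    have h2 : secondDiff (fun x => ψ (x, s + R * t₀)) (b + r • x₀) y =
        A⁻¹ * secondDiff (fun x => φ (x, t₀)) x₀ (r⁻¹ • y) := by
      have e1 : b + r • x₀ + y = b + r • (x₀ + r⁻¹ • y) := by
        simp [smul_smul, hr.ne', add_assoc]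
      have e2 : b + r • x₀ - y = b + r • (x₀ - r⁻¹ • y) := by
        simp [smul_sub, smul_smul, hr.ne', add_sub_assoc]
      simp only [secondDiff, e1, e2, hψa]
      ring
    rw [h2, abs_mul, abs_of_pos (inv_pos.2 hA)]
    rw [norm_smul, norm_inv, Real.norm_of_nonneg hr.le] at h1
    calc A⁻¹ * |secondDiff (fun x => φ (x, t₀)) x₀ (r⁻¹ • y)|
        ≤ A⁻¹ * (K * (r⁻¹ * ‖y‖) ^ 2) := by gcongr
      _ = _ := by field_simp

end

/-! ### The bump function and the maximal operator at a contact point -/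

noncomputable section

variable {n : ℕ}

/-- The bump function `(1 - |x|²)₊²`. -/
def bump (x : EuclideanSpace ℝ (Fin n)) : ℝ := (max (1 - ‖x‖ ^ 2) 0) ^ 2

theorem continuous_bump : Continuous (bump (n := n)) := by unfold bump; fun_prop

theorem bump_nonneg (x : EuclideanSpace ℝ (Fin n)) : 0 ≤ bump x := sq_nonneg _

theorem bump_le_one (x : EuclideanSpace ℝ (Fin n)) : bump x ≤ 1 :=
  pow_le_one₀ (le_max_right _ _) (max_le (by linarith [sq_nonneg ‖x‖]) zero_le_one)

theorem bump_of_norm_le_one {x : EuclideanSpace ℝ (Fin n)} (h : ‖x‖ ≤ 1) :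
    bump x = (1 - ‖x‖ ^ 2) ^ 2 := by
  rw [bump, max_eq_left]
  nlinarith [norm_nonneg x]

theorem bump_of_one_le_norm {x : EuclideanSpace ℝ (Fin n)} (h : 1 ≤ ‖x‖) : bump x = 0 := by
  rw [bump, max_eq_right (by nlinarith)]; simp

theorem le_bump_of_norm_le_half {x : EuclideanSpace ℝ (Fin n)} (h : ‖x‖ ≤ 1 / 2) :
    9 / 16 ≤ bump x := by
  rw [bump_of_norm_le_one (by linarith)]
  have : 3 / 4 ≤ 1 - ‖x‖ ^ 2 := by nlinarith [norm_nonneg x]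
  nlinarith

/-- Midpoint convexity of the squared positive part. As `|x + y|²` and `|x - y|²` differ only in the
sign of `2⟨x, y⟩`, it eliminates the inner product from the second difference of `bump`. -/
theorem two_mul_sq_max_le (a s : ℝ) :
    2 * (max a 0) ^ 2 ≤ (max (a - s) 0) ^ 2 + (max (a + s) 0) ^ 2 := by
  have h1 := le_max_left (a - s) 0
  have h2 := le_max_right (a - s) 0
  have h3 := le_max_left (a + s) 0
  have h4 := le_max_right (a + s) 0
  have h5 : 2 * max a 0 ≤ max (a - s) 0 + max (a + s) 0 := by
    rcases le_total a 0 with h | h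
    · rw [max_eq_right h]; linarith
    · rw [max_eq_left h]; linarith
  have h6 := le_max_right a 0
  nlinarith [sq_nonneg (max (a - s) 0 - max (a + s) 0)]

/-- The factor `1 - |x|²` is essential: the loss must vanish at the boundary of the ball, where
`bump` has a double zero. -/
theorem neg_le_secondDiff_bump {x : EuclideanSpace ℝ (Fin n)} (hx : ‖x‖ ≤ 1)
    (y : EuclideanSpace ℝ (Fin n)) :
    -(4 * (1 - ‖x‖ ^ 2) * min 1 (‖y‖ ^ 2)) ≤ secondDiff bump x y := by
  have hp : 0 ≤ 1 - ‖x‖ ^ 2 := by nlinarith [norm_nonneg x]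
  have hp1 : 1 - ‖x‖ ^ 2 ≤ 1 := by linarith [sq_nonneg ‖x‖]
  have hb : secondDiff bump x y = bump (x + y) + bump (x - y) - 2 * (1 - ‖x‖ ^ 2) ^ 2 := by
    rw [secondDiff, bump_of_norm_le_one hx]
  rcases le_total 1 (‖y‖ ^ 2) with h | h
  · rw [min_eq_left h, hb]
    nlinarith [bump_nonneg (x + y), bump_nonneg (x - y)]
  · rw [min_eq_right h, hb]
    have h1 := two_mul_sq_max_le (1 - ‖x‖ ^ 2 - ‖y‖ ^ 2) (2 * inner ℝ x y)
    have e1 : bump (x + y) = (max (1 - ‖x‖ ^ 2 - ‖y‖ ^ 2 - 2 * inner ℝ x y) 0) ^ 2 := by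
      rw [bump, norm_add_sq_real]; congr 2; ring
    have e2 : bump (x - y) = (max (1 - ‖x‖ ^ 2 - ‖y‖ ^ 2 + 2 * inner ℝ x y) 0) ^ 2 := by
      rw [bump, norm_sub_sq_real]; congr 2; ring
    rw [← e1, ← e2] at h1
    rcases le_total 0 (1 - ‖x‖ ^ 2 - ‖y‖ ^ 2) with h2 | h2
    · rw [max_eq_left h2] at h1
      nlinarith [sq_nonneg (‖y‖ ^ 2)]
    · rw [max_eq_right h2] at h1
      nlinarith

/-- Here `bump x ≤ 1 / 16`, whereas `bump` is at least `9 / 16` on the half ball. Points near the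
boundary therefore gain a fixed amount from the half ball. -/
theorem quarter_le_secondDiff_bump {x y : EuclideanSpace ℝ (Fin n)} (hx : ‖x‖ ≤ 1)
    (hx' : 1 - ‖x‖ ^ 2 ≤ 1 / 4) (hxy : ‖x + y‖ ≤ 1 / 2) : 1 / 4 ≤ secondDiff bump x y := by
  have hp : 0 ≤ 1 - ‖x‖ ^ 2 := by nlinarith [norm_nonneg x]
  rw [secondDiff, bump_of_norm_le_one hx]
  nlinarith [le_bump_of_norm_le_half hxy, bump_nonneg (x - y)]

open Classical in
theorem pucci_neg_secondDiff_bump_le {lam Lam : ℝ} (hlam : 0 ≤ lam) (hL : lam ≤ Lam)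
    {x : EuclideanSpace ℝ (Fin n)} (hx : ‖x‖ ≤ 1) (y : EuclideanSpace ℝ (Fin n)) :
    pucci lam Lam (-secondDiff bump x y) ≤ 4 * Lam * (1 - ‖x‖ ^ 2) * min 1 (‖y‖ ^ 2) -
      if 1 - ‖x‖ ^ 2 ≤ 1 / 4 ∧ ‖x + y‖ ≤ 1 / 2 then lam / 4 else 0 := by
  have hp : 0 ≤ 1 - ‖x‖ ^ 2 := by nlinarith [norm_nonneg x]
  have hLam := hlam.trans hL
  have h0 : 0 ≤ 4 * Lam * (1 - ‖x‖ ^ 2) * min 1 (‖y‖ ^ 2) := by positivity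
  split_ifs with h
  · have h1 := quarter_le_secondDiff_bump hx h.1 h.2
    rw [pucci_of_nonpos (by linarith)]
    nlinarith
  · have h1 := pucci_mono hlam hLam (neg_le.1 (neg_le_secondDiff_bump hx y))
    rw [pucci_of_nonneg (z := 4 * (1 - ‖x‖ ^ 2) * min 1 (‖y‖ ^ 2)) (by positivity)] at h1
    linarith

theorem min_div_le_kernelMajorant {σ ν : ℝ} (hν : 0 ≤ ν) (y : EuclideanSpace ℝ (Fin n)) :
    min 1 (‖y‖ ^ 2) / ‖y‖ ^ ((n : ℝ) + 2 * σ) ≤ kernelMajorant n σ ν y := by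
  unfold kernelMajorant
  gcongr
  exact le_mul_of_one_le_right (by positivity) (Real.one_le_rpow (by linarith [norm_nonneg y]) hν)

theorem rpow_div_le_kernelMajorant {σ ν : ℝ} (hν : 0 ≤ ν) {x y : EuclideanSpace ℝ (Fin n)}
    (hx : ‖x‖ ≤ 1) (hxy : 2 ≤ ‖x + y‖) :
    ‖x + y‖ ^ ν / ‖y‖ ^ ((n : ℝ) + 2 * σ) ≤ kernelMajorant n σ ν y := by
  have h1 := norm_add_le x y
  have h2 : 1 ≤ ‖y‖ := by linarith
  unfold kernelMajorant
  rw [min_eq_left (by nlinarith), one_mul]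
  gcongr
  linarith

theorem inv_two_rpow_le_inv {σ : ℝ} (hσ : 0 ≤ σ) {x y : EuclideanSpace ℝ (Fin n)} (hx : ‖x‖ ≤ 1)
    (hxy : ‖x + y‖ ≤ 1) (hy : y ≠ 0) :
    ((2:ℝ) ^ ((n : ℝ) + 2 * σ))⁻¹ ≤ (‖y‖ ^ ((n : ℝ) + 2 * σ))⁻¹ := by
  have h0 : 0 < ‖y‖ := norm_pos_iff.2 hy
  have h1 : ‖y‖ ≤ 2 := by
    have := norm_sub_le (x + y) x
    rw [add_sub_cancel_left] at this
    linarith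
  gcongr

/-- Pointwise bound of the extremal integrand for the part of a function below a barrier. -/
theorem pucci_gap_div_le {σ ν lam Lam : ℝ} (hlam : 0 ≤ lam) (hL : lam ≤ Lam) (hσ : 0 ≤ σ)
    (hν : 0 ≤ ν) {κ m ω : ℝ} (hκ₀ : 0 ≤ κ) (hκ : κ ≤ 1) (hω : 0 ≤ ω)
    {d G : EuclideanSpace ℝ (Fin n) → ℝ} {x : EuclideanSpace ℝ (Fin n)} (hx : ‖x‖ ≤ 1)
    (h₁ : ∀ z ∈ Metric.ball 0 2, 0 ≤ d z) (h₂ : ∀ z ∉ Metric.ball 0 2, -(ω * ‖z‖ ^ ν) ≤ d z)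
    (h₃ : ∀ z ∈ Metric.ball 0 1, G z - m ≤ d z) {y : EuclideanSpace ℝ (Fin n)} (hy : y ≠ 0) :
    pucci lam Lam (-d (x + y)) / ‖y‖ ^ ((n : ℝ) + 2 * σ) ≤
      -(lam * κ * ((2:ℝ) ^ ((n : ℝ) + 2 * σ))⁻¹) *
        (Metric.ball 0 1).indicator (fun z => G z - m) (x + y) +
      Lam * ω * kernelMajorant n σ ν y := by
  have hK := kernelMajorant_nonneg σ ν y
  have hLam := hlam.trans hL
  have hLK : 0 ≤ Lam * ω * kernelMajorant n σ ν y := by positivity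
  by_cases hz1 : x + y ∈ Metric.ball (0 : EuclideanSpace ℝ (Fin n)) 1
  · have hd := h₁ _ (Metric.ball_subset_ball one_le_two hz1)
    have hG := h₃ _ hz1
    rw [indicator_of_mem hz1, pucci_of_nonpos (by linarith), div_eq_mul_inv]
    have hi := inv_two_rpow_le_inv hσ hx (by simpa using (mem_ball_zero_iff.1 hz1).le) hy
    have hi0 : 0 ≤ ((2:ℝ) ^ ((n : ℝ) + 2 * σ))⁻¹ := by positivity
    have e1 : lam * d (x + y) * ((2:ℝ) ^ ((n : ℝ) + 2 * σ))⁻¹ ≤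
        lam * d (x + y) * (‖y‖ ^ ((n : ℝ) + 2 * σ))⁻¹ := by gcongr
    have e2 : lam * κ * ((2:ℝ) ^ ((n : ℝ) + 2 * σ))⁻¹ * (G (x + y) - m) ≤
        lam * κ * ((2:ℝ) ^ ((n : ℝ) + 2 * σ))⁻¹ * d (x + y) := by gcongr
    -- Only a fraction `κ` of the gain is kept. The accompanying loss `κ * m` can then be absorbed
    -- by the gain of `bump` near the boundary.
    have e3 : lam * κ * ((2:ℝ) ^ ((n : ℝ) + 2 * σ))⁻¹ * d (x + y) ≤
        lam * 1 * ((2:ℝ) ^ ((n : ℝ) + 2 * σ))⁻¹ * d (x + y) := by gcongr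
    linarith
  · rw [indicator_of_notMem hz1, mul_zero, zero_add]
    by_cases hz2 : x + y ∈ Metric.ball (0 : EuclideanSpace ℝ (Fin n)) 2
    · have hd := h₁ _ hz2
      refine le_trans (div_nonpos_of_nonpos_of_nonneg ?_ (by positivity)) hLK
      rw [pucci_of_nonpos (by linarith)]
      nlinarith
    · have hd := h₂ _ hz2
      have h5 : pucci lam Lam (-d (x + y)) ≤ Lam * (ω * ‖x + y‖ ^ ν) := by
        rw [← pucci_of_nonneg (lam := lam) (by positivity : 0 ≤ ω * ‖x + y‖ ^ ν)]
        exact pucci_mono hlam hLam (by linarith)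
      have h6 := rpow_div_le_kernelMajorant (σ := σ) hν hx (by simpa using hz2)
      calc _ ≤ Lam * (ω * ‖x + y‖ ^ ν) / ‖y‖ ^ ((n : ℝ) + 2 * σ) := by gcongr
        _ = Lam * ω * (‖x + y‖ ^ ν / ‖y‖ ^ ((n : ℝ) + 2 * σ)) := by ring
        _ ≤ _ := by gcongr

/-- The loss is linear in `p = 1 - |x|²`, but `bump = p²`. If `p ≤ 1 / 4`, the boundary gain `2c`
leaves `2qp - c ≤ q²p² / c`; if `p > 1 / 4`, then `p ≤ 4p²` and `1 ≤ 16p²`. -/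
theorem contact_coeff_le {q c p b : ℝ} (hq : 0 ≤ q) (hc : 0 < c) (hb : p ≤ 1 / 4 → b / 2 = 2 * c)
    (hb' : 0 ≤ b) : 2 * q * p - b / 2 + c ≤ (q ^ 2 / c + 8 * q + 16 * c) * p ^ 2 := by
  have h0 : 0 ≤ q ^ 2 / c * p ^ 2 := by positivity
  by_cases h : p ≤ 1 / 4
  · have e2 : 2 * q * p ≤ c + q ^ 2 / c * p ^ 2 := by
      have := sq_nonneg (c - q * p)
      rw [div_mul_eq_mul_div, ← sub_le_iff_le_add', le_div_iff₀ hc]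
      linarith
    have e3 : 0 ≤ (8 * q + 16 * c) * p ^ 2 := by positivity
    linarith [hb h]
  · have h' : 1 / 4 ≤ p := by linarith
    have e2 : 8 * q * (p * (1 / 4)) ≤ 8 * q * p ^ 2 := by
      gcongr
      nlinarith
    have e3 : 16 * c * (1 / 16) ≤ 16 * c * p ^ 2 := by
      gcongr
      nlinarith
    linarith

/-- A bound for the maximal operator at a point where a function touches the barrier
`a - m * bump` from below. -/
def ContactBound (n : ℕ) (σ ν lam Lam C c A : ℝ) : Prop :=
  ∀ (v G : EuclideanSpace ℝ (Fin n) → ℝ) (x : EuclideanSpace ℝ (Fin n)) (a m ω : ℝ),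
    Measurable v → (Integrable fun y => secondDiff v x y / ‖y‖ ^ ((n : ℝ) + 2 * σ)) →
    IntegrableOn G (Metric.ball 0 1) → ‖x‖ ≤ 1 → 0 ≤ m → 0 ≤ ω → v x = a - m * bump x →
    (∀ z ∈ Metric.ball 0 2, v z ≤ a - m * bump z) →
    (∀ z ∉ Metric.ball 0 2, v z ≤ a + ω * ‖z‖ ^ ν) →
    (∀ z ∈ Metric.ball 0 1, v z ≤ a - G z) →
    pucciMax σ lam Lam v x ≤ C * m * bump x - c * (∫ z in Metric.ball 0 1, G z) + A * ω

/-- Write `v = a - m * bump - d`, where `d ≥ 0` in `B_2` and `d x = 0`. By sublinearity the `bump`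
part costs `C m bump x` after its boundary gain is used, `d` in `B_1` yields `-c ∫ G`, and the
growth outside `B_2` costs `A ω`. -/
theorem exists_contactBound (hn : 1 ≤ n) {σ ν lam Lam : ℝ} (hlam : 0 < lam)
    (hL : lam ≤ Lam) (hσ₀ : 0 < σ) (hσ : σ < 1) (hν : 0 ≤ ν) (hνσ : ν < 2 * σ) :
    ∃ C c A : ℝ, 0 < C ∧ 0 < c ∧ 0 < A ∧ ContactBound n σ ν lam Lam C c A := by
  set w2 : ℝ := ((2:ℝ) ^ ((n : ℝ) + 2 * σ))⁻¹ with hw2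
  have hw2p : 0 < w2 := by positivity
  set V1 : ℝ := volume.real (Metric.ball (0 : EuclideanSpace ℝ (Fin n)) 1) with hV1
  set Vh : ℝ := volume.real (Metric.closedBall (0 : EuclideanSpace ℝ (Fin n)) (1 / 2)) with hVh
  have hV1p : 0 < V1 := ENNReal.toReal_pos (Metric.measure_ball_pos _ _ one_pos).ne'
    measure_ball_lt_top.ne
  have hVhp : 0 < Vh := ENNReal.toReal_pos (Metric.measure_closedBall_pos _ _ (by norm_num)).ne'
    measure_closedBall_lt_top.ne
  have hVle : Vh ≤ V1 := measureReal_mono (Metric.closedBall_subset_ball (by norm_num))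
    measure_ball_lt_top.ne
  set P : ℝ := ∫ y, kernelMajorant n σ ν y with hP
  have hP0 : 0 ≤ P := integral_nonneg (kernelMajorant_nonneg σ ν)
  have hKi := integrable_kernelMajorant hn hσ hν hνσ
  -- Chosen so that the loss `lam * κ * w2 * V1` equals `cb`, half of the gain available near the
  -- boundary.
  set κ : ℝ := Vh / (16 * V1) with hκ
  have hκ0 : 0 < κ := by positivity
  have hκ1 : κ ≤ 1 := (div_le_one (by positivity)).2 (by linarith)
  have hLam : 0 < Lam := hlam.trans_le hL
  set cb : ℝ := lam * w2 * Vh / 16 with hcb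
  have hcbp : 0 < cb := by positivity
  -- The first constant is that of `contact_coeff_le` with `q = Lam * P`; the `+ 1` only secures
  -- positivity.
  refine ⟨(Lam * P) ^ 2 / cb + 8 * (Lam * P) + 16 * cb, lam * κ * w2, Lam * P + 1, by positivity,
    by positivity, by positivity, ?_⟩
  intro v G x a m ω hvm hvi hG hx hm hω hvx h1 h2 h3
  have hLam0 := hLam.le
  set p : ℝ := 1 - ‖x‖ ^ 2 with hp
  have hp0 : 0 ≤ p := by nlinarith [norm_nonneg x]
  set d : EuclideanSpace ℝ (Fin n) → ℝ := fun z => a - m * bump z - v z with hd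
  set I1 : EuclideanSpace ℝ (Fin n) → ℝ :=
    (Metric.ball 0 1).indicator (fun z => G z - m) with hI1
  set b : ℝ := if p ≤ 1 / 4 then lam / 4 * w2 else 0 with hb
  set Ih : EuclideanSpace ℝ (Fin n) → ℝ :=
    (Metric.closedBall 0 (1 / 2)).indicator (fun _ => b) with hIh
  set Q : EuclideanSpace ℝ (Fin n) → ℝ := fun y =>
    -(lam * κ * w2) * I1 (x + y) + Lam * ω * kernelMajorant n σ ν y with hQ
  have hI1i : Integrable I1 := by
    refine IntegrableOn.integrable_indicator ?_ measurableSet_ball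
    exact hG.sub (integrableOn_const measure_ball_lt_top.ne)
  have hIhi : Integrable Ih := IntegrableOn.integrable_indicator
    (integrableOn_const measure_closedBall_lt_top.ne) measurableSet_closedBall
  have hQi : Integrable Q := ((hI1i.comp_add_left x).const_mul _).add (hKi.const_mul _)
  have hgap := fun {y : EuclideanSpace ℝ (Fin n)} (hy : y ≠ 0) =>
    pucci_gap_div_le (σ := σ) (ν := ν) (m := m) (d := d) (G := G) hlam.le hL hσ₀.le hν hκ0.le hκ1
      hω hx (fun z hz => by simp only [hd]; linarith [h1 z hz])
      (fun z hz => by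
        simp only [hd]
        rw [bump_of_one_le_norm (by have : 2 ≤ ‖z‖ := by simpa using hz
                                    linarith)]
        linarith [h2 z hz])
      (fun z hz => by
        simp only [hd]
        nlinarith [h3 z hz, bump_le_one z]) hy
  have hpt : ∀ y : EuclideanSpace ℝ (Fin n), y ≠ 0 →
      pucci lam Lam (secondDiff v x y) / ‖y‖ ^ ((n : ℝ) + 2 * σ) ≤
        m * (4 * Lam * p * kernelMajorant n σ ν y - Ih (x + y)) + Q y + Q (-y) := by
    intro y hy
    -- No term in `d x` appears, because `x` is the contact point.
    have e1 : secondDiff v x y = m * (-secondDiff bump x y) + (-d (x + y) + -d (x - y)) := by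
      simp only [secondDiff, hd, hvx]; ring
    have e2 : pucci lam Lam (secondDiff v x y) ≤ m * pucci lam Lam (-secondDiff bump x y) +
        (pucci lam Lam (-d (x + y)) + pucci lam Lam (-d (x - y))) := by
      rw [e1, ← pucci_const_mul hm]
      exact (pucci_add_le hL _ _).trans (by gcongr; exact pucci_add_le hL _ _)
    have e3 := hgap hy
    have e4 := hgap (neg_ne_zero.2 hy)
    rw [← sub_eq_add_neg, norm_neg] at e4
    have e5 : pucci lam Lam (-secondDiff bump x y) / ‖y‖ ^ ((n : ℝ) + 2 * σ) ≤
        4 * Lam * p * kernelMajorant n σ ν y - Ih (x + y) := by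
      have e6 := pucci_neg_secondDiff_bump_le hlam.le hL hx y
      have e7 := min_div_le_kernelMajorant (σ := σ) hν y
      have e8 : Ih (x + y) ≤ (if 1 - ‖x‖ ^ 2 ≤ 1 / 4 ∧ ‖x + y‖ ≤ 1 / 2 then lam / 4 else 0) /
          ‖y‖ ^ ((n : ℝ) + 2 * σ) := by
        by_cases hc : ‖x + y‖ ≤ 1 / 2
        · rw [hIh, indicator_of_mem (by simpa using hc)]
          by_cases hc' : p ≤ 1 / 4
          · rw [hb, if_pos hc', if_pos ⟨hc', hc⟩, div_eq_mul_inv _ (‖y‖ ^ _)]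
            have := inv_two_rpow_le_inv hσ₀.le hx (by linarith) hy
            gcongr
          · rw [hb, if_neg hc', if_neg fun h => hc' h.1]
            simp
        · rw [hIh, indicator_of_notMem (by simpa using hc), if_neg fun h => hc h.2]
          simp
      calc _ ≤ (4 * Lam * p * min 1 (‖y‖ ^ 2) - if 1 - ‖x‖ ^ 2 ≤ 1 / 4 ∧ ‖x + y‖ ≤ 1 / 2 then
              lam / 4 else 0) / ‖y‖ ^ ((n : ℝ) + 2 * σ) := by gcongr
        _ = 4 * Lam * p * (min 1 (‖y‖ ^ 2) / ‖y‖ ^ ((n : ℝ) + 2 * σ)) -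
            (if 1 - ‖x‖ ^ 2 ≤ 1 / 4 ∧ ‖x + y‖ ≤ 1 / 2 then lam / 4 else 0) /
              ‖y‖ ^ ((n : ℝ) + 2 * σ) := by ring
        _ ≤ _ := by gcongr
    calc _ ≤ (m * pucci lam Lam (-secondDiff bump x y) +
        (pucci lam Lam (-d (x + y)) + pucci lam Lam (-d (x - y)))) /
          ‖y‖ ^ ((n : ℝ) + 2 * σ) := by gcongr
      _ = m * (pucci lam Lam (-secondDiff bump x y) / ‖y‖ ^ ((n : ℝ) + 2 * σ)) +
          pucci lam Lam (-d (x + y)) / ‖y‖ ^ ((n : ℝ) + 2 * σ) +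
          pucci lam Lam (-d (x - y)) / ‖y‖ ^ ((n : ℝ) + 2 * σ) := by ring
      _ ≤ _ := by
        gcongr
        simpa only [hQ, ← sub_eq_add_neg] using e4
  have : Nonempty (Fin n) := ⟨⟨0, hn⟩⟩
  have hne : ∀ᵐ y : EuclideanSpace ℝ (Fin n), y ≠ 0 := by
    simp [ae_iff]
  have hBi : Integrable fun y => m * (4 * Lam * p * kernelMajorant n σ ν y - Ih (x + y)) :=
    ((hKi.const_mul _).sub (hIhi.comp_add_left x)).const_mul _
  have hint := integral_mono_ae (integrable_pucci_secondDiff_div hlam.le hL hvm hvi)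
    ((hBi.add hQi).add hQi.comp_neg) (hne.mono fun y hy => hpt y hy)
  have hQint : ∫ y, Q y = -(lam * κ * w2) * ((∫ z in Metric.ball 0 1, G z) - m * V1) +
      Lam * ω * P := by
    rw [hQ, integral_add ((hI1i.comp_add_left x).const_mul _) (hKi.const_mul _),
      integral_const_mul, integral_const_mul, integral_add_left_eq_self I1 x, hI1,
      integral_indicator measurableSet_ball,
      integral_sub hG (integrableOn_const measure_ball_lt_top.ne), setIntegral_const,
      smul_eq_mul, mul_comm _ m]
  have hBint : ∫ y, m * (4 * Lam * p * kernelMajorant n σ ν y - Ih (x + y)) =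
      m * (4 * Lam * p * P - b * Vh) := by
    rw [integral_const_mul, integral_sub (hKi.const_mul _) (hIhi.comp_add_left x),
      integral_const_mul, integral_add_left_eq_self Ih x, hIh,
      integral_indicator measurableSet_closedBall, setIntegral_const, smul_eq_mul, mul_comm _ b]
  have hsum : ∫ y, ((fun y => m * (4 * Lam * p * kernelMajorant n σ ν y - Ih (x + y))) + Q +
      fun y => Q (-y)) y = m * (4 * Lam * p * P - b * Vh) +
        2 * (-(lam * κ * w2) * ((∫ z in Metric.ball 0 1, G z) - m * V1) + Lam * ω * P) := by
    rw [integral_add' (hBi.add hQi) hQi.comp_neg, integral_add' hBi hQi, hBint,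
      integral_neg_eq_self Q, hQint]
    ring
  have hle : pucciMax σ lam Lam v x ≤ (1 / 2) * (m * (4 * Lam * p * P - b * Vh) +
        2 * (-(lam * κ * w2) * ((∫ z in Metric.ball 0 1, G z) - m * V1) + Lam * ω * P)) := by
    rw [pucciMax, ← hsum]
    gcongr
  have hκV : lam * κ * w2 * V1 = cb := by
    rw [hκ, hcb]; field_simp
  have hcoef : 2 * (Lam * P) * p - b * Vh / 2 + cb ≤
      ((Lam * P) ^ 2 / cb + 8 * (Lam * P) + 16 * cb) * p ^ 2 := by
    refine contact_coeff_le (by positivity) hcbp (fun hc => ?_) ?_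
    · rw [hb, if_pos hc, hcb]
      ring
    · rw [hb]
      split_ifs <;> positivity
  rw [bump_of_norm_le_one hx]
  have h7 := mul_le_mul_of_nonneg_left hcoef hm
  calc _ ≤ _ := hle
    _ = m * (2 * (Lam * P) * p - b * Vh / 2 + lam * κ * w2 * V1) -
        lam * κ * w2 * (∫ z in Metric.ball 0 1, G z) + Lam * P * ω := by ring
    _ ≤ m * (((Lam * P) ^ 2 / cb + 8 * (Lam * P) + 16 * cb) * p ^ 2) -
        lam * κ * w2 * (∫ z in Metric.ball 0 1, G z) + (Lam * P + 1) * ω := by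
      rw [hκV]
      gcongr
      linarith
    _ = _ := by ring

end

/-! ### Caputo derivatives at a contact point and the barrier -/

noncomputable section

variable {n : ℕ}

/-- Near `t₀` the increments are those of `w`; before `t₁`, growth of order `ν < α` is integrable
against `r^(-1-α)`. -/
theorem caputoIntegrable_of_eqOn {α ν B t₁ t₀ : ℝ} (hν : 0 ≤ ν) (hνα : ν < α)
    (ht : t₁ < t₀) {v w : ℝ → ℝ} (hv : Measurable v) (hw : CaputoIntegrable α w t₀)
    (h₁ : ∀ s ∈ Icc t₁ t₀, v t₀ - v s = w t₀ - w s)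
    (h₂ : ∀ s < t₁, |v t₀ - v s| ≤ B * (1 + (t₀ - s)) ^ ν) : CaputoIntegrable α v t₀ := by
  have hδ : 0 < t₀ - t₁ := sub_pos.2 ht
  unfold CaputoIntegrable at hw ⊢
  rw [← Ioc_union_Ioi_eq_Ioi hδ.le, integrableOn_union] at hw ⊢
  constructor
  · refine hw.1.congr_fun (fun r hr => ?_) measurableSet_Ioc
    simp only
    rw [h₁ _ ⟨by linarith [hr.2], by linarith [hr.1]⟩]
  · have hmaj : IntegrableOn
        (fun r : ℝ => B * ((1 / (t₀ - t₁) + 1) ^ ν * r ^ (ν - (1 + α)))) (Ioi (t₀ - t₁)) :=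
      ((integrableOn_Ioi_rpow_of_lt (by linarith) hδ).const_mul _).const_mul _
    refine Integrable.mono' hmaj ?_ ((ae_restrict_iff' measurableSet_Ioi).2
      (ae_of_all _ fun r hr => ?_))
    · exact Measurable.aestronglyMeasurable (by fun_prop)
    · have hr : t₀ - t₁ < r := hr
      have hr0 : 0 < r := hδ.trans hr
      have h3 := h₂ (t₀ - r) (by linarith)
      rw [sub_sub_cancel] at h3
      have hB : 0 ≤ B := by
        have h4 := (abs_nonneg _).trans h3
        by_contra hB
        have : 0 < (1 + r) ^ ν := by positivity
        nlinarith
      have h5 : 1 + r ≤ (1 / (t₀ - t₁) + 1) * r := by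
        have : 1 ≤ 1 / (t₀ - t₁) * r := by
          rw [one_div_mul_eq_div, one_le_div hδ]
          exact hr.le
        linarith
      rw [norm_div, Real.norm_eq_abs, Real.norm_of_nonneg (by positivity), Real.rpow_sub hr0,
        ← mul_div_assoc, ← mul_div_assoc]
      gcongr
      refine h3.trans ?_
      gcongr
      rw [← Real.mul_rpow (by positivity) hr0.le]
      gcongr

/-- Comparison of the Caputo derivatives of two functions touching at `t₀`, with an error that
only sees times before `-2T`. -/
theorem caputoDeriv_contact_ge {α ν T ω t₀ : ℝ} (hα₀ : 0 < α) (hα₁ : α < 1) (hν : 0 ≤ ν)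
    (hνα : ν < α) (hT : 0 < T) (hω : 0 ≤ ω) (ht₀ : -T ≤ t₀) {v w : ℝ → ℝ}
    (hv : CaputoIntegrable α v t₀) (hw : CaputoIntegrable α w t₀)
    (h₁ : ∀ s ∈ Icc (-(2 * T)) t₀, w t₀ - w s ≤ v t₀ - v s)
    (h₂ : ∀ s < -(2 * T), w t₀ - w s - ω * |s| ^ ν ≤ v t₀ - v s) :
    caputoDeriv α w t₀ - α / Real.Gamma (1 - α) * (ω * (2 * (T ^ (ν - α) / (α - ν)))) ≤
      caputoDeriv α v t₀ := by
  have hG : 0 < Real.Gamma (1 - α) := Real.Gamma_pos_of_pos (by linarith)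
  have hti : IntegrableOn (fun r : ℝ => 2 * r ^ (ν - α - 1)) (Ioi T) :=
    (integrableOn_Ioi_rpow_of_lt (by linarith) hT).const_mul _
  have hti' : IntegrableOn ((Ioi T).indicator fun r : ℝ => 2 * r ^ (ν - α - 1)) (Ioi 0) :=
    ((integrable_indicator_iff measurableSet_Ioi).2 hti).integrableOn
  have hint : ∫ r in Ioi 0, (Ioi T).indicator (fun r : ℝ => 2 * r ^ (ν - α - 1)) r =
      2 * (T ^ (ν - α) / (α - ν)) := by
    rw [setIntegral_indicator measurableSet_Ioi, inter_eq_right.2 (Ioi_subset_Ioi hT.le),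
      integral_const_mul, integral_Ioi_rpow_of_lt (by linarith) hT, sub_add_cancel,
      neg_div, ← div_neg, neg_sub]
  have key : ∫ r in Ioi 0, ((w t₀ - w (t₀ - r)) / r ^ (1 + α) -
        ω * (Ioi T).indicator (fun r : ℝ => 2 * r ^ (ν - α - 1)) r) ≤
      ∫ r in Ioi 0, (v t₀ - v (t₀ - r)) / r ^ (1 + α) := by
    refine setIntegral_mono_on (hw.sub (hti'.const_mul _)) hv measurableSet_Ioi fun r hr => ?_
    have hr : 0 < r := hr
    have hrp : 0 < r ^ (1 + α) := Real.rpow_pos_of_pos hr _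
    rcases lt_or_ge (t₀ - r) (-(2 * T)) with h | h
    · have hrT : T < r := by linarith
      -- From `t₀ ≥ -T` and `r > T` one gets `|t₀ - r| ≤ 2r`, and `2^ν ≤ 2` because `ν < 1`.
      have e1 : |t₀ - r| ^ ν ≤ 2 * r ^ ν := by
        have : |t₀ - r| ≤ 2 * r := by rw [abs_of_nonpos (by linarith)]; linarith
        calc |t₀ - r| ^ ν ≤ (2 * r) ^ ν := by gcongr
          _ = 2 ^ ν * r ^ ν := Real.mul_rpow (by norm_num) hr.le
          _ ≤ 2 ^ (1:ℝ) * r ^ ν := by gcongr <;> linarith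
          _ = 2 * r ^ ν := by rw [Real.rpow_one]
      have e2 : r ^ (ν - α - 1) = r ^ ν / r ^ (1 + α) := by
        rw [← Real.rpow_sub hr]; congr 1; ring
      rw [indicator_of_mem (show r ∈ Ioi T from hrT), e2]
      calc (w t₀ - w (t₀ - r)) / r ^ (1 + α) - ω * (2 * (r ^ ν / r ^ (1 + α)))
          = (w t₀ - w (t₀ - r) - ω * (2 * r ^ ν)) / r ^ (1 + α) := by ring
        _ ≤ (w t₀ - w (t₀ - r) - ω * |t₀ - r| ^ ν) / r ^ (1 + α) := by gcongr
        _ ≤ _ := div_le_div_of_nonneg_right (h₂ _ h) hrp.le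
    · have e1 : 0 ≤ (Ioi T).indicator (fun r : ℝ => 2 * r ^ (ν - α - 1)) r :=
        indicator_nonneg (fun r hr => by
          have : 0 < r := hT.trans hr
          positivity) r
      have e2 : (w t₀ - w (t₀ - r)) / r ^ (1 + α) ≤ (v t₀ - v (t₀ - r)) / r ^ (1 + α) :=
        div_le_div_of_nonneg_right (h₁ _ ⟨h, by linarith⟩) hrp.le
      have := mul_nonneg hω e1
      linarith
  rw [integral_sub hw (hti'.const_mul _), integral_const_mul, hint] at key
  rw [caputoDeriv_eq, caputoDeriv_eq, ← mul_sub]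
  gcongr

/-- The barrier `1 - c (J^α q - C J^{2α} q)(t + T) bump(x) + e J^α 1 (t + T)`. -/
def barrier (α C c e T : ℝ) (q : Polynomial ℝ) (x : EuclideanSpace ℝ (Fin n)) (t : ℝ) : ℝ :=
  1 - c * (fracInt α q (t + T) - C * fracInt (2 * α) q (t + T)) * bump x +
    e * fracInt α 1 (t + T)

/-- The derivative lowers the orders `2α, α` to `α, 0`. Up to the factor `c * bump x`, the
subtracted term is the Neumann series of `∂_t^α m + C m = q` cut after two terms. -/
theorem caputo_barrier {α C c e T t : ℝ} (hα₀ : 0 < α) (hα₁ : α < 1) (q : Polynomial ℝ)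
    (x : EuclideanSpace ℝ (Fin n)) (ht : 0 < t + T) :
    CaputoIntegrable α (barrier α C c e T q x) t ∧
      caputoDeriv α (barrier α C c e T q x) t =
        e - c * bump x * (q.eval (t + T) - C * fracInt α q (t + T)) := by
  have i1 := (caputoIntegrable_fracInt hα₀ hα₁ hα₀ q ht).const_mul (-(c * bump x))
  have i2 := (caputoIntegrable_fracInt hα₀ hα₁ (show 0 < 2 * α by linarith) q ht).const_mul
    (c * bump x * C)
  have i3 := (caputoIntegrable_fracInt hα₀ hα₁ hα₀ 1 ht).const_mul e
  have i0 := caputoIntegrable_const α 1 (t + T)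
  have hint := ((i0.add i1).add i2).add i3
  have hb : barrier α C c e T q x = fun s => 1 + -(c * bump x) * fracInt α q (s + T) +
      c * bump x * C * fracInt (2 * α) q (s + T) + e * fracInt α 1 (s + T) := by
    ext s
    simp only [barrier]
    ring
  refine ⟨?_, ?_⟩
  · rw [hb]
    exact hint.comp_add T
  · rw [hb, caputoDeriv_comp_add α t T fun τ => 1 + -(c * bump x) * fracInt α q τ +
        c * bump x * C * fracInt (2 * α) q τ + e * fracInt α 1 τ,
      caputoDeriv_add ((i0.add i1).add i2) i3,
      caputoDeriv_add (i0.add i1) i2, caputoDeriv_add i0 i1, caputoDeriv_const,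
      caputoDeriv_const_mul, caputoDeriv_const_mul, caputoDeriv_const_mul]
    have e1 := caputoDeriv_fracInt hα₀ hα₁ le_rfl q ht
    have e2 := caputoDeriv_fracInt hα₀ hα₁ hα₀.le q ht
    have e3 := caputoDeriv_fracInt hα₀ hα₁ le_rfl 1 ht
    rw [zero_add, fracInt_zero _ ht] at e1 e3
    rw [← two_mul] at e2
    rw [e1, e2, e3, Polynomial.eval_one]
    ring

theorem barrier_of_nonpos {α C c e T t : ℝ} (hα₀ : 0 < α) (q : Polynomial ℝ)
    (x : EuclideanSpace ℝ (Fin n)) (ht : t + T ≤ 0) : barrier α C c e T q x t = 1 := by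
  simp [barrier, fracInt_of_nonpos hα₀ _ ht, fracInt_of_nonpos (show 0 < 2 * α by linarith) _ ht]

theorem one_le_barrier_of_one_le_norm {α C c e T t : ℝ} (hα₀ : 0 < α) (he : 0 ≤ e)
    (q : Polynomial ℝ) {x : EuclideanSpace ℝ (Fin n)} (hx : 1 ≤ ‖x‖) :
    1 ≤ barrier α C c e T q x t := by
  have : 0 ≤ fracInt α 1 (t + T) := fracInt_nonneg hα₀ fun s _ => by simp
  rw [barrier, bump_of_one_le_norm hx]
  nlinarith [mul_nonneg he this]

theorem continuous_barrier {α C c e T : ℝ} (hα₀ : 0 < α) (q : Polynomial ℝ) :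
    Continuous fun p : EuclideanSpace ℝ (Fin n) × ℝ => barrier α C c e T q p.1 p.2 := by
  have h1 := continuous_fracInt hα₀ q
  have h2 := continuous_fracInt (show 0 < 2 * α by linarith) q
  have h3 := continuous_fracInt hα₀ 1
  have h4 := continuous_bump (n := n)
  unfold barrier
  fun_prop

/-- Inside the unit ball `bump` is a quartic polynomial. Using that polynomial as test function
gives global smoothness in `x` and an explicit quadratic bound. -/
theorem abs_secondDiff_quartic_le {x y : EuclideanSpace ℝ (Fin n)} (hx : ‖x‖ ≤ 1)
    (hy : ‖y‖ ≤ 1) (a b : ℝ) :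
    |secondDiff (fun z => a - b * (1 - ‖z‖ ^ 2) ^ 2) x y| ≤ 14 * |b| * ‖y‖ ^ 2 := by
  have e : secondDiff (fun z => a - b * (1 - ‖z‖ ^ 2) ^ 2) x y =
      b * (4 * (1 - ‖x‖ ^ 2) * ‖y‖ ^ 2 - 2 * (‖y‖ ^ 2) ^ 2 - 8 * (inner ℝ x y) ^ 2) := by
    simp only [secondDiff, norm_add_sq_real, norm_sub_sq_real]
    ring
  have hi : (inner ℝ x y) ^ 2 ≤ ‖y‖ ^ 2 := by
    rw [sq_le_sq, abs_of_nonneg (norm_nonneg y)]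
    exact (abs_real_inner_le_norm x y).trans (mul_le_of_le_one_left (norm_nonneg y) hx)
  have hx2 : ‖x‖ ^ 2 ≤ 1 := pow_le_one₀ (norm_nonneg x) hx
  have hy2 : ‖y‖ ^ 2 ≤ 1 := pow_le_one₀ (norm_nonneg y) hy
  have hx0 := sq_nonneg ‖x‖
  have hy0 := sq_nonneg ‖y‖
  have h : |4 * (1 - ‖x‖ ^ 2) * ‖y‖ ^ 2 - 2 * (‖y‖ ^ 2) ^ 2 - 8 * (inner ℝ x y) ^ 2| ≤
      14 * ‖y‖ ^ 2 := by
    rw [abs_le]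
    constructor <;> nlinarith [sq_nonneg (inner ℝ x y)]
  rw [e, abs_mul]
  calc _ ≤ |b| * (14 * ‖y‖ ^ 2) := by gcongr
    _ = _ := by ring

end

/-! ### Normalised functions and the impossibility of contact -/

noncomputable section

variable {n : ℕ}

/-- In the test cylinder the solution is replaced by the test function and the information carried
by `1 - u` is lost; on a ball of small volume this loss is negligible. -/
theorem exists_pos_volume_ball_lt (hn : 1 ≤ n) (x : EuclideanSpace ℝ (Fin n)) {ε ρ : ℝ}
    (hε : 0 < ε) (hρ : 0 < ρ) :
    ∃ δ, 0 < δ ∧ δ ≤ ρ ∧ δ ≤ 1 ∧ volume.real (Metric.ball x δ) < ε := by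
  set V1 : ℝ := volume.real (Metric.ball (0 : EuclideanSpace ℝ (Fin n)) 1) with hV1
  have hV0 : 0 ≤ V1 := measureReal_nonneg
  refine ⟨min (min ρ 1) (ε / (V1 + 1)), by positivity, (min_le_left _ _).trans (min_le_left _ _),
    (min_le_left _ _).trans (min_le_right _ _), ?_⟩
  set δ := min (min ρ 1) (ε / (V1 + 1)) with hδ
  have hδ0 : 0 < δ := by positivity
  have hδ1 : δ ≤ 1 := (min_le_left _ _).trans (min_le_right _ _)
  rw [Measure.real, Measure.addHaar_ball_of_pos volume x hδ0, finrank_euclideanSpace,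
    Fintype.card_fin, ENNReal.toReal_mul, ENNReal.toReal_ofReal (by positivity), ← Measure.real,
    ← hV1]
  calc δ ^ n * V1 ≤ δ ^ 1 * V1 := by
        gcongr 1
        exact pow_le_pow_of_le_one hδ0.le hδ1 hn
    _ ≤ ε / (V1 + 1) * V1 := by
        rw [pow_one]
        gcongr
        exact min_le_right _ _
    _ < ε := by
        rw [div_mul_eq_mul_div, div_lt_iff₀ (by positivity)]
        nlinarith

/-- The hypotheses on a normalised solution: it is bounded by `1` in `B_2 × [-2T,0]` and grows
slowly outside. -/
structure IsNormalized (T ω ν : ℝ) (u : EuclideanSpace ℝ (Fin n) → ℝ → ℝ) : Prop where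
  measurable : Measurable (Function.uncurry u)
  continuousOn : ContinuousOn (Function.uncurry u) (Metric.ball 0 2 ×ˢ Icc (-(2 * T)) 0)
  abs_le_one : ∀ x ∈ Metric.ball 0 2, ∀ t ∈ Icc (-(2 * T)) 0, |u x t| ≤ 1
  space : ∀ x ∉ Metric.ball 0 2, ∀ t ∈ Icc (-(2 * T)) 0, |u x t| ≤ 1 + ω * ‖x‖ ^ ν
  time : ∀ x ∈ Metric.ball 0 2, ∀ t < -(2 * T), |u x t| ≤ 1 + ω * |t| ^ ν

theorem IsNormalized.neg {T ω ν : ℝ} {u : EuclideanSpace ℝ (Fin n) → ℝ → ℝ}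
    (h : IsNormalized T ω ν u) : IsNormalized T ω ν (fun x t => -u x t) where
  measurable := h.measurable.neg
  continuousOn := h.continuousOn.neg
  abs_le_one x hx t ht := by rw [abs_neg]; exact h.abs_le_one x hx t ht
  space x hx t ht := by rw [abs_neg]; exact h.space x hx t ht
  time x hx t ht := by rw [abs_neg]; exact h.time x hx t ht

theorem IsNormalized.integrableOn_one_sub {T ω ν t : ℝ} {u : EuclideanSpace ℝ (Fin n) → ℝ → ℝ}
    (h : IsNormalized T ω ν u) (ht : t ∈ Icc (-(2 * T)) 0) :
    IntegrableOn (fun z => 1 - u z t) (Metric.ball 0 1) := by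
  refine Measure.integrableOn_of_bounded (M := 2) measure_ball_lt_top.ne ?_ ?_
  · have : Measurable fun z => u z t :=
      h.measurable.comp (measurable_id.prodMk measurable_const)
    exact (measurable_const.sub this).aestronglyMeasurable
  · refine (ae_restrict_iff' measurableSet_ball).2 (ae_of_all _ fun z hz => ?_)
    have := abs_le.1 (h.abs_le_one z (Metric.ball_subset_ball one_le_two hz) t ht)
    rw [Real.norm_eq_abs, abs_le]
    constructor <;> linarith [this.1, this.2]

/-- The impossibility of the solution touching the barrier from below. -/
theorem not_contact (hn : 1 ≤ n) {α σ ν lam Lam C c A T e ω η ε : ℝ}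
    (hσ : σ < 1) (hν : 0 ≤ ν) (hνσ : ν < 2 * σ) (hα₀ : 0 < α) (hα₁ : α < 1) (hνα : ν < α)
    (hCB : ContactBound n σ ν lam Lam C c A) (hC : 0 < C) (hc : 0 < c)
    (hT : 0 < T) (hT₁ : T ≤ 1 / 2) (he : 0 < e) (hω : 0 ≤ ω)
    {u : EuclideanSpace ℝ (Fin n) → ℝ → ℝ} (hu : IsNormalized T ω ν u)
    (hsub : IsPucciSubsolution α σ lam Lam η u (Metric.ball 0 2 ×ˢ Icc (-(2 * T)) 0))
    {q : Polynomial ℝ} (hq₀ : ∀ s ∈ Icc 0 T, 0 ≤ q.eval s)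
    (hJ : ∀ τ ≤ T, C * fracInt (2 * α) q τ ≤ fracInt α q τ / 2)
    (hsmall : η + α / Real.Gamma (1 - α) * (ω * (2 * (T ^ (ν - α) / (α - ν)))) + A * ω + c * ε < e)
    {x₀ : EuclideanSpace ℝ (Fin n)} {t₀ m₀ : ℝ} (hx₀ : x₀ ∈ Metric.ball 0 1)
    (ht₀ : t₀ ∈ Ioc (-T) 0) (hm₀ : 0 ≤ m₀)
    (hq₂ : q.eval (t₀ + T) ≤ (∫ z in Metric.ball 0 1, (1 - u z t₀)) + ε)
    (h0 : u x₀ t₀ = barrier α C c e T q x₀ t₀ + m₀)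
    (hle : ∀ x ∈ Metric.ball 0 2, ∀ t ∈ Icc (-(2 * T)) t₀, u x t ≤ barrier α C c e T q x t + m₀) :
    False := by
  have hτ : 0 < t₀ + T := by linarith [ht₀.1]
  have ht₀I : t₀ ∈ Icc (-(2 * T)) 0 := ⟨by linarith [ht₀.1], ht₀.2⟩
  have hx₀n : ‖x₀‖ < 1 := by simpa using hx₀
  -- a small cylinder
  set gap : ℝ := e - (η + α / Real.Gamma (1 - α) * (ω * (2 * (T ^ (ν - α) / (α - ν)))) + A * ω +
    c * ε) with hgap
  have hgap0 : 0 < gap := sub_pos.2 hsmall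
  obtain ⟨δ, hδ0, hδρ, hδ1, hδV⟩ := exists_pos_volume_ball_lt hn x₀
    (show 0 < gap / (2 * c) by positivity) (show 0 < 1 - ‖x₀‖ by linarith)
  have hball1 : Metric.ball x₀ δ ⊆ Metric.ball 0 1 :=
    Metric.ball_subset_ball' (by rw [dist_zero_right]; linarith)
  have hball2 : Metric.ball x₀ δ ⊆ Metric.ball 0 2 :=
    hball1.trans (Metric.ball_subset_ball one_le_two)
  -- The midpoint of `-T` and `t₀`: the cylinder stays away from the time `-T`, where the barrier is
  -- not smooth.
  set t₁ : ℝ := (t₀ - T) / 2 with ht₁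
  have ht₁₀ : t₁ < t₀ := by linarith
  have ht₁T : 0 < t₁ + T := by linarith
  -- the test function
  set Bt : ℝ → ℝ := fun τ => fracInt α q τ - C * fracInt (2 * α) q τ with hBt
  obtain ⟨B', hB'c, hB'⟩ := exists_contDiff_eqOn_Ici (f := Bt)
    ((contDiffOn_fracInt α q).sub (contDiffOn_const.mul (contDiffOn_fracInt (2 * α) q))) ht₁T
  obtain ⟨H', hH'c, hH'⟩ := exists_contDiff_eqOn_Ici (contDiffOn_fracInt α 1) ht₁T
  set φ : EuclideanSpace ℝ (Fin n) × ℝ → ℝ := fun p =>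
    1 + m₀ + e * H' (p.2 + T) - c * B' (p.2 + T) * (1 - ‖p.1‖ ^ 2) ^ 2 with hφ
  have hφc : ContDiff ℝ 2 φ := by
    have h1 : ContDiff ℝ 2 fun p : EuclideanSpace ℝ (Fin n) × ℝ => ‖p.1‖ ^ 2 :=
      contDiff_fst.norm_sq ℝ
    have h2 : ContDiff ℝ 2 fun p : EuclideanSpace ℝ (Fin n) × ℝ => B' (p.2 + T) :=
      hB'c.comp (contDiff_snd.add contDiff_const)
    have h3 : ContDiff ℝ 2 fun p : EuclideanSpace ℝ (Fin n) × ℝ => H' (p.2 + T) :=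
      hH'c.comp (contDiff_snd.add contDiff_const)
    exact (contDiff_const.add (contDiff_const.mul h3)).sub
      ((contDiff_const.mul h2).mul ((contDiff_const.sub h1).pow 2))
  have hφb : ∀ x ∈ Metric.ball (0 : EuclideanSpace ℝ (Fin n)) 1, ∀ t, t₁ ≤ t →
      φ (x, t) = barrier α C c e T q x t + m₀ := by
    intro x hx t ht
    have h1 : B' (t + T) = Bt (t + T) := hB' (show t₁ + T ≤ t + T by linarith)
    have h2 : H' (t + T) = fracInt α 1 (t + T) := hH' (show t₁ + T ≤ t + T by linarith)
    simp only [hφ, barrier, h1, h2, hBt]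
    rw [bump_of_norm_le_one (by simpa using (mem_ball_zero_iff.1 hx).le)]
    ring
  have hcylD : Metric.ball x₀ δ ×ˢ Icc t₁ t₀ ⊆
      Metric.ball (0 : EuclideanSpace ℝ (Fin n)) 2 ×ˢ Icc (-(2 * T)) 0 :=
    prod_mono hball2 (Icc_subset_Icc (by linarith) ht₀.2)
  have hφK : ∀ y ∈ Metric.ball (0 : EuclideanSpace ℝ (Fin n)) δ,
      |secondDiff (fun x => φ (x, t₀)) x₀ y| ≤ 14 * |c * B' (t₀ + T)| * ‖y‖ ^ 2 := fun y hy =>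
    abs_secondDiff_quartic_le hx₀n.le ((mem_ball_zero_iff.1 hy).le.trans hδ1) _ _
  have hmain := hsub φ hφc x₀ t₀ δ t₁ _ hδ0 ht₁₀ hcylD
    (by rw [hφb x₀ hx₀ t₀ ht₁₀.le, h0])
    (fun x hx t ht => by
      rw [hφb x (hball1 hx) t ht.1]
      exact hle x (hball2 hx) t ⟨by linarith [ht.1], ht.2⟩) hφK
  -- the time derivative
  have hvt_in : ∀ s ∈ Icc t₁ t₀, cylinderReplace u φ x₀ δ t₁ t₀ x₀ s =
      barrier α C c e T q x₀ s + m₀ := fun s hs => by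
    rw [cylinderReplace, if_pos ⟨Metric.mem_ball_self hδ0, hs⟩, hφb x₀ hx₀ s hs.1]
  have hvt_out : ∀ s ∉ Icc t₁ t₀, cylinderReplace u φ x₀ δ t₁ t₀ x₀ s = u x₀ s := fun s hs => by
    rw [cylinderReplace, if_neg fun h => hs h.2]
  have hvt₀ := hvt_in t₀ ⟨ht₁₀.le, le_rfl⟩
  have hx₀2 : x₀ ∈ Metric.ball (0 : EuclideanSpace ℝ (Fin n)) 2 :=
    Metric.ball_subset_ball one_le_two hx₀
  obtain ⟨hwi, hwe⟩ := caputo_barrier (C := C) (c := c) (e := e) hα₀ hα₁ q x₀ hτ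
  have hutime : ∀ s ≤ t₀, |u x₀ s| ≤ 1 + ω * |s| ^ ν := by
    intro s hs
    rcases lt_or_ge s (-(2 * T)) with h | h
    · exact hu.time x₀ hx₀2 s h
    · exact (hu.abs_le_one x₀ hx₀2 s ⟨h, hs.trans ht₀.2⟩).trans
        (le_add_of_nonneg_right (by positivity))
  have hvi : CaputoIntegrable α (fun s => cylinderReplace u φ x₀ δ t₁ t₀ x₀ s) t₀ := by
    refine caputoIntegrable_of_eqOn (B := 2 + ω) hν hνα ht₁₀
      (measurable_cylinderReplace_time hu.measurable hφc.continuous x₀ δ t₁ t₀ x₀) hwi ?_ ?_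
    · intro s hs
      simp only [hvt_in s hs, hvt₀]
      ring
    · intro s hs
      have hv0 : |cylinderReplace u φ x₀ δ t₁ t₀ x₀ t₀| ≤ 1 := by
        rw [hvt₀, ← h0]; exact hu.abs_le_one x₀ hx₀2 t₀ ht₀I
      have hvs : |cylinderReplace u φ x₀ δ t₁ t₀ x₀ s| ≤ 1 + ω * |s| ^ ν := by
        rw [hvt_out s fun h' => not_lt.2 h'.1 hs]
        exact hutime s (by linarith)
      have h1 : 1 ≤ (1 + (t₀ - s)) ^ ν := Real.one_le_rpow (by linarith) hν
      have h2 : |s| ^ ν ≤ (1 + (t₀ - s)) ^ ν := by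
        refine Real.rpow_le_rpow (abs_nonneg s) ?_ hν
        rw [abs_of_nonpos (by linarith [ht₀.2])]
        linarith [ht₀.1]
      calc _ ≤ _ := abs_sub _ _
        _ ≤ 1 + (1 + ω * |s| ^ ν) := add_le_add hv0 hvs
        _ ≤ 1 * (1 + (t₀ - s)) ^ ν + (1 * (1 + (t₀ - s)) ^ ν + ω * (1 + (t₀ - s)) ^ ν) := by
          rw [one_mul]; gcongr
        _ = _ := by ring
  -- From `-2T` on, `u` lies below the lifted barrier. Before `-2T` the barrier is `1`, and `u`
  -- exceeds it by at most `ω |s|^ν`.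
  have htime := caputoDeriv_contact_ge (w := barrier α C c e T q x₀) hα₀ hα₁ hν hνα hT hω
    ht₀.1.le hvi hwi
    (fun s hs => by
      rw [hvt₀]
      by_cases h : s ∈ Icc t₁ t₀
      · rw [hvt_in s h]; linarith
      · rw [hvt_out s h]
        linarith [hle x₀ hx₀2 s hs])
    (fun s hs => by
      rw [hvt₀, hvt_out s fun h => by linarith [h.1],
        barrier_of_nonpos hα₀ q x₀ (show s + T ≤ 0 by linarith)]
      linarith [(abs_le.1 (hutime s (by linarith))).2])
  -- the space derivative
  have hvs_in : ∀ z ∈ Metric.ball x₀ δ, cylinderReplace u φ x₀ δ t₁ t₀ z t₀ =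
      barrier α C c e T q z t₀ + m₀ := fun z hz => by
    rw [cylinderReplace, if_pos ⟨hz, ht₁₀.le, le_rfl⟩, hφb z (hball1 hz) t₀ ht₁₀.le]
  have hvs_out : ∀ z ∉ Metric.ball x₀ δ, cylinderReplace u φ x₀ δ t₁ t₀ z t₀ = u z t₀ :=
    fun z hz => by rw [cylinderReplace, if_neg fun h => hz h.1]
  have hgrow : ∀ z, |u z t₀| ≤ (1 + ω) * (1 + ‖z‖) ^ ν := by
    intro z
    have h1 : 1 ≤ (1 + ‖z‖) ^ ν := Real.one_le_rpow (by linarith [norm_nonneg z]) hν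
    have h2 : ‖z‖ ^ ν ≤ (1 + ‖z‖) ^ ν := by gcongr; linarith
    by_cases hz : z ∈ Metric.ball (0 : EuclideanSpace ℝ (Fin n)) 2
    · have := hu.abs_le_one z hz t₀ ht₀I
      nlinarith
    · have := hu.space z hz t₀ ht₀I
      nlinarith
  have hsi := integrable_secondDiff_cylinderReplace_div hn hσ hν hνσ hu.measurable hgrow
    hφc.continuous hδ0 ht₁₀ hφK
  have h1u := hu.integrableOn_one_sub ht₀I
  have hI : IntegrableOn ((Metric.ball x₀ δ).indicator fun _ => (2:ℝ)) (Metric.ball 0 1) :=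
    ((integrable_indicator_iff measurableSet_ball).2
      (integrableOn_const measure_ball_lt_top.ne)).integrableOn
  have hH0 : 0 ≤ fracInt α 1 (t₀ + T) := fracInt_nonneg hα₀ fun s _ => by simp
  have hτT : t₀ + T ≤ T := by linarith [ht₀.2]
  have hJ0 : 0 ≤ fracInt α q (t₀ + T) :=
    fracInt_nonneg hα₀ fun s hs => hq₀ s ⟨hs.1, hs.2.trans hτT⟩
  have hJ20 : 0 ≤ fracInt (2 * α) q (t₀ + T) :=
    fracInt_nonneg (by linarith) fun s hs => hq₀ s ⟨hs.1, hs.2.trans hτT⟩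
  have hBt0 : 0 ≤ Bt (t₀ + T) := by
    have := hJ _ hτT
    simp only [hBt]
    linarith
  have hwz : ∀ z : EuclideanSpace ℝ (Fin n), barrier α C c e T q z t₀ + m₀ =
      (1 + m₀ + e * fracInt α 1 (t₀ + T)) - c * Bt (t₀ + T) * bump z := fun z => by
    simp only [barrier, hBt]; ring
  have hv_le : ∀ z ∈ Metric.ball (0 : EuclideanSpace ℝ (Fin n)) 2,
      cylinderReplace u φ x₀ δ t₁ t₀ z t₀ ≤
        (1 + m₀ + e * fracInt α 1 (t₀ + T)) - c * Bt (t₀ + T) * bump z := by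
    intro z hz
    rw [← hwz]
    by_cases h : z ∈ Metric.ball x₀ δ
    · rw [hvs_in z h]
    · rw [hvs_out z h]
      exact hle z hz t₀ ⟨ht₀I.1, le_rfl⟩
  have heH : 0 ≤ e * fracInt α 1 (t₀ + T) := mul_nonneg he.le hH0
  -- On the small ball `G = (1 - u) - 2 ≤ 0` because `u ≥ -1`, so `v ≤ a - G` remains true where `v`
  -- is the test function.
  have hspace := hCB (fun z => cylinderReplace u φ x₀ δ t₁ t₀ z t₀)
    (fun z => (1 - u z t₀) - (Metric.ball x₀ δ).indicator (fun _ => (2:ℝ)) z) x₀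
    (1 + m₀ + e * fracInt α 1 (t₀ + T)) (c * Bt (t₀ + T)) ω
    (measurable_cylinderReplace_slice hu.measurable hφc.continuous x₀ δ t₁ t₀ t₀) hsi
    (h1u.sub hI) hx₀n.le (mul_nonneg hc.le hBt0) hω
    (by rw [hvt₀, hwz]) hv_le
    (fun z hz => by
      have hz' : z ∉ Metric.ball x₀ δ := fun h => hz (hball2 h)
      rw [hvs_out z hz']
      linarith [(abs_le.1 (hu.space z hz t₀ ht₀I)).2])
    (fun z hz => by
      have hz2 := Metric.ball_subset_ball one_le_two hz
      by_cases h : z ∈ Metric.ball x₀ δ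
      · rw [indicator_of_mem h]
        have h1 := hv_le z hz2
        have h2 := (abs_le.1 (hu.abs_le_one z hz2 t₀ ht₀I)).1
        have h3 := mul_nonneg (mul_nonneg hc.le hBt0) (bump_nonneg z)
        linarith
      · rw [indicator_of_notMem h, hvs_out z h]
        linarith)
  rw [integral_sub h1u hI, setIntegral_indicator measurableSet_ball, inter_eq_right.2 hball1,
    setIntegral_const, smul_eq_mul] at hspace
  -- conclusion
  set g₀ : ℝ := ∫ z in Metric.ball 0 1, (1 - u z t₀)
  have hq0 : 0 ≤ q.eval (t₀ + T) := hq₀ _ ⟨hτ.le, hτT⟩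
  have hb1 := bump_le_one x₀
  have hb0 := bump_nonneg x₀
  -- The source of the barrier is paid for by the diffusion term `c * g₀`. The terms in `C J^α q`
  -- cancel, and the remaining one, `k2`, has the favourable sign.
  have k1 : c * bump x₀ * q.eval (t₀ + T) ≤ c * (g₀ + ε) := by
    calc c * bump x₀ * q.eval (t₀ + T) ≤ c * 1 * q.eval (t₀ + T) := by gcongr
      _ ≤ c * (g₀ + ε) := by rw [mul_one]; gcongr
  have k2 : 0 ≤ c * bump x₀ * C * (C * fracInt (2 * α) q (t₀ + T)) := by positivity
  have k3 : c * (volume.real (Metric.ball x₀ δ) * 2) < gap := by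
    rw [lt_div_iff₀ (by positivity)] at hδV
    linarith
  have k4 : C * (c * Bt (t₀ + T)) * bump x₀ = c * bump x₀ * C * fracInt α q (t₀ + T) -
      c * bump x₀ * C * (C * fracInt (2 * α) q (t₀ + T)) := by simp only [hBt]; ring
  rw [k4, mul_sub c] at hspace
  rw [hwe] at htime
  have k5 : c * bump x₀ * (q.eval (t₀ + T) - C * fracInt α q (t₀ + T)) =
      c * bump x₀ * q.eval (t₀ + T) - c * bump x₀ * C * fracInt α q (t₀ + T) := by ring
  rw [k5] at htime
  simp only [hgap] at k3
  linarith

end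

/-! ### Comparison with the barrier and decay of oscillation -/

noncomputable section

variable {n : ℕ}

/-- At a positive maximum of the difference, the barrier lifted by that maximum touches `u` from
above. The maximum is not attained at `|x| = 1` or `t = -T`, where the barrier is at least `1`. -/
theorem le_barrier (hn : 1 ≤ n) {α σ ν lam Lam C c A T e ω η ε : ℝ}
    (hσ : σ < 1) (hν : 0 ≤ ν) (hνσ : ν < 2 * σ) (hα₀ : 0 < α) (hα₁ : α < 1) (hνα : ν < α)
    (hCB : ContactBound n σ ν lam Lam C c A) (hC : 0 < C) (hc : 0 < c)
    (hT : 0 < T) (hT₁ : T ≤ 1 / 2) (he : 0 < e) (hω : 0 ≤ ω)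
    {u : EuclideanSpace ℝ (Fin n) → ℝ → ℝ} (hu : IsNormalized T ω ν u)
    (hsub : IsPucciSubsolution α σ lam Lam η u (Metric.ball 0 2 ×ˢ Icc (-(2 * T)) 0))
    {q : Polynomial ℝ} (hq₀ : ∀ s ∈ Icc 0 T, 0 ≤ q.eval s)
    (hJ : ∀ τ ≤ T, C * fracInt (2 * α) q τ ≤ fracInt α q τ / 2)
    (hsmall : η + α / Real.Gamma (1 - α) * (ω * (2 * (T ^ (ν - α) / (α - ν)))) + A * ω + c * ε < e)
    (hq₂ : ∀ t ∈ Icc (-T) 0, q.eval (t + T) ≤ (∫ z in Metric.ball 0 1, (1 - u z t)) + ε)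
    {x : EuclideanSpace ℝ (Fin n)} (hx : x ∈ Metric.ball 0 1) {t : ℝ} (ht : t ∈ Icc (-T) 0) :
    u x t ≤ barrier α C c e T q x t := by
  by_contra! hlt
  have hsubset : Metric.closedBall (0 : EuclideanSpace ℝ (Fin n)) 1 ×ˢ Icc (-T) 0 ⊆
      Metric.ball 0 2 ×ˢ Icc (-(2 * T)) 0 :=
    prod_mono (Metric.closedBall_subset_ball one_lt_two) (Icc_subset_Icc (by linarith) le_rfl)
  have hcont : ContinuousOn (fun p : EuclideanSpace ℝ (Fin n) × ℝ =>
      u p.1 p.2 - barrier α C c e T q p.1 p.2) (Metric.closedBall 0 1 ×ˢ Icc (-T) 0) :=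
    (hu.continuousOn.mono hsubset).sub (continuous_barrier hα₀ q).continuousOn
  obtain ⟨⟨x₀, t₀⟩, hp₀, hmax⟩ := ((isCompact_closedBall _ _).prod isCompact_Icc).exists_isMaxOn
    ⟨(x, t), Metric.ball_subset_closedBall hx, ht⟩ hcont
  have hx₀ : ‖x₀‖ ≤ 1 := by simpa using hp₀.1
  have ht₀ : t₀ ∈ Icc (-T) 0 := hp₀.2
  have hpos : 0 < u x₀ t₀ - barrier α C c e T q x₀ t₀ :=
    lt_of_lt_of_le (sub_pos.2 hlt)
      (hmax (show (x, t) ∈ _ from ⟨Metric.ball_subset_closedBall hx, ht⟩))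
  have hu1 : ∀ z ∈ Metric.ball (0 : EuclideanSpace ℝ (Fin n)) 2, ∀ s ∈ Icc (-(2 * T)) 0,
      u z s ≤ 1 := fun z hz s hs => (abs_le.1 (hu.abs_le_one z hz s hs)).2
  have hu₀ := hu1 x₀ (hsubset hp₀).1 t₀ (hsubset hp₀).2
  have hx₀' : x₀ ∈ Metric.ball (0 : EuclideanSpace ℝ (Fin n)) 1 := by
    by_contra h
    have h : 1 ≤ ‖x₀‖ := by simpa using h
    linarith [one_le_barrier_of_one_le_norm (C := C) (c := c) (T := T) (t := t₀) hα₀ he.le q h]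
  have ht₀' : -T < t₀ := by
    by_contra! h
    rw [barrier_of_nonpos hα₀ q x₀ (by linarith)] at hpos
    linarith
  refine not_contact hn hσ hν hνσ hα₀ hα₁ hνα hCB hC hc hT hT₁ he hω hu hsub hq₀ hJ hsmall
    hx₀' ⟨ht₀', ht₀.2⟩ hpos.le (hq₂ t₀ ht₀) (by ring) fun z hz s hs => ?_
  have hs' : s ∈ Icc (-(2 * T)) 0 := ⟨hs.1, hs.2.trans ht₀.2⟩
  have hus := hu1 z hz s hs'
  rcases le_or_gt s (-T) with h | h
  · rw [barrier_of_nonpos hα₀ q z (by linarith)]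
    linarith
  · rcases le_or_gt 1 ‖z‖ with hz1 | hz1
    · linarith [one_le_barrier_of_one_le_norm (C := C) (c := c) (T := T) (t := s) hα₀ he.le q hz1]
    · have := hmax (show (z, s) ∈ Metric.closedBall (0 : EuclideanSpace ℝ (Fin n)) 1 ×ˢ Icc (-T) 0
        from ⟨by simpa using hz1.le, h.le, hs'.2⟩)
      have : u z s - barrier α C c e T q z s ≤ u x₀ t₀ - barrier α C c e T q x₀ t₀ := this
      linarith

theorem continuousOn_integral_one_sub {T ω ν : ℝ} (hT : 0 ≤ T)
    {u : EuclideanSpace ℝ (Fin n) → ℝ → ℝ} (hu : IsNormalized T ω ν u) :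
    ContinuousOn (fun t => ∫ z in Metric.ball 0 1, (1 - u z t)) (Icc (-T) 0) := by
  have hT' : Icc (-T) 0 ⊆ Icc (-(2 * T)) 0 := Icc_subset_Icc (by linarith) le_rfl
  refine continuousOn_of_dominated (bound := fun _ => 2) (fun t _ => ?_) (fun t ht => ?_) ?_ ?_
  · exact (measurable_const.sub
      (hu.measurable.comp (measurable_id.prodMk measurable_const))).aestronglyMeasurable
  · refine (ae_restrict_iff' measurableSet_ball).2 (ae_of_all _ fun z hz => ?_)
    have := abs_le.1 (hu.abs_le_one z (Metric.ball_subset_ball one_le_two hz) t (hT' ht))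
    rw [Real.norm_eq_abs, abs_le]
    constructor <;> linarith [this.1, this.2]
  · exact integrableOn_const measure_ball_lt_top.ne
  · refine (ae_restrict_iff' measurableSet_ball).2 (ae_of_all _ fun z hz => ?_)
    refine continuousOn_const.sub ?_
    exact hu.continuousOn.comp (f := fun t => (z, t)) (by fun_prop) fun t ht =>
      ⟨Metric.ball_subset_ball one_le_two hz, hT' ht⟩

theorem exists_gamma_bounds {a b : ℝ} (ha : 0 < a) :
    ∃ G : ℝ, 1 ≤ G ∧ ∀ x ∈ Icc a b, Real.Gamma x ≤ G ∧ G⁻¹ ≤ Real.Gamma x := by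
  have hc : ContinuousOn Real.Gamma (Icc a b) := fun x hx =>
    (Real.differentiableAt_Gamma fun m => by
      have : 0 < x := ha.trans_le hx.1
      have : (0:ℝ) ≤ m := m.cast_nonneg
      linarith).continuousAt.continuousWithinAt
  have hpos : ∀ x ∈ Icc a b, 0 < Real.Gamma x := fun x hx =>
    Real.Gamma_pos_of_pos (ha.trans_le hx.1)
  obtain ⟨B, hB⟩ := isCompact_Icc.exists_bound_of_continuousOn hc
  obtain ⟨B', hB'⟩ := isCompact_Icc.exists_bound_of_continuousOn
    (hc.inv₀ fun x hx => (hpos x hx).ne')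
  refine ⟨max 1 (max B B'), le_max_left _ _, fun x hx => ⟨?_, ?_⟩⟩
  · exact (le_abs_self _).trans ((hB x hx).trans ((le_max_left _ _).trans (le_max_right _ _)))
  · rw [inv_le_comm₀ (by positivity) (hpos x hx)]
    exact (le_abs_self _).trans ((hB' x hx).trans ((le_max_right _ _).trans (le_max_right _ _)))

/-- Since `(1 - α) Γ(1-α) = Γ(2-α)`, the quotient is `α (1 - α) / Γ(2-α)` and does not blow up as `α
→ 1`. -/
theorem div_gamma_one_sub_le {α G : ℝ} (hα₀ : 0 < α) (hα₁ : α < 1) (hG : 0 < G)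
    (h : G⁻¹ ≤ Real.Gamma (2 - α)) : α / Real.Gamma (1 - α) ≤ G := by
  have h1 : 0 < 1 - α := by linarith
  have h2 := Real.Gamma_pos_of_pos h1
  rw [show 2 - α = (1 - α) + 1 by ring, Real.Gamma_add_one h1.ne'] at h
  rw [div_le_iff₀ h2]
  have h3 : 1 ≤ G * ((1 - α) * Real.Gamma (1 - α)) := by
    have := mul_le_mul_of_nonneg_left h hG.le
    rwa [mul_inv_cancel₀ hG.ne'] at this
  nlinarith [mul_pos hG h2]

/-- Improvement of oscillation from one side: a normalised subsolution that stays well below `1`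
in measure at early times is below `1 - θ` at later times. -/
theorem exists_oscillation_decay (hn : 1 ≤ n) {lam Lam σ α₀ ν : ℝ} (hlam : 0 < lam)
    (hL : lam ≤ Lam) (hσ₀ : 0 < σ) (hσ : σ < 1) (hα₀ : 0 < α₀) (hα₁ : α₀ < 1) (hν : 0 ≤ ν)
    (hνα : ν < α₀) (hνσ : ν < 2 * σ) :
    ∃ T θ η ω : ℝ, 0 < T ∧ T ≤ 1 / 2 ∧ 0 < θ ∧ θ < 1 ∧ 0 < η ∧ 0 < ω ∧
      ∀ α, α₀ ≤ α → α < 1 → ∀ u : EuclideanSpace ℝ (Fin n) → ℝ → ℝ, IsNormalized T ω ν u →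
      IsPucciSubsolution α σ lam Lam η u (Metric.ball 0 2 ×ˢ Icc (-(2 * T)) 0) →
      volume.real (Metric.ball (0 : EuclideanSpace ℝ (Fin n)) 1) * (T / 2) ≤
        (∫ t in (-T)..(-(T / 2)), ∫ z in Metric.ball 0 1, (1 - u z t)) →
      ∀ x ∈ Metric.ball 0 (1 / 2), ∀ t ∈ Icc (-(T / 2)) 0, u x t ≤ 1 - θ := by
  obtain ⟨C, c, A, hC, hc, hA, hCB⟩ := exists_contactBound hn hlam hL hσ₀ hσ hν hνσ
  obtain ⟨G, hG1, hG⟩ := exists_gamma_bounds (b := 2) hα₀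
  have hG0 : 0 < G := by linarith
  set V1 : ℝ := volume.real (Metric.ball (0 : EuclideanSpace ℝ (Fin n)) 1) with hV1
  have hV1p : 0 < V1 := ENNReal.toReal_pos (Metric.measure_ball_pos _ _ one_pos).ne'
    measure_ball_lt_top.ne
  -- Short enough for the integral of order `2α`, multiplied by `C`, to be at most half of that of
  -- order `α`, for every `α ≥ α₀`.
  set T : ℝ := min (1 / 2) ((1 / (2 * C * G ^ 2)) ^ (1 / α₀)) with hT
  have hT0 : 0 < T := by positivity
  have hT1 : T ≤ 1 / 2 := min_le_left _ _
  have hTα : C * T ^ α₀ * G ≤ G⁻¹ / 2 := by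
    have h1 : T ^ α₀ ≤ 1 / (2 * C * G ^ 2) := by
      calc T ^ α₀ ≤ ((1 / (2 * C * G ^ 2)) ^ (1 / α₀)) ^ α₀ := by
            gcongr
            exact min_le_right _ _
        _ = _ := by rw [← Real.rpow_mul (by positivity), one_div_mul_cancel hα₀.ne', Real.rpow_one]
    calc C * T ^ α₀ * G ≤ C * (1 / (2 * C * G ^ 2)) * G := by gcongr
      _ = _ := by field_simp
  -- A lower bound for the coefficient of `bump` after time `-T/2`. On the half ball the barrier
  -- drops by `9/16 * μ`, and `e` is chosen so that its term returns at most half of this.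
  set μ : ℝ := c / 2 * (G⁻¹ * (V1 * (T / 2))) with hμ
  have hμ0 : 0 < μ := by positivity
  set e : ℝ := 9 / 32 * μ / G with he
  have he0 : 0 < e := by positivity
  have hαν : 0 < α₀ - ν := by linarith
  set D : ℝ := G * (2 * (T⁻¹ / (α₀ - ν))) + A with hD
  have hD0 : 0 < D := by positivity
  -- Of the margin `e`, one eighth each goes to the source, to the growth errors (whose total
  -- coefficient is at most `D`) and to the approximation error `c * ε`.
  refine ⟨T, min (1 / 2) (9 / 32 * μ), e / 8, e / 8 / D, hT0, hT1, by positivity,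
    (min_le_left _ _).trans_lt (by norm_num), by positivity, by positivity, ?_⟩
  intro α hα hα1 u hu hsub hmass x hx t ht
  have hαp : 0 < α := hα₀.trans_le hα
  set g : ℝ → ℝ := fun t => ∫ z in Metric.ball 0 1, (1 - u z t) with hg
  have hgc : ContinuousOn g (Icc (-T) 0) := continuousOn_integral_one_sub hT0.le hu
  have hT2 : Icc (-T) 0 ⊆ Icc (-(2 * T)) 0 := Icc_subset_Icc (by linarith) le_rfl
  have hg0 : ∀ t ∈ Icc (-T) 0, 0 ≤ g t := fun t ht =>
    setIntegral_nonneg measurableSet_ball fun z hz => by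
      linarith [(abs_le.1 (hu.abs_le_one z (Metric.ball_subset_ball one_le_two hz) t (hT2 ht))).2]
  set ε : ℝ := e / (8 * c) with hε
  have hε0 : 0 < ε := by positivity
  -- polynomial approximation from above
  have hshift : ContinuousOn (fun s => g (s - T) + ε / 2) (Icc 0 T) :=
    (hgc.comp (f := fun s => s - T) (by fun_prop) fun s hs =>
      ⟨by linarith [hs.1], by linarith [hs.2]⟩).add continuousOn_const
  -- Approximating `g + ε / 2` within `ε / 2` gives `g ≤ q ≤ g + ε`.
  obtain ⟨q, hq⟩ := exists_polynomial_near_of_continuousOn 0 T _ hshift (ε / 2) (by positivity)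
  have hq1 : ∀ s ∈ Icc 0 T, g (s - T) ≤ q.eval s := fun s hs => by
    linarith [(abs_lt.1 (hq s hs)).1]
  have hq2 : ∀ t ∈ Icc (-T) 0, q.eval (t + T) ≤ g t + ε := fun t ht => by
    have := (abs_lt.1 (hq (t + T) ⟨by linarith [ht.1], by linarith [ht.2]⟩)).2
    rw [add_sub_cancel_right] at this
    linarith
  have hq0 : ∀ s ∈ Icc 0 T, 0 ≤ q.eval s := fun s hs =>
    (hg0 _ ⟨by linarith [hs.1], by linarith [hs.2]⟩).trans (hq1 s hs)
  have hΓα := hG α ⟨hα, by linarith⟩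
  have hΓ1 := hG (1 + α) ⟨by linarith, by linarith⟩
  have hΓ2 := hG (2 * α) ⟨by linarith, by linarith⟩
  have hΓ3 := hG (2 - α) ⟨by linarith, by linarith⟩
  have hJ : ∀ τ ≤ T, C * fracInt (2 * α) q τ ≤ fracInt α q τ / 2 := by
    refine fun τ hτ => mul_fracInt_two_mul_le hαp hC.le ?_ hq0 hτ
    have h1 : T ^ α ≤ T ^ α₀ := Real.rpow_le_rpow_of_exponent_ge hT0 (by linarith) hα
    calc C * T ^ α * Real.Gamma α ≤ C * T ^ α₀ * G := by
          have := (Real.Gamma_pos_of_pos hαp).le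
          gcongr
          exact hΓα.1
      _ ≤ G⁻¹ / 2 := hTα
      _ ≤ _ := by
        gcongr
        exact hΓ2.2
  have hcα := div_gamma_one_sub_le hαp hα1 hG0 hΓ3.2
  have hsmall : e / 8 + α / Real.Gamma (1 - α) *
      (e / 8 / D * (2 * (T ^ (ν - α) / (α - ν)))) + A * (e / 8 / D) + c * ε < e := by
    have h1 : T ^ (ν - α) ≤ T⁻¹ := by
      rw [← Real.rpow_neg_one]
      exact Real.rpow_le_rpow_of_exponent_ge hT0 (by linarith) (by linarith)
    have h2 : T ^ (ν - α) / (α - ν) ≤ T⁻¹ / (α₀ - ν) := by gcongr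
    have h3 : 0 ≤ T ^ (ν - α) / (α - ν) := div_nonneg (by positivity) (by linarith)
    have h4 : α / Real.Gamma (1 - α) * (e / 8 / D * (2 * (T ^ (ν - α) / (α - ν)))) ≤
        G * (e / 8 / D * (2 * (T⁻¹ / (α₀ - ν)))) := by gcongr
    have h5 : G * (e / 8 / D * (2 * (T⁻¹ / (α₀ - ν)))) + A * (e / 8 / D) = e / 8 := by
      rw [show G * (e / 8 / D * (2 * (T⁻¹ / (α₀ - ν)))) + A * (e / 8 / D) = e / 8 / D * D by
        rw [hD]; ring]
      field_simp
    have h6 : c * ε = e / 8 := by rw [hε]; field_simp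
    linarith
  have htT : t ∈ Icc (-T) 0 := ⟨by linarith [ht.1], ht.2⟩
  have hbar := le_barrier hn hσ hν hνσ hαp hα1 (by linarith) hCB hC hc hT0 hT1 he0 (by positivity)
    hu hsub hq0 hJ hsmall hq2 (Metric.ball_subset_ball (by norm_num) hx) htT
  -- lower bound of the barrier coefficient
  have hτT : t + T ≤ T := by linarith [ht.2]
  have hmass' : V1 * (T / 2) ≤ ∫ s in (0:ℝ)..(T / 2), q.eval s := by
    refine hmass.trans ?_
    have e1 : ∫ t in (-T)..(-(T / 2)), g t = ∫ s in (0:ℝ)..(T / 2), g (s - T) := by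
      rw [intervalIntegral.integral_comp_sub_right g T]
      congr 1 <;> ring
    rw [e1]
    refine intervalIntegral.integral_mono_on (by linarith) ?_
      (Continuous.intervalIntegrable (by fun_prop) _ _) fun s hs => hq1 s ⟨hs.1, by linarith [hs.2]⟩
    refine ContinuousOn.intervalIntegrable_of_Icc (by linarith) ?_
    exact hgc.comp (f := fun s => s - T) (by fun_prop) fun s hs =>
      ⟨by linarith [hs.1], by linarith [hs.2]⟩
  have hJlow := le_fracInt hαp hα1.le hT0 (by linarith) hq0 (show T / 2 ≤ t + T by linarith [ht.1])
    hτT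
  have hm : μ ≤ c * (fracInt α q (t + T) - C * fracInt (2 * α) q (t + T)) := by
    have h1 : G⁻¹ * (V1 * (T / 2)) ≤ fracInt α q (t + T) := by
      refine le_trans ?_ hJlow
      have := Real.Gamma_pos_of_pos hαp
      gcongr
      exact hΓα.1
    have h2 := hJ _ hτT
    have h3 : fracInt α q (t + T) / 2 ≤ fracInt α q (t + T) - C * fracInt (2 * α) q (t + T) := by
      linarith
    calc μ = c * (G⁻¹ * (V1 * (T / 2)) / 2) := by rw [hμ]; ring
      _ ≤ c * (fracInt α q (t + T) / 2) := by gcongr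
      _ ≤ _ := by gcongr
  have hH : e * fracInt α 1 (t + T) ≤ 9 / 32 * μ := by
    have h1 : fracInt α 1 (t + T) ≤ G := by
      have h0 : 0 ≤ t + T := by linarith [ht.1]
      rw [fracInt_one, max_eq_left h0, div_le_iff₀ (Real.Gamma_pos_of_pos (by linarith))]
      calc (t + T) ^ α ≤ 1 := Real.rpow_le_one h0 (by linarith) hαp.le
        _ = G * G⁻¹ := (mul_inv_cancel₀ hG0.ne').symm
        _ ≤ _ := by
          gcongr
          exact hΓ1.2
    calc e * fracInt α 1 (t + T) ≤ e * G := by gcongr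
      _ = _ := by rw [he]; field_simp
  have hbump : 9 / 16 ≤ bump x := le_bump_of_norm_le_half (by simpa using (mem_ball_zero_iff.1 hx).le)
  have hprod : μ * (9 / 16) ≤
      c * (fracInt α q (t + T) - C * fracInt (2 * α) q (t + T)) * bump x :=
    mul_le_mul hm hbump (by norm_num) (hμ0.le.trans hm)
  rw [barrier] at hbar
  have := min_le_right (1 / 2) (9 / 32 * μ)
  linarith

end

/-! ### Iteration on shrinking cylinders -/

noncomputable section

variable {n : ℕ}

theorem rpow_le_rpow_of_le_of_le {a b γ ν : ℝ} (ha : 1 ≤ a) (hab : a ≤ b) (hγ : 0 ≤ γ)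
    (hγν : γ ≤ ν) : a ^ γ ≤ b ^ ν :=
  (Real.rpow_le_rpow (by linarith) hab hγ).trans
    (Real.rpow_le_rpow_of_exponent_le (ha.trans hab) hγν)

/-- Turning bounds on geometrically growing cylinders into power growth. -/
theorem abs_le_of_dyadic {y γ D X V M : ℝ} {k : ℕ} (hy : 1 < y) (hγ : 0 ≤ γ) (hD : 1 ≤ D)
    (h₁ : ∀ i ≤ k, D < y ^ i → |V| ≤ 2 * (y ^ γ) ^ i - 1)
    (h₂ : y ^ k ≤ D → |V| ≤ X + (y ^ γ) ^ k - 1)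
    (hM : (y * D) ^ γ ≤ M) (hX : X ≤ M) : |V| ≤ 2 * M - 1 := by
  have hpow : ∀ i : ℕ, (y ^ γ) ^ i = (y ^ i) ^ γ := fun i => by
    rw [← Real.rpow_natCast, ← Real.rpow_mul (by linarith), mul_comm, Real.rpow_mul (by linarith),
      Real.rpow_natCast]
  -- The point first enters the cylinder of index `m + 1`. If `m + 1 ≤ k` its oscillation bound
  -- applies; otherwise the point is outside the original cylinder and the original growth takes
  -- over.
  obtain ⟨m, hm₁, hm₂⟩ := exists_nat_pow_near hD hy
  rcases lt_or_ge m k with h | h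
  · have h3 := h₁ (m + 1) h hm₂
    have h4 : (y ^ γ) ^ (m + 1) ≤ (y * D) ^ γ := by
      rw [hpow, pow_succ']
      gcongr
    linarith
  · have h3 : y ^ k ≤ D := (pow_le_pow_right₀ hy.le h).trans hm₁
    have h4 : (y ^ γ) ^ k ≤ (y * D) ^ γ := by
      rw [hpow]
      refine Real.rpow_le_rpow (by positivity) (h3.trans ?_) hγ
      nlinarith
    linarith [h₂ h3]

/-- A function bounded by `1` in `B_2 × [-2T,0]`, with power growth outside, for which both `u`
and `-u` are subsolutions of the extremal equation. -/
structure IsControlled (α σ lam Lam η T C ν : ℝ) (u : EuclideanSpace ℝ (Fin n) → ℝ → ℝ) :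
    Prop where
  measurable : Measurable (Function.uncurry u)
  continuousOn : ContinuousOn (Function.uncurry u) (Metric.ball 0 2 ×ˢ Icc (-(2 * T)) 0)
  abs_le_one : ∀ x ∈ Metric.ball 0 2, ∀ t ∈ Icc (-(2 * T)) 0, |u x t| ≤ 1
  space : ∀ x ∉ Metric.ball 0 2, ∀ t ∈ Icc (-(2 * T)) 0, |u x t| ≤ (C * ‖x‖) ^ ν
  time : ∀ x ∈ Metric.ball 0 2, ∀ t ≤ -(2 * T), |u x t| ≤ (C * |t|) ^ ν
  sub : IsPucciSubsolution α σ lam Lam η u (Metric.ball 0 2 ×ˢ Icc (-(2 * T)) 0)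
  sub_neg : IsPucciSubsolution α σ lam Lam η (fun x t => -u x t)
    (Metric.ball 0 2 ×ˢ Icc (-(2 * T)) 0)

theorem IsControlled.neg {α σ lam Lam η T C ν : ℝ} {u : EuclideanSpace ℝ (Fin n) → ℝ → ℝ}
    (h : IsControlled α σ lam Lam η T C ν u) :
    IsControlled α σ lam Lam η T C ν (fun x t => -u x t) where
  measurable := h.measurable.neg
  continuousOn := h.continuousOn.neg
  abs_le_one x hx t ht := by rw [abs_neg]; exact h.abs_le_one x hx t ht
  space x hx t ht := by rw [abs_neg]; exact h.space x hx t ht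
  time x hx t ht := by rw [abs_neg]; exact h.time x hx t ht
  sub := h.sub_neg
  sub_neg := by simpa only [neg_neg] using h.sub

/-- Control of the oscillation of `u` in the first `k` of a sequence of shrinking cylinders. -/
def OscControl (T ρ Y β : ℝ) (u : EuclideanSpace ℝ (Fin n) → ℝ → ℝ) (k : ℕ) (c : ℝ) : Prop :=
  |c| ≤ 1 - β ^ k ∧ ∀ j ≤ k, ∀ x ∈ Metric.ball 0 (2 * ρ ^ j), ∀ t ∈ Icc (-(2 * T * Y ^ j)) 0,
    |u x t - c| ≤ 2 * β ^ j - β ^ k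

theorem OscControl.neg {T ρ Y β c : ℝ} {u : EuclideanSpace ℝ (Fin n) → ℝ → ℝ} {k : ℕ}
    (h : OscControl T ρ Y β u k c) : OscControl T ρ Y β (fun x t => -u x t) k (-c) := by
  refine ⟨by rw [abs_neg]; exact h.1, fun j hj x hx t ht => ?_⟩
  rw [← abs_neg, neg_sub_neg, neg_sub, ← abs_neg, neg_sub, abs_sub_comm]
  exact h.2 j hj x hx t ht

/-- The rescaling of `u` to the `k`-th cylinder. -/
def rescale (ρ Y β : ℝ) (u : EuclideanSpace ℝ (Fin n) → ℝ → ℝ) (k : ℕ) (c : ℝ)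
    (x : EuclideanSpace ℝ (Fin n)) (t : ℝ) : ℝ :=
  (β⁻¹) ^ k * (u (0 + ρ ^ k • x) (0 + Y ^ k * t) - c)

/-- The relations between the parameters of the iteration. -/
structure ScaleData (α σ T C C₁ ω ν ν₁ θ ρ Y β κ : ℝ) : Prop where
  T_pos : 0 < T
  T_le : T ≤ 1 / 2
  ρ_pos : 0 < ρ
  ρ_le : ρ ≤ 1 / 4
  Y_pos : 0 < Y
  Y_le : Y ≤ 1 / 4
  Y_rpow : Y ^ α = ρ ^ (2 * σ)
  κ_pos : 0 < κ
  κ_le : κ ≤ ν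
  κ'_nonneg : 0 ≤ κ * α / (2 * σ)
  κ'_le : κ * α / (2 * σ) ≤ ν
  β_eq : β = ρ ^ κ
  β_eq' : β = Y ^ (κ * α / (2 * σ))
  β_ge : 1 - θ / 2 ≤ β
  ρ_rpow_le : ρ ^ (2 * σ) ≤ β
  C_nonneg : 0 ≤ C
  C_le : C ≤ C₁
  ρ_inv_le : ρ⁻¹ / 2 ≤ C₁
  Y_inv_le : Y⁻¹ / (2 * T) ≤ C₁
  growth : ∀ r, 2 * T ≤ r → 2 * (C₁ * r) ^ ν ≤ 2 + ω * r ^ ν₁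

section Iteration

variable {α σ lam Lam η T C C₁ ω ν ν₁ θ ρ Y β κ : ℝ} {u : EuclideanSpace ℝ (Fin n) → ℝ → ℝ}
  {k : ℕ} {c : ℝ}

theorem ScaleData.β_pos (hS : ScaleData α σ T C C₁ ω ν ν₁ θ ρ Y β κ) : 0 < β := by
  rw [hS.β_eq]; exact Real.rpow_pos_of_pos hS.ρ_pos _

theorem ScaleData.β_lt_one (hS : ScaleData α σ T C C₁ ω ν ν₁ θ ρ Y β κ) : β < 1 := by
  rw [hS.β_eq]
  exact Real.rpow_lt_one hS.ρ_pos.le (by linarith [hS.ρ_le]) hS.κ_pos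

theorem ScaleData.ρ_rpow_ν_le (hS : ScaleData α σ T C C₁ ω ν ν₁ θ ρ Y β κ) : ρ ^ ν ≤ β := by
  rw [hS.β_eq]
  exact Real.rpow_le_rpow_of_exponent_ge hS.ρ_pos (by linarith [hS.ρ_le]) hS.κ_le

theorem ScaleData.Y_rpow_ν_le (hS : ScaleData α σ T C C₁ ω ν ν₁ θ ρ Y β κ) : Y ^ ν ≤ β := by
  rw [hS.β_eq']
  exact Real.rpow_le_rpow_of_exponent_ge hS.Y_pos (by linarith [hS.Y_le]) hS.κ'_le

theorem abs_rescale (hβ : 0 < β) (x : EuclideanSpace ℝ (Fin n)) (t : ℝ) :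
    |rescale ρ Y β u k c x t| = (β⁻¹) ^ k * |u (ρ ^ k • x) (Y ^ k * t) - c| := by
  rw [rescale, abs_mul, abs_of_pos (by positivity), zero_add, zero_add]

theorem abs_rescale_le_of_cylinder (hβ : 0 < β) (hO : OscControl T ρ Y β u k c) {i : ℕ}
    (hi : i ≤ k) {x : EuclideanSpace ℝ (Fin n)} {t : ℝ}
    (hx : ρ ^ k • x ∈ Metric.ball 0 (2 * ρ ^ (k - i)))
    (ht : Y ^ k * t ∈ Icc (-(2 * T * Y ^ (k - i))) 0) :
    |rescale ρ Y β u k c x t| ≤ 2 * (β⁻¹) ^ i - 1 := by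
  rw [abs_rescale hβ]
  calc _ ≤ (β⁻¹) ^ k * (2 * β ^ (k - i) - β ^ k) := by
        gcongr
        exact hO.2 (k - i) (Nat.sub_le k i) _ hx _ ht
    _ = 2 * (β⁻¹) ^ i - 1 := by
        obtain ⟨j, rfl⟩ := Nat.exists_eq_add_of_le hi
        rw [Nat.add_sub_cancel_left]
        simp only [pow_add, inv_pow]
        field_simp

/-- The rescaling amplifies by `β^(-k)`, while evaluating the growth bound at the contracted point
gains `z^(kν) ≤ β^k`; the two compensate. -/
theorem abs_rescale_le_of_far (hβ : 0 < β) (hO : OscControl T ρ Y β u k c)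
    {z ν X : ℝ} (hz : 0 ≤ z) (hzν : z ^ ν ≤ β) (hX : 0 ≤ X)
    {x : EuclideanSpace ℝ (Fin n)} {t : ℝ} (h : |u (ρ ^ k • x) (Y ^ k * t)| ≤ (z ^ k * X) ^ ν) :
    |rescale ρ Y β u k c x t| ≤ X ^ ν + (β⁻¹) ^ k - 1 := by
  rw [abs_rescale hβ]
  have h1 : (z ^ k * X) ^ ν ≤ β ^ k * X ^ ν := by
    rw [Real.mul_rpow (by positivity) hX]
    gcongr
    rw [← Real.rpow_natCast, ← Real.rpow_mul hz, mul_comm, Real.rpow_mul hz, Real.rpow_natCast]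
    gcongr
  calc _ ≤ (β⁻¹) ^ k * (β ^ k * X ^ ν + (1 - β ^ k)) := by
        gcongr
        exact (abs_sub _ _).trans (add_le_add (h.trans h1) hO.1)
    _ = _ := by
        rw [inv_pow]
        field_simp
        ring

/-- Oscillation control in the larger cylinders means power growth with exponents `κ` in space and
`κα/(2σ)` in time, both at most `ν`. Together with the original growth this gives `2 (C₁ r)^ν - 1`,
which `growth` bounds by `1 + ω r^ν₁`. -/
theorem isNormalized_rescale (hS : ScaleData α σ T C C₁ ω ν ν₁ θ ρ Y β κ)
    (hu : IsControlled α σ lam Lam η T C ν u) (hO : OscControl T ρ Y β u k c) :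
    IsNormalized T ω ν₁ (rescale ρ Y β u k c) := by
  have hβ := hS.β_pos
  have hρ := hS.ρ_pos
  have hY := hS.Y_pos
  have hT := hS.T_pos
  have hρ1 : ρ < 1 := by linarith [hS.ρ_le]
  have hY1 : Y < 1 := by linarith [hS.Y_le]
  have hρk : 0 < ρ ^ k := by positivity
  have hYk : 0 < Y ^ k := by positivity
  have hρk1 : ρ ^ k ≤ 1 := pow_le_one₀ hρ.le hρ1.le
  have hYk1 : Y ^ k ≤ 1 := pow_le_one₀ hY.le hY1.le
  have hC1 : 0 ≤ C₁ := hS.C_nonneg.trans hS.C_le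
  have hmapx : ∀ x : EuclideanSpace ℝ (Fin n), ‖ρ ^ k • x‖ = ρ ^ k * ‖x‖ := fun x => by
    rw [norm_smul, Real.norm_of_nonneg hρk.le]
  have hb1 : β⁻¹ = (ρ⁻¹) ^ κ := by rw [hS.β_eq, Real.inv_rpow hρ.le]
  have hb2 : β⁻¹ = (Y⁻¹) ^ (κ * α / (2 * σ)) := by
    rw [Real.inv_rpow hY.le, ← hS.β_eq']
  have hYt : ∀ t ∈ Icc (-(2 * T)) 0, ∀ i, Y ^ k * t ∈ Icc (-(2 * T * Y ^ (k - i))) 0 := by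
    intro t ht i
    have h1 : Y ^ k ≤ Y ^ (k - i) := pow_le_pow_of_le_one hY.le hY1.le (Nat.sub_le k i)
    refine ⟨?_, mul_nonpos_of_nonneg_of_nonpos hYk.le ht.2⟩
    nlinarith [ht.1, ht.2]
  have hxball : ∀ x ∈ Metric.ball (0 : EuclideanSpace ℝ (Fin n)) 2, ∀ i,
      ρ ^ k • x ∈ Metric.ball (0 : EuclideanSpace ℝ (Fin n)) (2 * ρ ^ (k - i)) := by
    intro x hx i
    have h1 : ρ ^ k ≤ ρ ^ (k - i) := pow_le_pow_of_le_one hρ.le hρ1.le (Nat.sub_le k i)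
    rw [mem_ball_zero_iff] at hx ⊢
    rw [hmapx]
    nlinarith [norm_nonneg x]
  have hxball2 : ∀ x ∈ Metric.ball (0 : EuclideanSpace ℝ (Fin n)) 2,
      ρ ^ k • x ∈ Metric.ball (0 : EuclideanSpace ℝ (Fin n)) 2 := by
    intro x hx
    simpa using hxball x hx k
  have hYt2 : ∀ t ∈ Icc (-(2 * T)) 0, Y ^ k * t ∈ Icc (-(2 * T)) 0 := by
    intro t ht
    simpa using hYt t ht k
  refine ⟨?_, ?_, ?_, ?_, ?_⟩
  · have h1 : Measurable fun p : EuclideanSpace ℝ (Fin n) × ℝ =>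
        (0 + ρ ^ k • p.1, 0 + Y ^ k * p.2) := by fun_prop
    exact measurable_const.mul ((hu.measurable.comp h1).sub measurable_const)
  · refine continuousOn_const.mul (ContinuousOn.sub ?_ continuousOn_const)
    refine hu.continuousOn.comp (f := fun p : EuclideanSpace ℝ (Fin n) × ℝ =>
        (0 + ρ ^ k • p.1, 0 + Y ^ k * p.2)) (by fun_prop) fun p hp => ?_
    simp only [zero_add]
    exact ⟨hxball2 _ hp.1, hYt2 _ hp.2⟩
  · intro x hx t ht
    have := abs_rescale_le_of_cylinder hβ hO (Nat.zero_le k) (hxball x hx 0) (hYt t ht 0)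
    norm_num at this
    exact this
  · intro x hx t ht
    have hx2 : 2 ≤ ‖x‖ := by simpa using hx
    have hD : 1 ≤ ‖x‖ / 2 := by linarith
    have hy : 1 < ρ⁻¹ := (one_lt_inv₀ hρ).2 hρ1
    have hgr := hS.growth ‖x‖ (by linarith [hS.T_le])
    have key := abs_le_of_dyadic (V := rescale ρ Y β u k c x t) (k := k) (X := (C * ‖x‖) ^ ν)
      (M := (C₁ * ‖x‖) ^ ν) hy hS.κ_pos.le hD ?_ ?_ ?_ ?_
    · linarith
    · intro i hi hlt
      rw [← hb1]
      refine abs_rescale_le_of_cylinder hβ hO hi ?_ (hYt t ht i)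
      rw [mem_ball_zero_iff, hmapx, pow_sub₀ _ hρ.ne' hi, ← inv_pow]
      nlinarith
    · intro hle
      rw [← hb1]
      refine abs_rescale_le_of_far hβ hO hρ.le hS.ρ_rpow_ν_le
        (mul_nonneg hS.C_nonneg (norm_nonneg x)) ?_
      have hout : ρ ^ k • x ∉ Metric.ball (0 : EuclideanSpace ℝ (Fin n)) 2 := by
        rw [mem_ball_zero_iff, hmapx, not_lt]
        have : ρ ^ k * (ρ⁻¹) ^ k = 1 := by rw [← mul_pow, mul_inv_cancel₀ hρ.ne', one_pow]
        nlinarith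
      have := hu.space _ hout _ (hYt2 t ht)
      rwa [hmapx, mul_left_comm] at this
    · refine rpow_le_rpow_of_le_of_le (by nlinarith) ?_ hS.κ_pos.le hS.κ_le
      have := mul_le_mul_of_nonneg_right hS.ρ_inv_le (norm_nonneg x)
      linarith
    · have := hS.C_nonneg
      exact Real.rpow_le_rpow (by positivity) (by gcongr; exact hS.C_le)
        (hS.κ_pos.le.trans hS.κ_le)
  · intro x hx t ht
    have ht0 : t ≤ 0 := by linarith
    have hD : 1 ≤ |t| / (2 * T) := by
      rw [one_le_div (by positivity), abs_of_nonpos ht0]; linarith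
    have hy : 1 < Y⁻¹ := (one_lt_inv₀ hY).2 hY1
    have hgr := hS.growth |t| (by rw [abs_of_nonpos ht0]; linarith)
    have key := abs_le_of_dyadic (V := rescale ρ Y β u k c x t) (k := k) (X := (C * |t|) ^ ν)
      (M := (C₁ * |t|) ^ ν) hy hS.κ'_nonneg hD ?_ ?_ ?_ ?_
    · linarith
    · intro i hi hlt
      rw [← hb2]
      refine abs_rescale_le_of_cylinder hβ hO hi (hxball x hx i) ⟨?_, ?_⟩
      · rw [div_lt_iff₀ (by positivity), abs_of_nonpos ht0] at hlt
        rw [pow_sub₀ _ hY.ne' hi, ← inv_pow]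
        nlinarith
      · exact mul_nonpos_of_nonneg_of_nonpos hYk.le ht0
    · intro hle
      rw [← hb2]
      refine abs_rescale_le_of_far hβ hO hY.le hS.Y_rpow_ν_le
        (mul_nonneg hS.C_nonneg (abs_nonneg t)) ?_
      have hout : Y ^ k * t ≤ -(2 * T) := by
        rw [le_div_iff₀ (by positivity), abs_of_nonpos ht0] at hle
        have : Y ^ k * (Y⁻¹) ^ k = 1 := by rw [← mul_pow, mul_inv_cancel₀ hY.ne', one_pow]
        nlinarith
      have := hu.time _ (hxball2 x hx) _ hout
      rwa [abs_mul, abs_of_pos hYk, mul_left_comm] at this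
    · refine rpow_le_rpow_of_le_of_le (by nlinarith) ?_ hS.κ'_nonneg hS.κ'_le
      have := mul_le_mul_of_nonneg_right hS.Y_inv_le (abs_nonneg t)
      rwa [div_mul_eq_mul_div, mul_div_assoc] at this
    · have := hS.C_nonneg
      exact Real.rpow_le_rpow (by positivity) (by gcongr; exact hS.C_le)
        (hS.κ_pos.le.trans hS.κ_le)

/-- The source is multiplied by `(β⁻¹ ρ^(2σ))^k ≤ 1`. -/
theorem isPucciSubsolution_rescale (hS : ScaleData α σ T C C₁ ω ν ν₁ θ ρ Y β κ) (hη : 0 ≤ η)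
    (hu : IsControlled α σ lam Lam η T C ν u) :
    IsPucciSubsolution α σ lam Lam η (rescale ρ Y β u k c)
      (Metric.ball 0 2 ×ˢ Icc (-(2 * T)) 0) := by
  have hβ := hS.β_pos
  have hρ := hS.ρ_pos
  have hY := hS.Y_pos
  have hρk1 : ρ ^ k ≤ 1 := pow_le_one₀ hρ.le (by linarith [hS.ρ_le])
  have hYk1 : Y ^ k ≤ 1 := pow_le_one₀ hY.le (by linarith [hS.Y_le])
  have hYk : 0 < Y ^ k := by positivity
  have hcomm : ∀ {z : ℝ} (_ : 0 ≤ z) (s : ℝ), (z ^ k) ^ s = (z ^ s) ^ k := fun hz s => by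
    rw [← Real.rpow_natCast, ← Real.rpow_natCast, ← Real.rpow_mul hz, mul_comm, Real.rpow_mul hz]
  have h := hu.sub.affine (A := (β⁻¹) ^ k) (r := ρ ^ k) (R := Y ^ k)
    (D' := Metric.ball 0 2 ×ˢ Icc (-(2 * T)) 0) (by positivity) (by positivity)
    hYk (by rw [hcomm hY.le, hcomm hρ.le, hS.Y_rpow]) 0 0 c ?_
  · refine h.mono ?_ subset_rfl
    rw [hcomm hρ.le, ← mul_pow]
    refine mul_le_of_le_one_left hη (pow_le_one₀ (by positivity) ?_)
    rw [inv_mul_le_one₀ hβ]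
    exact hS.ρ_rpow_le
  · rintro x t ⟨hx, ht⟩
    simp only [zero_add]
    simp only at hx ht
    refine ⟨?_, ?_, ?_⟩
    · rw [mem_ball_zero_iff] at hx ⊢
      rw [norm_smul, Real.norm_of_nonneg (by positivity)]
      nlinarith [norm_nonneg x]
    · simp only
      nlinarith [ht.1, ht.2]
    · exact mul_nonpos_of_nonneg_of_nonpos hYk.le ht.2

/-- Moving the centre by `β^k - β^(k+1)` uses up exactly what the bounds `2β^j - β^k` and `1 - β^k`
allow when `k` increases. Rescaled, the new cylinder lies in the region of decay since `2ρ ≤ 1/2`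
and `2TY ≤ T/2`. -/
theorem oscControl_succ_of_le (hS : ScaleData α σ T C C₁ ω ν ν₁ θ ρ Y β κ)
    (hO : OscControl T ρ Y β u k c)
    (h : ∀ x ∈ Metric.ball 0 (1 / 2), ∀ t ∈ Icc (-(T / 2)) 0,
      -1 ≤ rescale ρ Y β u k c x t ∧ rescale ρ Y β u k c x t ≤ 1 - θ) :
    OscControl T ρ Y β u (k + 1) (c - β ^ k * (1 - β)) := by
  have hβ := hS.β_pos
  have hβ1 := hS.β_lt_one
  have hρ := hS.ρ_pos
  have hY := hS.Y_pos
  have hT := hS.T_pos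
  have hβk : 0 < β ^ k := by positivity
  have hinc : |β ^ k * (1 - β)| = β ^ k - β ^ (k + 1) := by
    rw [abs_of_nonneg (mul_nonneg hβk.le (by linarith)), pow_succ]; ring
  refine ⟨(abs_sub _ _).trans (by rw [hinc]; linarith [hO.1]), fun j hj x hx t ht => ?_⟩
  rcases hj.lt_or_eq with hj | rfl
  · have h1 := hO.2 j (Nat.lt_succ_iff.1 hj) x hx t ht
    calc |u x t - (c - β ^ k * (1 - β))| = |(u x t - c) + β ^ k * (1 - β)| := by congr 1; ring
      _ ≤ |u x t - c| + |β ^ k * (1 - β)| := abs_add_le _ _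
      _ ≤ _ := by rw [hinc]; linarith
  · have hρk : 0 < ρ ^ k := by positivity
    have hYk : 0 < Y ^ k := by positivity
    have h1 := h ((ρ ^ k)⁻¹ • x) ?_ ((Y ^ k)⁻¹ * t) ?_
    · have e : u x t - c = β ^ k * rescale ρ Y β u k c ((ρ ^ k)⁻¹ • x) ((Y ^ k)⁻¹ * t) := by
        rw [rescale, zero_add, zero_add, smul_smul, mul_inv_cancel₀ hρk.ne', one_smul,
          mul_inv_cancel_left₀ hYk.ne', inv_pow, mul_inv_cancel_left₀ hβk.ne']
      rw [show u x t - (c - β ^ k * (1 - β)) = (u x t - c) + β ^ k * (1 - β) by ring, e, ← mul_add,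
        abs_mul, abs_of_pos hβk, show 2 * β ^ (k + 1) - β ^ (k + 1) = β ^ k * β by ring]
      gcongr
      rw [abs_le]
      -- Shifting `[-1, 1 - θ]` by `1 - β` lands in `[-β, β]` precisely because `β ≥ 1 - θ / 2`.
      constructor <;> linarith [h1.1, h1.2, hS.β_ge]
    · rw [mem_ball_zero_iff] at hx ⊢
      rw [norm_smul, norm_inv, Real.norm_of_nonneg hρk.le, inv_mul_lt_iff₀ hρk]
      rw [pow_succ] at hx
      nlinarith [hS.ρ_le]
    · refine ⟨?_, mul_nonpos_of_nonneg_of_nonpos (by positivity) ht.2⟩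
      rw [le_inv_mul_iff₀ hYk]
      have := ht.1
      rw [pow_succ] at this
      nlinarith [hS.Y_le, mul_pos hT hYk]

/-- The masses of `1 - v` and `1 + v` add up to twice the threshold, so the decay applies to `v` or
to `-v`. -/
theorem exists_oscControl_succ
    (hS : ScaleData α σ T C C₁ ω ν ν₁ θ ρ Y β κ) (hη : 0 ≤ η)
    (hdecay : ∀ v : EuclideanSpace ℝ (Fin n) → ℝ → ℝ, IsNormalized T ω ν₁ v →
      IsPucciSubsolution α σ lam Lam η v (Metric.ball 0 2 ×ˢ Icc (-(2 * T)) 0) →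
      volume.real (Metric.ball (0 : EuclideanSpace ℝ (Fin n)) 1) * (T / 2) ≤
        (∫ t in (-T)..(-(T / 2)), ∫ z in Metric.ball 0 1, (1 - v z t)) →
      ∀ x ∈ Metric.ball 0 (1 / 2), ∀ t ∈ Icc (-(T / 2)) 0, v x t ≤ 1 - θ)
    (hu : IsControlled α σ lam Lam η T C ν u) (hO : OscControl T ρ Y β u k c) :
    ∃ c', OscControl T ρ Y β u (k + 1) c' := by
  have hT := hS.T_pos
  have hvneg : (fun x t => -rescale ρ Y β u k c x t) =
      rescale ρ Y β (fun x t => -u x t) k (-c) := by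
    ext x t
    simp only [rescale]
    ring
  set v := rescale ρ Y β u k c with hv
  have hvN : IsNormalized T ω ν₁ v := isNormalized_rescale hS hu hO
  have hvN' : IsNormalized T ω ν₁ fun x t => -v x t := hvN.neg
  have hone : ∀ x ∈ Metric.ball (0 : EuclideanSpace ℝ (Fin n)) (1 / 2), ∀ t ∈ Icc (-(T / 2)) 0,
      |v x t| ≤ 1 := fun x hx t ht =>
    hvN.abs_le_one x (Metric.ball_subset_ball (by norm_num) hx) t ⟨by linarith [ht.1], ht.2⟩
  have hsum : (∫ t in (-T)..(-(T / 2)), ∫ z in Metric.ball 0 1, (1 - v z t)) +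
      (∫ t in (-T)..(-(T / 2)), ∫ z in Metric.ball 0 1, (1 - -v z t)) =
      2 * (volume.real (Metric.ball (0 : EuclideanSpace ℝ (Fin n)) 1) * (T / 2)) := by
    have hsub : Icc (-T) (-(T / 2)) ⊆ Icc (-T) 0 := Icc_subset_Icc le_rfl (by linarith)
    have hle : -T ≤ -(T / 2) := by linarith
    rw [← intervalIntegral.integral_add
      (((continuousOn_integral_one_sub hT.le hvN).mono hsub).intervalIntegrable_of_Icc hle)
      (((continuousOn_integral_one_sub hT.le hvN').mono hsub).intervalIntegrable_of_Icc hle)]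
    have : ∀ t ∈ uIcc (-T) (-(T / 2)), (∫ z in Metric.ball 0 1, (1 - v z t)) +
        (∫ z in Metric.ball 0 1, (1 - -v z t)) =
        volume.real (Metric.ball (0 : EuclideanSpace ℝ (Fin n)) 1) * 2 := by
      intro t ht
      rw [uIcc_of_le hle] at ht
      have ht' : t ∈ Icc (-(2 * T)) 0 := ⟨by linarith [ht.1], by linarith [ht.2]⟩
      rw [← integral_add (hvN.integrableOn_one_sub ht') (hvN'.integrableOn_one_sub ht'),
        ← smul_eq_mul, ← setIntegral_const]
      congr 1
      ext z
      ring
    rw [intervalIntegral.integral_congr this, intervalIntegral.integral_const, smul_eq_mul]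
    ring
  rcases le_or_gt (volume.real (Metric.ball (0 : EuclideanSpace ℝ (Fin n)) 1) * (T / 2))
      (∫ t in (-T)..(-(T / 2)), ∫ z in Metric.ball 0 1, (1 - v z t)) with h | h
  · have hd := hdecay v hvN (isPucciSubsolution_rescale hS hη hu) h
    exact ⟨_, oscControl_succ_of_le hS hO fun x hx t ht =>
      ⟨(abs_le.1 (hone x hx t ht)).1, hd x hx t ht⟩⟩
  · have hd := hdecay (fun x t => -v x t) hvN'
      (by rw [hvneg]; exact isPucciSubsolution_rescale hS hη hu.neg) (by linarith)
    have h1 : OscControl T ρ Y β (fun x t => -u x t) (k + 1) _ :=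
      oscControl_succ_of_le hS hO.neg fun x hx t ht => by
        rw [← hvneg]
        exact ⟨by linarith [(abs_le.1 (hone x hx t ht)).2], hd x hx t ht⟩
    have h2 := h1.neg
    simp only [neg_neg (u _ _)] at h2
    exact ⟨_, h2⟩

theorem exists_oscControl
    (hS : ScaleData α σ T C C₁ ω ν ν₁ θ ρ Y β κ) (hη : 0 ≤ η)
    (hdecay : ∀ v : EuclideanSpace ℝ (Fin n) → ℝ → ℝ, IsNormalized T ω ν₁ v →
      IsPucciSubsolution α σ lam Lam η v (Metric.ball 0 2 ×ˢ Icc (-(2 * T)) 0) →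
      volume.real (Metric.ball (0 : EuclideanSpace ℝ (Fin n)) 1) * (T / 2) ≤
        (∫ t in (-T)..(-(T / 2)), ∫ z in Metric.ball 0 1, (1 - v z t)) →
      ∀ x ∈ Metric.ball 0 (1 / 2), ∀ t ∈ Icc (-(T / 2)) 0, v x t ≤ 1 - θ)
    (hu : IsControlled α σ lam Lam η T C ν u) (k : ℕ) :
    ∃ c, OscControl T ρ Y β u k c := by
  induction k with
  | zero =>
    refine ⟨0, by simp, fun j hj x hx t ht => ?_⟩
    obtain rfl := Nat.le_zero.1 hj
    have := hu.abs_le_one x (by simpa using hx) t (by simpa using ht)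
    norm_num
    exact this
  | succ k ih =>
    obtain ⟨c, hc⟩ := ih
    exact exists_oscControl_succ hS hη hdecay hu hc

/-- Hölder decay of a controlled function at the origin. -/
theorem abs_sub_zero_le
    (hS : ScaleData α σ T C C₁ ω ν ν₁ θ ρ Y β κ) (hη : 0 ≤ η)
    (hdecay : ∀ v : EuclideanSpace ℝ (Fin n) → ℝ → ℝ, IsNormalized T ω ν₁ v →
      IsPucciSubsolution α σ lam Lam η v (Metric.ball 0 2 ×ˢ Icc (-(2 * T)) 0) →
      volume.real (Metric.ball (0 : EuclideanSpace ℝ (Fin n)) 1) * (T / 2) ≤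
        (∫ t in (-T)..(-(T / 2)), ∫ z in Metric.ball 0 1, (1 - v z t)) →
      ∀ x ∈ Metric.ball 0 (1 / 2), ∀ t ∈ Icc (-(T / 2)) 0, v x t ≤ 1 - θ)
    (hu : IsControlled α σ lam Lam η T C ν u) {x : EuclideanSpace ℝ (Fin n)} {t : ℝ}
    (hx : ‖x‖ < 1) (ht : t ≤ 0) (ht' : |t| ≤ 2 * T) :
    |u x t - u 0 0| ≤ 2 * β⁻¹ * (‖x‖ ^ κ + (|t| / (2 * T)) ^ (κ * α / (2 * σ))) := by
  have hβ := hS.β_pos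
  have hρ := hS.ρ_pos
  have hY := hS.Y_pos
  have hT := hS.T_pos
  have hβ1 := hS.β_lt_one
  have hosc : ∀ k : ℕ, ‖x‖ ≤ ρ ^ k → |t| / (2 * T) ≤ Y ^ k → |u x t - u 0 0| ≤ 2 * β ^ k := by
    intro k hxk htk
    obtain ⟨c, hc⟩ := exists_oscControl hS hη hdecay hu k
    have hρk : 0 < ρ ^ k := by positivity
    have hYk : 0 < Y ^ k := by positivity
    have h1 := hc.2 k le_rfl x (by rw [mem_ball_zero_iff]; linarith) t
      ⟨by
        rw [div_le_iff₀ (by positivity), abs_of_nonpos ht] at htk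
        linarith, ht⟩
    have h2 := hc.2 k le_rfl 0 (by rw [mem_ball_zero_iff, norm_zero]; positivity) 0
      ⟨by simp only [Left.neg_nonpos_iff]; positivity, le_rfl⟩
    calc |u x t - u 0 0| = |(u x t - c) - (u 0 0 - c)| := by congr 1; ring
      _ ≤ |u x t - c| + |u 0 0 - c| := abs_sub _ _
      _ ≤ _ := by linarith
  set b : ℝ := ‖x‖ ^ κ + (|t| / (2 * T)) ^ (κ * α / (2 * σ)) with hb
  have hb0 : 0 ≤ b := by positivity
  have hpowρ : ∀ k : ℕ, β ^ k = (ρ ^ k) ^ κ := fun k => by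
    rw [hS.β_eq, ← Real.rpow_natCast, ← Real.rpow_mul hρ.le, mul_comm, Real.rpow_mul hρ.le,
      Real.rpow_natCast]
  have hpowY : ∀ k : ℕ, β ^ k = (Y ^ k) ^ (κ * α / (2 * σ)) := fun k => by
    rw [hS.β_eq', ← Real.rpow_natCast, ← Real.rpow_mul hY.le, mul_comm, Real.rpow_mul hY.le,
      Real.rpow_natCast]
  -- If the point lies in all cylinders, let `k → ∞`. Otherwise use the last one before the first
  -- failure `m`: this costs a factor `β⁻¹`, and the coordinate that fails bounds `β^m`.
  by_cases hall : ∀ k : ℕ, ‖x‖ ≤ ρ ^ k ∧ |t| / (2 * T) ≤ Y ^ k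
  · have hlim : Filter.Tendsto (fun k : ℕ => 2 * β ^ k) Filter.atTop (nhds (2 * 0)) :=
      (tendsto_pow_atTop_nhds_zero_of_lt_one hβ.le hβ1).const_mul 2
    rw [mul_zero] at hlim
    have h0 := ge_of_tendsto' hlim fun k => hosc k (hall k).1 (hall k).2
    exact h0.trans (by positivity)
  · push Not at hall
    classical
    set m := Nat.find hall with hm
    have hspec : ‖x‖ ≤ ρ ^ m → Y ^ m < |t| / (2 * T) := Nat.find_spec hall
    have hm0 : m ≠ 0 := by
      intro h
      rw [h] at hspec
      have := hspec (by simpa using hx.le)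
      rw [pow_zero, lt_div_iff₀ (by positivity)] at this
      linarith
    obtain ⟨j, hj⟩ := Nat.exists_eq_succ_of_ne_zero hm0
    have hjm : ¬ (‖x‖ ≤ ρ ^ j → Y ^ j < |t| / (2 * T)) := Nat.find_min hall (by omega)
    push Not at hjm
    have h1 := hosc j hjm.1 hjm.2
    have hβm : β ^ m ≤ b := by
      have e1 : 0 ≤ ‖x‖ ^ κ := by positivity
      have e2 : 0 ≤ (|t| / (2 * T)) ^ (κ * α / (2 * σ)) := by positivity
      rcases le_or_gt ‖x‖ (ρ ^ m) with h | h
      · rw [hpowY]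
        have := Real.rpow_le_rpow (by positivity) (hspec h).le hS.κ'_nonneg
        linarith
      · rw [hpowρ]
        have := Real.rpow_le_rpow (by positivity) h.le hS.κ_pos.le
        linarith
    calc |u x t - u 0 0| ≤ 2 * β ^ j := h1
      _ = 2 * β⁻¹ * β ^ m := by
        rw [hj, Nat.succ_eq_add_one, pow_succ]; field_simp
      _ ≤ _ := by gcongr

end Iteration

end

/-! ### Choice of parameters and the Hölder estimate -/

noncomputable section

variable {n : ℕ}

/-- Bernoulli: `X^p ≤ 1 + p (X - 1)` for `X = (C r)^ν₁` and `p ≤ 1`. A small `p` makes the growing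
part as small as desired. -/
theorem exists_growth_exponent {C T ω ν₁ : ℝ} (hC : 0 < C) (hT : 0 < T) (hω : 0 < ω)
    (hν₁ : 0 < ν₁) :
    ∃ ν, 0 < ν ∧ ν ≤ ν₁ ∧ ∀ r, 2 * T ≤ r → 2 * (C * r) ^ ν ≤ 2 + ω * r ^ ν₁ := by
  set p : ℝ := min 1 (ω / (2 * C ^ ν₁)) with hp
  have hp0 : 0 < p := by positivity
  have hp1 : p ≤ 1 := min_le_left _ _
  refine ⟨ν₁ * p, by positivity, by nlinarith, fun r hr => ?_⟩
  have hr0 : 0 < r := by linarith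
  have h1 : ((C * r) ^ ν₁) ^ p ≤ 1 + p * ((C * r) ^ ν₁ - 1) := by
    have := rpow_one_add_le_one_add_mul_self (s := (C * r) ^ ν₁ - 1)
      (by linarith [Real.rpow_nonneg (mul_pos hC hr0).le ν₁]) hp0.le hp1
    rwa [add_sub_cancel] at this
  have h2 : p * (C * r) ^ ν₁ ≤ ω / 2 * r ^ ν₁ := by
    calc p * (C * r) ^ ν₁ ≤ ω / (2 * C ^ ν₁) * (C * r) ^ ν₁ := by
          gcongr
          exact min_le_right _ _
      _ = _ := by
          rw [Real.mul_rpow hC.le hr0.le]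
          field_simp
  rw [Real.rpow_mul (by positivity)]
  linarith

/-- The parameters of the iteration exist, uniformly in the order of the time derivative. -/
theorem exists_scaleData {σ α₀ T C ω ν₁ θ : ℝ} (hσ : 0 < σ) (hα₀ : 0 < α₀) (hT : 0 < T)
    (hT' : T ≤ 1 / 2) (hC : 0 < C) (hω : 0 < ω) (hν₁ : 0 < ν₁) (hθ : 0 < θ) (hθ' : θ < 1) :
    ∃ C₁ ν ρ β κ : ℝ, 0 < ν ∧ ν ≤ ν₁ ∧ 0 < κ ∧
      ∀ α, α₀ ≤ α → α < 1 → ∃ Y, ScaleData α σ T C C₁ ω ν ν₁ θ ρ Y β κ := by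
  set ρ : ℝ := min (1 / 4) ((1 / 4) ^ (1 / (2 * σ))) with hρ
  have hρ0 : 0 < ρ := by positivity
  have hρ4 : ρ ≤ 1 / 4 := min_le_left _ _
  have hρσ : ρ ^ (2 * σ) ≤ 1 / 4 := by
    calc ρ ^ (2 * σ) ≤ ((1 / 4) ^ (1 / (2 * σ))) ^ (2 * σ) := by
          gcongr
          exact min_le_right _ _
      _ = _ := by
          rw [← Real.rpow_mul (by norm_num), one_div_mul_cancel (by positivity), Real.rpow_one]
  -- The ratio `Y = ρ^(2σ/α)` depends on `α`; its inverse is largest at `α = α₀`, which gives a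
  -- uniform constant.
  set C₁ : ℝ := C + ρ⁻¹ / 2 + (ρ ^ (2 * σ / α₀))⁻¹ / (2 * T) with hC₁
  have hρi : 0 < ρ⁻¹ / 2 := by positivity
  have hYi : 0 < (ρ ^ (2 * σ / α₀))⁻¹ / (2 * T) := by positivity
  obtain ⟨ν, hν0, hν1, hν⟩ := exists_growth_exponent (C := C₁) (by positivity) hT hω hν₁
  have hl : 0 < Real.logb ρ (1 - θ / 2) :=
    Real.logb_pos_of_base_lt_one hρ0 (by linarith) (by linarith) (by linarith)
  -- The four bounds yield, in order, `κ ≤ ν`, `κα/(2σ) ≤ ν`, `ρ^(2σ) ≤ β` and `1 - θ/2 ≤ β`.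
  set κ : ℝ := min (min ν (2 * σ * ν)) (min (2 * σ) (Real.logb ρ (1 - θ / 2))) with hκ
  have hκ0 : 0 < κ := by positivity
  have hκ1 : κ ≤ ν := (min_le_left _ _).trans (min_le_left _ _)
  have hκ2 : κ ≤ 2 * σ * ν := (min_le_left _ _).trans (min_le_right _ _)
  have hκ3 : κ ≤ 2 * σ := (min_le_right _ _).trans (min_le_left _ _)
  have hκ4 : κ ≤ Real.logb ρ (1 - θ / 2) := (min_le_right _ _).trans (min_le_right _ _)
  refine ⟨C₁, ν, ρ, ρ ^ κ, κ, hν0, hν1, hκ0, fun α hα hα1 => ⟨ρ ^ (2 * σ / α), ?_⟩⟩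
  have hα0 : 0 < α := by linarith
  have hσα : 2 * σ ≤ 2 * σ / α := by
    rw [le_div_iff₀ hα0]
    nlinarith
  exact
  { T_pos := hT
    T_le := hT'
    ρ_pos := hρ0
    ρ_le := hρ4
    Y_pos := by positivity
    Y_le := (Real.rpow_le_rpow_of_exponent_ge hρ0 (by linarith) hσα).trans hρσ
    Y_rpow := by rw [← Real.rpow_mul hρ0.le, div_mul_cancel₀ _ hα0.ne']
    κ_pos := hκ0
    κ_le := hκ1
    κ'_nonneg := by positivity
    κ'_le := by
      rw [div_le_iff₀ (by positivity)]
      nlinarith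
    β_eq := rfl
    β_eq' := by
      rw [← Real.rpow_mul hρ0.le]
      congr 1
      field_simp
    β_ge := by
      have h1 := Real.rpow_le_rpow_of_exponent_ge hρ0 (by linarith) hκ4
      rwa [Real.rpow_logb hρ0 (by linarith) (by linarith)] at h1
    ρ_rpow_le := Real.rpow_le_rpow_of_exponent_ge hρ0 (by linarith) hκ3
    C_nonneg := hC.le
    C_le := by linarith
    ρ_inv_le := by linarith
    Y_inv_le := by
      have h1 : ρ ^ (2 * σ / α₀) ≤ ρ ^ (2 * σ / α) :=
        Real.rpow_le_rpow_of_exponent_ge hρ0 (by linarith) (by gcongr)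
      have h2 : (ρ ^ (2 * σ / α))⁻¹ / (2 * T) ≤ (ρ ^ (2 * σ / α₀))⁻¹ / (2 * T) := by gcongr
      linarith
    growth := hν }

/-- A function on `B_2 × [-2,0]` with the bounds of the Hölder estimate, which together with its
negative is a subsolution of the extremal equation. -/
structure IsPucciBounded (α σ lam Lam F M ν : ℝ) (u : EuclideanSpace ℝ (Fin n) → ℝ → ℝ) :
    Prop where
  measurable : Measurable (Function.uncurry u)
  continuousOn : ContinuousOn (Function.uncurry u) (Metric.ball 0 2 ×ˢ Icc (-2) 0)
  abs_le : ∀ x ∈ Metric.ball 0 2, ∀ t ∈ Icc (-2) 0, |u x t| ≤ M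
  space : ∀ x ∉ Metric.ball 0 2, ∀ t ∈ Icc (-2) 0, |u x t| ≤ M * (4 * ‖x‖) ^ ν
  time : ∀ x ∈ Metric.ball 0 2, ∀ t ≤ -2, |u x t| ≤ M * (4 * |t|) ^ ν
  sub : IsPucciSubsolution α σ lam Lam F u (Metric.ball 0 2 ×ˢ Icc (-2) 0)
  sub_neg : IsPucciSubsolution α σ lam Lam F (fun x t => -u x t) (Metric.ball 0 2 ×ˢ Icc (-2) 0)

section Estimate

variable {α σ lam Lam F M η N T ν : ℝ} {u : EuclideanSpace ℝ (Fin n) → ℝ → ℝ}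

/-- The conditions `r ≤ 1/2` and `2TR ≤ t₀ + 2` keep the zoomed cylinder inside the original one.
Recentring the growth at `(x₀, t₀)` only changes the constant. -/
theorem IsPucciBounded.isControlled (h : IsPucciBounded α σ lam Lam F M ν u) (hσ : 0 ≤ σ)
    (hη : 0 ≤ η) (hN : 0 < N) (hM : M ≤ N) (hF : F ≤ η * N) (hT : 0 < T) (hν : 0 ≤ ν)
    {x₀ : EuclideanSpace ℝ (Fin n)} {t₀ r R : ℝ} (hx₀ : x₀ ∈ Metric.ball 0 1)
    (ht₀ : t₀ ≤ 0) (hr : 0 < r) (hr' : r ≤ 1 / 2) (hR : 0 < R) (hR' : R ≤ 1)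
    (hrR : R ^ α = r ^ (2 * σ)) (hTR : 2 * T * R ≤ t₀ + 2) :
    IsControlled α σ lam Lam η T (4 + 4 / T) ν
      (fun x t => N⁻¹ * (u (x₀ + r • x) (t₀ + R * t) - 0)) := by
  have hx₀' : ‖x₀‖ < 1 := by simpa using hx₀
  have hnorm : ∀ x, ‖x₀ + r • x‖ ≤ 1 + 1 / 2 * ‖x‖ := fun x => by
    calc ‖x₀ + r • x‖ ≤ ‖x₀‖ + r * ‖x‖ := by
          refine (norm_add_le _ _).trans_eq ?_
          rw [norm_smul, Real.norm_of_nonneg hr.le]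
      _ ≤ _ := by gcongr
  have hball : ∀ x ∈ Metric.ball (0 : EuclideanSpace ℝ (Fin n)) 2,
      x₀ + r • x ∈ Metric.ball (0 : EuclideanSpace ℝ (Fin n)) 2 := fun x hx => by
    rw [mem_ball_zero_iff] at hx ⊢
    calc ‖x₀ + r • x‖ ≤ ‖x₀‖ + r * ‖x‖ := by
          refine (norm_add_le _ _).trans_eq ?_
          rw [norm_smul, Real.norm_of_nonneg hr.le]
      _ < 2 := by nlinarith [norm_nonneg x]
  have htime : ∀ t ∈ Icc (-(2 * T)) 0, t₀ + R * t ∈ Icc (-2) 0 := fun t ht =>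
    ⟨by nlinarith [ht.1], by nlinarith [ht.2]⟩
  have hmap : ∀ x t, (x, t) ∈ Metric.ball (0 : EuclideanSpace ℝ (Fin n)) 2 ×ˢ Icc (-(2 * T)) 0 →
      (x₀ + r • x, t₀ + R * t) ∈ Metric.ball (0 : EuclideanSpace ℝ (Fin n)) 2 ×ˢ Icc (-2) 0 :=
    fun x t hp => ⟨hball x hp.1, htime t hp.2⟩
  have habs : ∀ x t {B : ℝ}, |u (x₀ + r • x) (t₀ + R * t)| ≤ M * B → 0 ≤ B →
      |N⁻¹ * (u (x₀ + r • x) (t₀ + R * t) - 0)| ≤ B := fun x t B hB hB0 => by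
    rw [sub_zero, abs_mul, abs_of_pos (inv_pos.2 hN), inv_mul_le_iff₀ hN]
    exact hB.trans (by gcongr)
  have hsrc : N⁻¹ * r ^ (2 * σ) * F ≤ η := by
    have h1 : r ^ (2 * σ) ≤ 1 := Real.rpow_le_one hr.le (by linarith) (by linarith)
    have h2 : (0 : ℝ) ≤ r ^ (2 * σ) := by positivity
    calc N⁻¹ * r ^ (2 * σ) * F ≤ N⁻¹ * r ^ (2 * σ) * (η * N) := by gcongr
      _ = r ^ (2 * σ) * η := by field_simp
      _ ≤ 1 * η := by gcongr
      _ = η := one_mul _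
  have hT4 : 4 / T * T = 4 := div_mul_cancel₀ _ hT.ne'
  have hT4' : 0 < 4 / T := by positivity
  constructor
  · have h1 : Measurable fun p : EuclideanSpace ℝ (Fin n) × ℝ => (x₀ + r • p.1, t₀ + R * p.2) := by
      fun_prop
    exact ((h.measurable.comp h1).sub_const 0).const_mul _
  · have h1 : ContinuousOn (fun p : EuclideanSpace ℝ (Fin n) × ℝ =>
        (x₀ + r • p.1, t₀ + R * p.2)) (Metric.ball 0 2 ×ˢ Icc (-(2 * T)) 0) := by
      fun_prop
    exact continuousOn_const.mul
      ((h.continuousOn.comp h1 fun p hp => hmap p.1 p.2 hp).sub continuousOn_const)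
  · intro x hx t ht
    exact habs x t (by simpa using h.abs_le _ (hball x hx) _ (htime t ht)) zero_le_one
  · intro x hx t ht
    have hx2 : 2 ≤ ‖x‖ := by simpa using hx
    by_cases hb : x₀ + r • x ∈ Metric.ball (0 : EuclideanSpace ℝ (Fin n)) 2
    · refine (habs x t (by simpa using h.abs_le _ hb _ (htime t ht)) zero_le_one).trans ?_
      exact Real.one_le_rpow (by nlinarith) hν
    · refine (habs x t (h.space _ hb _ (htime t ht)) (by positivity)).trans ?_
      gcongr ?_ ^ ν
      nlinarith [hnorm x]
  · intro x hx t ht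
    have ht0 : |t| = -t := abs_of_nonpos (by linarith)
    -- The shift by `t₀ ≥ -2` adds at most `8` to `4|t|`; since `|t| ≥ 2T`, the part `4 / T` of the
    -- constant covers it.
    have h8 : 8 ≤ 4 / T * |t| := by rw [ht0]; nlinarith
    rcases le_total (-2) (t₀ + R * t) with hs | hs
    · refine (habs x t (by simpa using h.abs_le _ (hball x hx) _ ⟨hs, by nlinarith⟩)
        zero_le_one).trans ?_
      exact Real.one_le_rpow (by nlinarith [abs_nonneg t]) hν
    · refine (habs x t (h.time _ (hball x hx) _ hs) (by positivity)).trans ?_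
      gcongr ?_ ^ ν
      rw [abs_of_nonpos (by linarith)]
      rw [ht0] at h8 ⊢
      nlinarith
  · exact (h.sub.affine (inv_pos.2 hN) hr hR hrR x₀ t₀ 0 hmap).mono hsrc subset_rfl
  · have h1 := (h.sub_neg.affine (inv_pos.2 hN) hr hR hrR x₀ t₀ 0 hmap).mono hsrc subset_rfl
    refine (congrArg (fun w => IsPucciSubsolution α σ lam Lam η w _) ?_).mp h1
    ext x t
    ring

variable {C₁ ω ν₁ θ ρ Y β κ : ℝ}

/-- The Hölder estimate for two points of which the first is the later one. -/
theorem IsPucciBounded.abs_sub_le_of_le (h : IsPucciBounded α σ lam Lam F M ν u) (hσ : 0 < σ)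
    (hα : 0 < α) (hα' : α < 1) (hη : 0 ≤ η) (hN : 0 < N) (hM : M ≤ N) (hF : F ≤ η * N)
    (hS : ScaleData α σ T (4 + 4 / T) C₁ ω ν ν₁ θ ρ Y β κ)
    (hdecay : ∀ v : EuclideanSpace ℝ (Fin n) → ℝ → ℝ, IsNormalized T ω ν₁ v →
      IsPucciSubsolution α σ lam Lam η v (Metric.ball 0 2 ×ˢ Icc (-(2 * T)) 0) →
      volume.real (Metric.ball (0 : EuclideanSpace ℝ (Fin n)) 1) * (T / 2) ≤
        (∫ t in (-T)..(-(T / 2)), ∫ z in Metric.ball 0 1, (1 - v z t)) →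
      ∀ x ∈ Metric.ball 0 (1 / 2), ∀ t ∈ Icc (-(T / 2)) 0, v x t ≤ 1 - θ)
    {x y : EuclideanSpace ℝ (Fin n)} (hx : x ∈ Metric.ball 0 1) (hy : y ∈ Metric.ball 0 1)
    {t s : ℝ} (ht : t ∈ Ioc (-2) 0) (hs : s ∈ Icc (-2) 0) (hst : s ≤ t) :
    |u x t - u y s| ≤ 2 * β⁻¹ * (2 ^ κ * (T⁻¹) ^ (κ / (2 * σ))) * N *
      ((‖x - y‖ ^ κ + |t - s| ^ (κ * α / (2 * σ))) / (t + 2) ^ (κ * α / (2 * σ))) := by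
  have hT := hS.T_pos
  have hT' := hS.T_le
  have hκ := hS.κ_pos
  have hβ := hS.β_pos
  set γ : ℝ := κ * α / (2 * σ) with hγ
  have hγ0 : 0 < γ := by positivity
  have hγ1 : γ ≤ κ / (2 * σ) := by
    rw [hγ]
    gcongr
    nlinarith
  set τ : ℝ := t + 2 with hτ
  have hτ0 : 0 < τ := by linarith [ht.1]
  have hτ2 : τ ≤ 2 := by linarith [ht.2]
  -- The zoom fits between the initial time and `t`: `R ≤ τ / 2`, `r ≤ 1 / 2` and `R^α = r^(2σ)`.
  -- Negative powers of `r` and `R` produce the weight in `t + 2`.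
  set r : ℝ := 1 / 2 * (τ / 2) ^ (α / (2 * σ)) with hr
  set R : ℝ := (1 / 2) ^ (2 * σ / α) * (τ / 2) with hR
  have hr0 : 0 < r := by positivity
  have hR0 : 0 < R := by positivity
  have hr1 : r ≤ 1 / 2 := by
    have := Real.rpow_le_one (x := τ / 2) (z := α / (2 * σ)) (by positivity) (by linarith)
      (by positivity)
    linarith
  have hRτ : R ≤ τ / 2 := by
    have := Real.rpow_le_one (x := (1 / 2 : ℝ)) (z := 2 * σ / α) (by positivity) (by norm_num)
      (by positivity)
    nlinarith
  have hrR : R ^ α = r ^ (2 * σ) := by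
    rw [hr, hR, Real.mul_rpow (by positivity) (by positivity),
      Real.mul_rpow (by positivity) (by positivity), ← Real.rpow_mul (by positivity),
      ← Real.rpow_mul (by positivity), div_mul_cancel₀ _ hα.ne',
      div_mul_cancel₀ _ (by positivity)]
  have hctrl := h.isControlled hσ.le hη hN hM hF hT (hS.κ_pos.le.trans hS.κ_le) hx ht.2 hr0 hr1 hR0
    (by linarith) hrR (by nlinarith)
  have hball : ∀ z ∈ Metric.ball (0 : EuclideanSpace ℝ (Fin n)) 1,
      z ∈ Metric.ball (0 : EuclideanSpace ℝ (Fin n)) 2 :=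
    fun z hz => Metric.ball_subset_ball (by norm_num) hz
  have hX : (‖x - y‖ / r) ^ κ ≤ 2 ^ κ * (T⁻¹) ^ (κ / (2 * σ)) * (‖x - y‖ ^ κ / τ ^ γ) := by
    have h1 : r ^ κ = (2 ^ κ * 2 ^ γ)⁻¹ * τ ^ γ := by
      rw [hr, Real.mul_rpow (by positivity) (by positivity), ← Real.rpow_mul (by positivity),
        show α / (2 * σ) * κ = γ by rw [hγ]; ring, Real.div_rpow (by positivity) (by positivity),
        Real.div_rpow (by positivity) (by positivity), Real.one_rpow]
      field_simp
    have h2 : (2 : ℝ) ^ γ ≤ (T⁻¹) ^ (κ / (2 * σ)) := by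
      have h3 : (2 : ℝ) ≤ T⁻¹ := by
        rw [le_inv_comm₀ (by norm_num) hT]
        linarith
      exact (Real.rpow_le_rpow (by norm_num) h3 hγ0.le).trans
        (Real.rpow_le_rpow_of_exponent_le (by linarith) hγ1)
    calc (‖x - y‖ / r) ^ κ = 2 ^ κ * 2 ^ γ * (‖x - y‖ ^ κ / τ ^ γ) := by
          rw [Real.div_rpow (by positivity) hr0.le, h1]
          field_simp
      _ ≤ _ := by gcongr
  have hS' : (|t - s| / R / (2 * T)) ^ γ ≤
      2 ^ κ * (T⁻¹) ^ (κ / (2 * σ)) * (|t - s| ^ γ / τ ^ γ) := by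
    have h1 : ((2 : ℝ) ^ (2 * σ / α)) ^ γ = 2 ^ κ := by
      rw [← Real.rpow_mul (by norm_num)]
      congr 1
      rw [hγ]
      field_simp
    have h2 : (T⁻¹) ^ γ ≤ (T⁻¹) ^ (κ / (2 * σ)) :=
      Real.rpow_le_rpow_of_exponent_le ((one_le_inv₀ hT).2 (by linarith)) hγ1
    calc (|t - s| / R / (2 * T)) ^ γ = (2 ^ (2 * σ / α) * T⁻¹ * (|t - s| / τ)) ^ γ := by
          congr 1
          rw [hR, Real.div_rpow (by positivity) (by positivity), Real.one_rpow]
          field_simp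
      _ = 2 ^ κ * (T⁻¹) ^ γ * (|t - s| ^ γ / τ ^ γ) := by
          rw [Real.mul_rpow (by positivity) (by positivity),
            Real.mul_rpow (by positivity) (by positivity), h1,
            Real.div_rpow (by positivity) (by positivity)]
      _ ≤ _ := by gcongr
  have key : |u x t - u y s| ≤
      N * (2 * β⁻¹ * ((‖x - y‖ / r) ^ κ + (|t - s| / R / (2 * T)) ^ γ)) := by
    -- Nearby points are compared in the zoomed picture, centred at the later point. For the others
    -- the right-hand side is at least `2N`, and the bound on `u` suffices.
    by_cases hnear : ‖x - y‖ < r ∧ |t - s| ≤ 2 * T * R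
    · have hst0 : |t - s| = t - s := abs_of_nonneg (by linarith)
      have h1 := abs_sub_zero_le hS hη hdecay hctrl (x := r⁻¹ • (y - x)) (t := R⁻¹ * (s - t))
        (by
          rw [norm_smul, norm_inv, Real.norm_of_nonneg hr0.le, norm_sub_rev,
            inv_mul_lt_iff₀ hr0, mul_one]
          exact hnear.1)
        (mul_nonpos_of_nonneg_of_nonpos (by positivity) (by linarith))
        (by
          rw [abs_mul, abs_inv, abs_of_pos hR0, abs_sub_comm, inv_mul_le_iff₀ hR0]
          linarith [hnear.2])
      rw [smul_inv_smul₀ hr0.ne', mul_inv_cancel_left₀ hR0.ne', smul_zero, mul_zero, add_zero,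
        add_zero, add_sub_cancel, add_sub_cancel, sub_zero, sub_zero, ← mul_sub, abs_mul,
        abs_of_pos (inv_pos.2 hN), inv_mul_le_iff₀ hN, norm_smul, norm_inv,
        Real.norm_of_nonneg hr0.le, norm_sub_rev, abs_mul, abs_inv, abs_of_pos hR0,
        abs_sub_comm s t, abs_sub_comm (u y s)] at h1
      rwa [div_eq_inv_mul ‖x - y‖, div_eq_inv_mul |t - s|]
    · have h1 : 1 ≤ (‖x - y‖ / r) ^ κ + (|t - s| / R / (2 * T)) ^ γ := by
        have hX0 : 0 ≤ (‖x - y‖ / r) ^ κ := by positivity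
        have hS0 : 0 ≤ (|t - s| / R / (2 * T)) ^ γ := by positivity
        rcases not_and_or.1 hnear with h2 | h2
        · have : 1 ≤ (‖x - y‖ / r) ^ κ :=
            Real.one_le_rpow ((one_le_div hr0).2 (not_lt.1 h2)) hκ.le
          linarith
        · have : 1 ≤ (|t - s| / R / (2 * T)) ^ γ := by
            refine Real.one_le_rpow ?_ hγ0.le
            rw [div_div, one_le_div (by positivity)]
            linarith
          linarith
      have h2 := h.abs_le x (hball x hx) t (Ioc_subset_Icc_self ht)
      have h3 := h.abs_le y (hball y hy) s hs
      have h4 : 1 ≤ β⁻¹ := (one_le_inv₀ hβ).2 hS.β_lt_one.le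
      have h5 : N * (2 * 1 * 1) ≤
          N * (2 * β⁻¹ * ((‖x - y‖ / r) ^ κ + (|t - s| / R / (2 * T)) ^ γ)) := by gcongr
      linarith [abs_sub (u x t) (u y s)]
  refine key.trans ?_
  calc _ ≤ N * (2 * β⁻¹ * (2 ^ κ * (T⁻¹) ^ (κ / (2 * σ)) * (‖x - y‖ ^ κ / τ ^ γ) +
        2 ^ κ * (T⁻¹) ^ (κ / (2 * σ)) * (|t - s| ^ γ / τ ^ γ))) := by gcongr
    _ = _ := by ring

end Estimate

end

/-! ### The Hölder estimate for viscosity solutions -/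

theorem theorem4p3 (n : ℕ) (hn : 1 ≤ n) (lam Lam σ : ℝ) (hlam : 0 < lam) (hLam : lam ≤ Lam)
    (hσ₀ : 0 < σ) (hσ₁ : σ < 1) (α₀ : ℝ) (hα₀ : 0 < α₀) (hα₁ : α₀ < 1) :
    -- the constants depend on `α` only through a lower bound `α₀`: they are uniform as `α → 1`
    ∃ ν ε₀ C κ : ℝ, 0 < ν ∧ ν < α₀ ∧ ν < 2 * σ ∧ 0 < ε₀ ∧ 0 < C ∧ 0 < κ ∧
      ∀ α : ℝ, α₀ ≤ α → α < 1 →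
      ∀ (I J : Type*) [Nonempty I] [Nonempty J]
        (a : I → J → ℝ → EuclideanSpace ℝ (Fin n) → EuclideanSpace ℝ (Fin n) → ℝ),
      IsIsaacsCoeff lam Lam a →
      ∀ (f u : EuclideanSpace ℝ (Fin n) → ℝ → ℝ) (M F : ℝ),
      Measurable (Function.uncurry u) →
      IsViscositySolution α σ a f u (Metric.ball 0 2 ×ˢ Set.Icc (-2) 0) →
      (∀ x ∈ Metric.ball 0 2, ∀ t ∈ Set.Icc (-2) 0, |f x t| ≤ F) →
      (∀ x ∈ Metric.ball 0 2, ∀ t ∈ Set.Icc (-2) 0, |u x t| ≤ M) →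
      (∀ x ∉ Metric.ball 0 2, ∀ t ∈ Set.Icc (-2) 0, |u x t| ≤ M * (4 * ‖x‖) ^ ν) →
      (∀ x ∈ Metric.ball 0 2, ∀ t ≤ -2, |u x t| ≤ M * (4 * |t|) ^ ν) →
      ∀ x ∈ Metric.ball 0 1, ∀ y ∈ Metric.ball 0 1,
      ∀ t ∈ Set.Ioc (-2) 0, ∀ s ∈ Set.Icc (-2) 0,
        |u x t - u y s| ≤ C * (M + ε₀⁻¹ * F) *
          ((‖x - y‖ ^ κ + |t - s| ^ (κ * α / (2 * σ))) / (t + 2) ^ (κ * α / (2 * σ))) := by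

  -- The exponent `min α₀ σ / 2` is below both `α₀` and `2σ`; the exponent of the theorem is a
  -- smaller one, fixed by the iteration.
  obtain ⟨T, θ, η, ω, hT, hT', hθ, hθ', hη, hω, hdecay⟩ :=
    exists_oscillation_decay hn hlam hLam hσ₀ hσ₁ hα₀ hα₁ (ν := min α₀ σ / 2) (by positivity)
      (by linarith [min_le_left α₀ σ]) (by linarith [min_le_right α₀ σ])
  obtain ⟨C₁, ν, ρ, β, κ, hν, hν', hκ, hscale⟩ :=
    exists_scaleData (C := 4 + 4 / T) (ν₁ := min α₀ σ / 2) hσ₀ hα₀ hT hT' (by positivity) hω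
      (by positivity) hθ hθ'
  have hβ : 0 < β := by
    obtain ⟨Y, hS⟩ := hscale α₀ le_rfl hα₁
    exact hS.β_pos
  have hνσ : ν < 2 * σ := by linarith [min_le_right α₀ σ]
  refine ⟨ν, η, 2 * β⁻¹ * (2 ^ κ * (T⁻¹) ^ (κ / (2 * σ))), κ, hν, by linarith [min_le_left α₀ σ],
    hνσ, hη, by positivity, hκ, ?_⟩
  intro α hα hα' I J _ _ a ha f u M F hum hu hf hM hspace htime x hx y hy t ht s hs
  obtain ⟨Y, hS⟩ := hscale α hα hα'
  have hα0 : 0 < α := hα₀.trans_le hα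
  have hball : ∀ z ∈ Metric.ball (0 : EuclideanSpace ℝ (Fin n)) 1,
      z ∈ Metric.ball (0 : EuclideanSpace ℝ (Fin n)) 2 :=
    fun z hz => Metric.ball_subset_ball (by norm_num) hz
  have ht' := Ioc_subset_Icc_self ht
  have hM0 : 0 ≤ M := (abs_nonneg _).trans (hM x (hball x hx) t ht')
  have hF0 : 0 ≤ F := (abs_nonneg _).trans (hf x (hball x hx) t ht')
  have hFη : 0 ≤ η⁻¹ * F := by positivity
  have hτ : 0 < t + 2 := by linarith [ht.1]
  -- The normalisation divides by this quantity; if it is `0` then `M = 0` and `u` vanishes at both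
  -- points.
  rcases (add_nonneg hM0 hFη).eq_or_lt with hN | hN
  · have h1 := hM x (hball x hx) t ht'
    have h2 := hM y (hball y hy) s hs
    rw [← hN, mul_zero, zero_mul]
    linarith [abs_sub (u x t) (u y s)]
  have hgrowth : ∀ p ∈ Metric.ball (0 : EuclideanSpace ℝ (Fin n)) 2 ×ˢ Icc (-2 : ℝ) 0,
      ∃ A, ∀ z, |u z p.2| ≤ A * (1 + ‖z‖) ^ ν := fun p hp => by
    refine ⟨M * 4 ^ ν, fun z => ?_⟩
    rw [mul_assoc, ← Real.mul_rpow (by norm_num) (by positivity)]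
    by_cases hz : z ∈ Metric.ball (0 : EuclideanSpace ℝ (Fin n)) 2
    · refine (hM z hz p.2 hp.2).trans (le_mul_of_one_le_right hM0 ?_)
      exact Real.one_le_rpow (by linarith [norm_nonneg z]) hν.le
    · refine (hspace z hz p.2 hp.2).trans ?_
      gcongr
      linarith
  have hb : IsPucciBounded α σ lam Lam F M ν u :=
    ⟨hum, hu.1.1, hM, hspace, htime,
      hu.1.isPucciSubsolution hn hlam.le hLam hσ₁ hν.le hνσ ha hum hgrowth
        fun p hp => hf p.1 hp.1 p.2 hp.2,
      hu.2.isPucciSubsolution_neg hn hlam.le hLam hσ₁ hν.le hνσ ha hum hgrowth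
        fun p hp => hf p.1 hp.1 p.2 hp.2⟩
  have hFN : F ≤ η * (M + η⁻¹ * F) := by
    rw [mul_add, mul_inv_cancel_left₀ hη.ne']
    linarith [mul_nonneg hη.le hM0]
  have hMN : M ≤ M + η⁻¹ * F := by linarith
  rcases le_total s t with hst | hst
  · exact hb.abs_sub_le_of_le hσ₀ hα0 hα' hη.le hN hMN hFN hS (hdecay α hα hα') hx hy ht hs hst
  -- Centred at the later time `s`, the estimate has `s + 2 ≥ t + 2` in the denominator and is the
  -- stronger one.
  · have h1 := hb.abs_sub_le_of_le hσ₀ hα0 hα' hη.le hN hMN hFN hS (hdecay α hα hα') hy hx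
      ⟨ht.1.trans_le hst, hs.2⟩ ht' hst
    rw [abs_sub_comm, norm_sub_rev, abs_sub_comm s t] at h1
    refine h1.trans ?_
    have h2 := hS.κ'_nonneg
    gcongr
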